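/- Let $k$ be a field and $r\ge 1$ an integer. Let $a(s,t), b(s,t)\in k[s,t]$ be homogeneous polynomials of degrees $r$ and $2r$ respectively (one of them may be zero, but not both; so $\max\{2\deg a,\deg b\}=2r$), and let $\Theta$ be the closed subscheme of the weighted projective space $\mathbb P(1,1,r)=\operatorname{Proj} k[s,t,z]$ defined by $$z^2+a(s,t)z+b(s,t)=0 .$$ Suppose that $\Theta$ is reduced, let $\tilde\Theta\to\Theta$ be its normalization, and let $\psi:\Theta\to\mathbb P^1_k$ be the projection $[s:t:z]\mapsto[s:t]$. For a closed point $q\in\mathbb P^1_k$ with residue field $k(q)$, put $A=\mathcal O_{\mathbb P^1_k,q}$, let $\mathfrak m$ be its maximal ideal and let $B=(\psi_*\mathcal O_\Theta)_q$. The multiplicity $\lambda_q(\Theta)\in\mathbb N\cup\{+\infty\}$ is the supremum of $\min\{2\operatorname{ord}_{\mathfrak m}(\alpha),\operatorname{ord}_{\mathfrak m}(\beta)\}$ over all $y\in B$, $\alpha,\beta\in A$ with $B=A[y]$ and $y^2+\alpha y+\beta=0$, where $\operatorname{ord}_{\mathfrak m}(x)=\sup\{n : x\in\mathfrak m^n\}$.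 For a proper curve $C$ over $k$, $p_a(C)=1-\chi(\mathcal O_C)$. Below, $[x]$ denotes the integral part of $x$, and $q$ runs through the closed points of $\mathbb P^1_k$. 1. The morphism $\psi:\Theta\to\mathbb P^1_k$ is a finite flat morphism of $k$-schemes of degree $2$. Moreover $H^0(\Theta,\mathcal O_\Theta)=k$ and $p_a(\Theta)=r-1$. 2. If $\psi$ is generically étale, then $\lambda_q(\Theta)=0$ for all but finitely many $q$, and $$\sum_{q}\lambda_q(\Theta)[k(q):k]\le 2r.$$ 3. Suppose that $\psi$ is purely inseparable. Then $[\lambda_q(\Theta)/2]=0$ for all but finitely many $q$, and: (a) if $H^0(\tilde\Theta,\mathcal O_{\tilde\Theta})=k$, then $\displaystyle\sum_{q}2[\lambda_q(\Theta)/2][k(q):k]\le 2r-2$; (b) otherwise, $\displaystyle\sum_{q}2[\lambda_q(\Theta)/2][k(q):k]=2r$, and $\lambda_q(\Theta)$ is even for every $q$ with $k(q)=k$. 4. In all cases, $\lambda_q(\Theta)\le 2r$ for every $q$ (in particular $\lambda_q(\Theta)$ is finite). -/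

import Mathlib

universe u

open AlgebraicGeometry CategoryTheory TopologicalSpace

namespace DoubleCover

noncomputable section

/-! ### The multiplicity of a double cover at a point -/

section Multiplicity

/-- `ord_m(a)`: the supremum of the integers `n` with `a ∈ m ^ n`; it is `⊤` for `a = 0`. -/
def ordAt {A : Type*} [CommRing A] (m : Ideal A) (a : A) : ℕ∞ :=
  ⨆ n : {n : ℕ // a ∈ m ^ n}, ((n : ℕ) : ℕ∞)

/-- `λ_m(B)`: the supremum of `min {2 ord_m(a), ord_m(b)}` over all generators `y` of the
`A`-algebra `B` and all equations `y² + a y + b = 0` with `a, b ∈ A`. -/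
def multiplicity {A : Type*} [CommRing A] (m : Ideal A) (B : Type*) [CommRing B] [Algebra A B] :
    ℕ∞ :=
  ⨆ (y : B) (a : A) (b : A) (_ : Algebra.adjoin A {y} = ⊤)
    (_ : y ^ 2 + algebraMap A B a * y + algebraMap A B b = 0), min (2 * ordAt m a) (ordAt m b)

variable {Y Z : Scheme.{u}} (ψ : Y ⟶ Z) (q : Z)

/-- The stalk `(ψ_* 𝒪_Y)_q`. -/
abbrev pushforwardStalk : CommRingCat.{u} :=
  (((TopCat.Presheaf.pushforward CommRingCat.{u} ψ.base).obj Y.presheaf).stalk q)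

/-- The ring map `𝒪_{Z,q} ⟶ (ψ_* 𝒪_Y)_q`. -/
def toPushforwardStalk : Z.presheaf.stalk q ⟶ pushforwardStalk ψ q :=
  (TopCat.Presheaf.stalkFunctor CommRingCat.{u} q).map ψ.c

/-- `λ_q(Y)`, the multiplicity of `ψ : Y ⟶ Z` at `q ∈ Z`. -/
def lam : ℕ∞ :=
  letI : Algebra (Z.presheaf.stalk q) (pushforwardStalk ψ q) :=
    (toPushforwardStalk ψ q).hom.toAlgebra
  multiplicity (IsLocalRing.maximalIdeal (Z.presheaf.stalk q)) (pushforwardStalk ψ q)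

end Multiplicity

/-- `ψ` is generically étale: étale over a dense open subset of the target. -/
def GenericallyEtale {Y Z : Scheme.{u}} (ψ : Y ⟶ Z) : Prop :=
  ∃ U : Z.Opens, Dense (U : Set Z) ∧ Etale (ψ ∣_ U)

/-! ### Schemes over a field -/

section OverField

variable {k : Type u} [Field k] {X : Scheme.{u}} (p : X ⟶ Spec (.of k))

lemma le_preimage_top (U : X.Opens) : U ≤ p ⁻¹ᵁ ⊤ := fun _ _ => trivial

/-- The structure map `k → Γ(X, U)` of a scheme `p : X ⟶ Spec k`. -/
def toSections (U : X.Opens) : k →+* Γ(X, U) :=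
  ((Scheme.ΓSpecIso (.of k)).inv ≫ p.appLE ⊤ U (le_preimage_top p U)).hom

/-- The ring `𝒪_X(U)`, regarded as a `k`-algebra through `p : X ⟶ Spec k`. -/
def Sections (_p : X ⟶ Spec (.of k)) (U : X.Opens) : Type u := Γ(X, U)

instance (U : X.Opens) : CommRing (Sections p U) := inferInstanceAs (CommRing Γ(X, U))

instance (U : X.Opens) : Algebra k (Sections p U) := (toSections p U).toAlgebra

/-- Restriction of sections, as a map of `k`-algebras. -/
def resₐ {U V : X.Opens} (h : V ≤ U) : Sections p U →ₐ[k] Sections p V where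
  __ := (X.presheaf.map (homOfLE h).op).hom
  commutes' c := by
    change ((Scheme.ΓSpecIso (.of k)).inv ≫ p.appLE ⊤ U (le_preimage_top p U) ≫
      X.presheaf.map (homOfLE h).op).hom c = toSections p V c
    rw [Scheme.Hom.appLE_map]
    rfl

/-- `H⁰(X, 𝒪_X) = k`: the structure map is bijective. -/
def GlobalSectionsEqBase : Prop := Function.Bijective (algebraMap k (Sections p ⊤))

/-- The residue field `k(q)` as a `k`-algebra. -/
def residueMap (q : X) : k →+* X.residueField q :=
  (X.evaluation ⊤ q trivial).hom.comp (toSections p ⊤)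

/-- The degree `[k(q) : k]`. -/
def residueDegree (q : X) : ℕ :=
  letI := (residueMap p q).toAlgebra
  Module.finrank k (X.residueField q)

/-- The Čech differential `𝒪_X(U) × 𝒪_X(V) → 𝒪_X(U ∩ V)`, `(f, g) ↦ f - g`. -/
def cechDifferential (U V : X.Opens) :
    (Sections p U × Sections p V) →ₗ[k] Sections p (U ⊓ V) :=
  (resₐ p inf_le_left).toLinearMap ∘ₗ LinearMap.fst k _ _ -
    (resₐ p inf_le_right).toLinearMap ∘ₗ LinearMap.snd k _ _

/-- The Čech cohomology group `H⁰` of `𝒪_X` with respect to `{U, V}`. -/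
abbrev CechH0 (U V : X.Opens) : Type u := LinearMap.ker (cechDifferential p U V)

/-- The Čech cohomology group `H¹` of `𝒪_X` with respect to `{U, V}`. -/
abbrev CechH1 (U V : X.Opens) : Type u :=
  Sections p (U ⊓ V) ⧸ LinearMap.range (cechDifferential p U V)

/-- `X` is a separated `k`-scheme covered by two affine open subsets `U, V`, so that the
cohomology of `𝒪_X` is that of the (alternating) Čech complex of `{U, V}`; this cohomology is
finite dimensional, and `p_a(X) = 1 - χ(𝒪_X)` equals `g`. -/
structure HasArithmeticGenus (U V : X.Opens) (g : ℤ) : Prop where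
  separated : X.IsSeparated
  affine_left : IsAffineOpen U
  affine_right : IsAffineOpen V
  cover : U ⊔ V = ⊤
  finite_H0 : Module.Finite k (CechH0 p U V)
  finite_H1 : Module.Finite k (CechH1 p U V)
  eq : 1 - ((Module.finrank k (CechH0 p U V) : ℤ) - Module.finrank k (CechH1 p U V)) = g

end OverField

/-! ### Normalization -/

section Normalization

/-- The disjoint union of the spectra of the residue fields at the generic points of the
irreducible components of `X`. -/
abbrev genericFibers (X : Scheme.{u}) : Scheme.{u} :=
  ∐ fun η : genericPoints X => Spec (X.residueField η.1)

/-- The canonical morphism from `genericFibers X` to `X`. -/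
def genericFibersTo (X : Scheme.{u}) : genericFibers X ⟶ X :=
  Limits.Sigma.desc fun η : genericPoints X => X.fromSpecResidueField η.1

variable (X : Scheme.{u}) [X.IsSeparated] [NoetherianSpace X]

instance : Finite (genericPoints X) :=
  (genericPoints.finite NoetherianSpace.finite_irreducibleComponents).to_subtype

instance : QuasiCompact (genericFibersTo X) :=
  inferInstance

instance : QuasiSeparated (genericFibersTo X) :=
  inferInstance

/-- The normalization of a reduced, separated scheme `X` with noetherian underlying space: the
relative normalization of `X` in the disjoint union of its generic points (at which the local
ring of `X` is the residue field, as `X` is reduced). -/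
def normalization : Scheme.{u} := (genericFibersTo X).normalization

/-- The normalization morphism. -/
def normalizationTo : normalization X ⟶ X := (genericFibersTo X).fromNormalization

end Normalization

/-! ### Proj of a quotient, projections between Proj -/

section GradedQuotient

variable {k R : Type u} [Field k] [CommRing R] [Algebra k R] (𝒜 : ℕ → Submodule k R)

/-- The grading on `R ⧸ I` induced by a grading on `R`. -/
def quotientGrading (I : Ideal R) (n : ℕ) : Submodule k (R ⧸ I) :=
  (𝒜 n).map (Ideal.Quotient.mkₐ k I).toLinearMap

variable [GradedAlgebra 𝒜]

/-- If `I` is homogeneous, the induced grading makes `R ⧸ I` a graded algebra. -/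
@[reducible]
def quotientGradedAlgebra (I : Ideal R) (hI : I.IsHomogeneous 𝒜) :
    GradedAlgebra (quotientGrading 𝒜 I) :=
  haveI : SetLike.GradedMonoid (quotientGrading 𝒜 I) :=
    { one_mem := ⟨1, SetLike.GradedOne.one_mem, map_one (Ideal.Quotient.mk I)⟩
      mul_mem := by
        rintro i j _ _ ⟨x, hx, rfl⟩ ⟨y, hy, rfl⟩
        exact ⟨x * y, SetLike.GradedMul.mul_mem hx hy, map_mul (Ideal.Quotient.mk I) x y⟩ }
  have hint : DirectSum.IsInternal (quotientGrading 𝒜 I) := by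
    classical
    constructor
    · rw [injective_iff_map_eq_zero]
      intro z hz
      have hx : ∀ i, ∃ x : 𝒜 i, (Ideal.Quotient.mk I (x : R)) = (z i : R ⧸ I) := by
        intro i
        obtain ⟨x, hx, e⟩ := (z i).2
        exact ⟨⟨x, hx⟩, e⟩
      choose x hx using hx
      have hsum : (∑ i ∈ z.support, (x i : R)) ∈ I := by
        rw [← Ideal.Quotient.eq_zero_iff_mem, map_sum]
        simp only [hx]
        rw [← hz, DirectSum.coeAddMonoidHom_eq_dfinsuppSum]
        rfl
      ext i
      by_cases hi : i ∈ z.support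
      · have := hI i hsum
        rw [DirectSum.decompose_sum, DFinsupp.finsetSum_apply, AddSubmonoidClass.coe_finsetSum,
          Finset.sum_eq_single i] at this
        · rw [DirectSum.decompose_coe, DirectSum.of_eq_same, ← Ideal.Quotient.eq_zero_iff_mem,
            hx] at this
          simpa using this
        · intro j _ hj
          rw [DirectSum.decompose_coe, DirectSum.of_eq_of_ne _ _ _ hj.symm]
          rfl
        · exact fun h => absurd hi h
      · simpa using hi
    · intro y
      obtain ⟨x, rfl⟩ := Ideal.Quotient.mk_surjective y
      rw [← DirectSum.sum_support_decompose 𝒜 x, map_sum]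
      refine ⟨∑ i ∈ (DirectSum.decompose 𝒜 x).support, DirectSum.of (fun i => quotientGrading 𝒜 I i)
        i ⟨_, (DirectSum.decompose 𝒜 x i), (DirectSum.decompose 𝒜 x i).2, rfl⟩, ?_⟩
      rw [map_sum]
      refine Finset.sum_congr rfl fun i _ => ?_
      rw [DirectSum.coeAddMonoidHom_of]
      rfl
  { hint.chooseDecomposition with }

end GradedQuotient

section Projection

open HomogeneousLocalization

variable {A B σ τ : Type u} [CommRing A] [SetLike σ A] [AddSubgroupClass σ A]
  [CommRing B] [SetLike τ B] [AddSubgroupClass τ B]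
  {𝒜 : ℕ → σ} {ℬ : ℕ → τ} [GradedRing 𝒜] [GradedRing ℬ]

lemma awayMap_comp_map (f : 𝒜 →+*ᵍ ℬ) {d e : ℕ} {s t x : A} (hs : s ∈ 𝒜 d) (ht : t ∈ 𝒜 e)
    (hx : x = s * t) (hx' : f x = f s * f t) :
    (awayMap ℬ (Graded.map_mem f ht) hx').comp (Away.map f s) =
      (Away.map f x).comp (awayMap 𝒜 ht hx) := by
  ext y
  obtain ⟨n, a, ha, rfl⟩ := Away.mk_surjective 𝒜 hs y
  simp [awayMap_mk, Away.map_mk]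

/-- The affine open cover of `Proj ℬ` by the `D₊(f (s i))`. -/
@[simps! I₀ X f]
def projCover (f : 𝒜 →+*ᵍ ℬ) {ι : Type u} (s : ι → A) (d : ι → ℕ) (hs : ∀ i, s i ∈ 𝒜 (d i))
    (hd : ∀ i, 0 < d i) (hcov : ⨆ i, Proj.basicOpen ℬ (f (s i)) = ⊤) :
    (Proj ℬ).AffineOpenCover where
  I₀ := ι
  X i := .of (Away ℬ (f (s i)))
  f i := Proj.awayι ℬ (f (s i)) (Graded.map_mem f (hs i)) (hd i)
  idx x := (Opens.mem_iSup.mp (hcov.ge (Set.mem_univ x))).choose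
  covers x := by
    change x ∈ (Proj.awayι ℬ _ _ _).opensRange
    rw [Proj.opensRange_awayι]
    exact (Opens.mem_iSup.mp (hcov.ge (Set.mem_univ x))).choose_spec

/-- A homomorphism of graded rings `f : 𝒜 → ℬ` and homogeneous elements `s i ∈ 𝒜` of positive
degree such that the `D₊(f (s i))` cover `Proj ℬ` give a morphism `Proj ℬ ⟶ Proj 𝒜`,
which on `D₊(f (s i))` is `Spec` of the map `𝒜_(s i) → ℬ_(f (s i))` induced by `f`. -/
def projMap (f : 𝒜 →+*ᵍ ℬ) {ι : Type u} (s : ι → A) (d : ι → ℕ) (hs : ∀ i, s i ∈ 𝒜 (d i))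
    (hd : ∀ i, 0 < d i) (hcov : ⨆ i, Proj.basicOpen ℬ (f (s i)) = ⊤) : Proj ℬ ⟶ Proj 𝒜 :=
  (projCover f s d hs hd hcov).openCover.glueMorphisms
    (fun i => Spec.map (CommRingCat.ofHom (Away.map f (s i))) ≫ Proj.awayι 𝒜 (s i) (hs i) (hd i))
    (by
      have key : ∀ i j, Spec.map (CommRingCat.ofHom
            (awayMap ℬ (Graded.map_mem f (hs j)) (map_mul f (s i) (s j)))) ≫
          Spec.map (CommRingCat.ofHom (Away.map f (s i))) ≫ Proj.awayι 𝒜 (s i) (hs i) (hd i) =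
          Spec.map (CommRingCat.ofHom (Away.map f (s i * s j))) ≫ Proj.awayι 𝒜 (s i * s j)
            (SetLike.mul_mem_graded (hs i) (hs j)) ((hd i).trans_le (Nat.le_add_right _ _)) := by
        intro i j
        rw [← Spec.map_comp_assoc, ← CommRingCat.ofHom_comp,
          awayMap_comp_map f (hs i) (hs j) rfl (map_mul f (s i) (s j)), CommRingCat.ofHom_comp,
          Spec.map_comp_assoc, Proj.SpecMap_awayMap_awayι]
      have key' : ∀ i j : ι, Limits.pullback.fst
            (Proj.awayι ℬ (f (s i)) (Graded.map_mem f (hs i)) (hd i))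
            (Proj.awayι ℬ (f (s j)) (Graded.map_mem f (hs j)) (hd j)) ≫
            Spec.map (CommRingCat.ofHom (Away.map f (s i))) ≫ Proj.awayι 𝒜 (s i) (hs i) (hd i) =
          Limits.pullback.snd _ _ ≫
            Spec.map (CommRingCat.ofHom (Away.map f (s j))) ≫
              Proj.awayι 𝒜 (s j) (hs j) (hd j) := by
        intro i j
        rw [← Proj.pullbackAwayιIso_hom_SpecMap_awayMap_left ℬ (Graded.map_mem f (hs i)) (hd i)
            (Graded.map_mem f (hs j)) (hd j) (map_mul f (s i) (s j)),
          ← Proj.pullbackAwayιIso_hom_SpecMap_awayMap_right ℬ (Graded.map_mem f (hs i)) (hd i)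
            (Graded.map_mem f (hs j)) (hd j) (map_mul f (s i) (s j)),
          Category.assoc, Category.assoc, key i j]
        congr 1
        have h := awayMap_comp_map f (hs j) (hs i) (mul_comm (s i) (s j))
          ((map_mul f (s i) (s j)).trans (mul_comm _ _))
        rw [← Spec.map_comp_assoc, ← CommRingCat.ofHom_comp, h, CommRingCat.ofHom_comp,
            Spec.map_comp_assoc, Proj.SpecMap_awayMap_awayι]
        rfl
      exact key')

end Projection

/-! ### The curve `z² + a(s,t) z + b(s,t) = 0` in `ℙ(1,1,r)` -/

section Curve

open MvPolynomial

section ProjOver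

variable {k R : Type u} [Field k] [CommRing R] [Algebra k R] (𝒜 : ℕ → Submodule k R)
  [GradedAlgebra 𝒜]

/-- The structure morphism `Proj 𝒜 ⟶ Spec k` for a graded `k`-algebra `𝒜`. -/
def projOver : Proj 𝒜 ⟶ Spec (.of k) :=
  Proj.toSpecZero 𝒜 ≫ Spec.map (CommRingCat.ofHom (algebraMap k (𝒜 0)))

instance [IsNoetherianRing R] : NoetherianSpace (Proj 𝒜) := by
  have : NoetherianSpace (ProjectiveSpectrum 𝒜) := by
    let i : ProjectiveSpectrum 𝒜 → PrimeSpectrum R := fun x => ⟨x.1.toIdeal, x.2⟩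
    have hi : Topology.IsInducing i := by
      constructor
      refine TopologicalSpace.ext_iff_isClosed.mpr fun Z => ?_
      rw [isClosed_induced_iff, ProjectiveSpectrum.isClosed_iff_zeroLocus]
      constructor
      · rintro ⟨t, rfl⟩
        exact ⟨_, PrimeSpectrum.isClosed_zeroLocus t, rfl⟩
      · rintro ⟨_, ht, rfl⟩
        obtain ⟨t, rfl⟩ := (PrimeSpectrum.isClosed_iff_zeroLocus _).mp ht
        exact ⟨t, rfl⟩
    exact hi.noetherianSpace
  exact this

end ProjOver

variable (k : Type u) [Field k] (r : ℕ)

/-- The grading of `k[s, t, z] = k[X 0, X 1, X 2]` with weights `1, 1, r`. -/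
abbrev weightedGrading : ℕ → Submodule k (MvPolynomial (Fin 3) k) :=
  weightedHomogeneousSubmodule k ![1, 1, r]

instance : GradedAlgebra (weightedGrading k r) := weightedGradedAlgebra k ![1, 1, r]

instance : GradedAlgebra (homogeneousSubmodule (Fin 2) k) := MvPolynomial.gradedAlgebra

/-- The projective line `Proj k[s, t]`. -/
abbrev P1 : Scheme.{u} := Proj (homogeneousSubmodule (Fin 2) k)

/-- The structure morphism `ℙ¹ ⟶ Spec k`. -/
abbrev P1Over : P1 k ⟶ Spec (.of k) := projOver (homogeneousSubmodule (Fin 2) k)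

variable {k r} (a : homogeneousSubmodule (Fin 2) k r) (b : homogeneousSubmodule (Fin 2) k (2 * r))

/-- The polynomial `z² + a(s,t) z + b(s,t)`. -/
def curveEquation : MvPolynomial (Fin 3) k :=
  X 2 ^ 2 + rename Fin.castSucc a.1 * X 2 + rename Fin.castSucc b.1

lemma rename_mem {n : ℕ} {c : MvPolynomial (Fin 2) k} (hc : c ∈ homogeneousSubmodule (Fin 2) k n) :
    rename Fin.castSucc c ∈ weightedGrading k r n := by
  rw [mem_weightedHomogeneousSubmodule]
  intro d hd
  obtain ⟨e, rfl, he⟩ := coeff_rename_ne_zero _ _ _ hd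
  have h1 := hc he
  rw [Finsupp.weight_apply, Finsupp.sum_mapDomain_index (by simp) (by simp [add_mul])]
  rw [Finsupp.weight_apply] at h1
  rw [← h1]
  refine Finsupp.sum_congr fun i _ => ?_
  fin_cases i <;> rfl

lemma curveEquation_mem : curveEquation a b ∈ weightedGrading k r (2 * r) := by
  have hz : (X 2 : MvPolynomial (Fin 3) k) ∈ weightedGrading k r r :=
    isWeightedHomogeneous_X k ![1, 1, r] 2
  refine add_mem (add_mem ?_ ?_) (rename_mem b.2)
  · have := SetLike.pow_mem_graded (A := weightedGrading k r) 2 hz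
    simpa using this
  · have := SetLike.mul_mem_graded (A := weightedGrading k r) (rename_mem (r := r) a.2) hz
    rwa [← two_mul] at this

/-- The homogeneous coordinate ring `k[s, t, z] / (z² + a z + b)`. -/
abbrev CoordinateRing : Type u := MvPolynomial (Fin 3) k ⧸ Ideal.span {curveEquation a b}

/-- The grading of the homogeneous coordinate ring, with `s, t, z` of degrees `1, 1, r`. -/
abbrev curveGrading : ℕ → Submodule k (CoordinateRing a b) :=
  quotientGrading (weightedGrading k r) (Ideal.span {curveEquation a b})

instance : GradedAlgebra (curveGrading a b) :=
  quotientGradedAlgebra _ _ (Ideal.homogeneous_span _ _ (by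
    rintro x rfl
    exact ⟨_, curveEquation_mem a b⟩))

/-- The closed subscheme `Θ` of `ℙ(1,1,r) = Proj k[s, t, z]` defined by `z² + a z + b = 0`. -/
abbrev Curve : Scheme.{u} := Proj (curveGrading a b)

/-- The structure morphism `Θ ⟶ Spec k`. -/
abbrev curveOver : Curve a b ⟶ Spec (.of k) := projOver (curveGrading a b)

/-- The homomorphism of graded rings `k[s, t] → k[s, t, z] / (z² + a z + b)`. -/
def coordinateMap : homogeneousSubmodule (Fin 2) k →+*ᵍ curveGrading a b where
  __ := (Ideal.Quotient.mk (Ideal.span {curveEquation a b})).comp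
    (rename Fin.castSucc : MvPolynomial (Fin 2) k →ₐ[k] MvPolynomial (Fin 3) k).toRingHom
  map_mem := fun {_ x} hx => ⟨rename Fin.castSucc x, rename_mem hx, rfl⟩

/-- The open subset `D₊(s)` (`i = 0`) or `D₊(t)` (`i = 1`) of `Θ`. -/
abbrev chart (i : Fin 2) : (Curve a b).Opens :=
  Proj.basicOpen (curveGrading a b) (coordinateMap a b (X i))

lemma iSup_chart (hr : 0 < r) : ⨆ i : ULift.{u} (Fin 2), chart a b i.down = ⊤ := by
  refine top_le_iff.mp fun x _ => Opens.mem_iSup.mpr ?_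
  by_contra! H
  have hst : ∀ i : Fin 2, coordinateMap a b (X i) ∈ x.asHomogeneousIdeal.toIdeal := by
    intro i
    have := H ⟨i⟩
    rwa [Proj.mem_basicOpen, not_not] at this
  let P : Ideal (MvPolynomial (Fin 3) k) :=
    x.asHomogeneousIdeal.toIdeal.comap (Ideal.Quotient.mk (Ideal.span {curveEquation a b}))
  have hP : P.IsPrime := Ideal.IsPrime.comap (hK := x.isPrime) _
  have hpos : ∀ {n : ℕ} {c : MvPolynomial (Fin 2) k}, 0 < n →
      c ∈ homogeneousSubmodule (Fin 2) k n → rename Fin.castSucc c ∈ P := by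
    intro n c hn hc
    have h1 : c ∈ Ideal.span (X '' (Set.univ : Set (Fin 2))) := by
      rw [mem_ideal_span_X_image]
      intro m hm
      by_contra! h0
      have h2 : m = 0 := by ext i; simpa using h0 i
      have h3 := hc (mem_support_iff.mp hm)
      rw [h2] at h3
      simp at h3
      omega
    have h2 : Ideal.span (X '' (Set.univ : Set (Fin 2))) ≤
        P.comap (rename Fin.castSucc : MvPolynomial (Fin 2) k →ₐ[k] _).toRingHom := by
      rw [Ideal.span_le]
      rintro _ ⟨i, _, rfl⟩
      exact hst i
    exact h2 h1
  have hz : (X 2 : MvPolynomial (Fin 3) k) ∈ P := by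
    have h0 : curveEquation a b ∈ P := by
      change Ideal.Quotient.mk _ _ ∈ x.asHomogeneousIdeal.toIdeal
      rw [Ideal.Quotient.eq_zero_iff_mem.mpr (Ideal.subset_span (Set.mem_singleton _))]
      exact zero_mem _
    have h1 : (X 2 : MvPolynomial (Fin 3) k) ^ 2 ∈ P := by
      have h2 := P.add_mem (P.mul_mem_right (X 2) (hpos hr a.2)) (hpos (by omega) b.2)
      have h3 := P.sub_mem h0 h2
      have h4 : curveEquation a b - (rename Fin.castSucc a.1 * X 2 + rename Fin.castSucc b.1) =
        X 2 ^ 2 := by unfold curveEquation; ring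
      rwa [h4] at h3
    exact hP.mem_of_pow_mem 2 h1
  refine x.not_irrelevant_le ((HomogeneousIdeal.toIdeal_irrelevant_le _).mpr ?_)
  rintro i hi _ ⟨f, hf, rfl⟩
  change f ∈ P
  have h1 : f ∈ Ideal.span (X '' (Set.univ : Set (Fin 3))) := by
    rw [mem_ideal_span_X_image]
    intro m hm
    by_contra! h0
    have h2 : m = 0 := by ext i; simpa using h0 i
    have h3 := hf (mem_support_iff.mp hm)
    rw [h2] at h3
    simp at h3
    omega
  have h2 : Ideal.span (X '' (Set.univ : Set (Fin 3))) ≤ P := by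
    rw [Ideal.span_le]
    rintro _ ⟨i, _, rfl⟩
    fin_cases i
    · simpa [coordinateMap, P] using hst 0
    · simpa [coordinateMap, P] using hst 1
    · exact hz
  exact h2 h1

/-- The double cover `Θ ⟶ ℙ¹`, `[s : t : z] ↦ [s : t]`. -/
def curveToP1 (hr : 0 < r) : Curve a b ⟶ P1 k :=
  projMap (coordinateMap a b) (fun i : ULift.{u} (Fin 2) => X i.down) (fun _ => 1)
    (fun i => isHomogeneous_X k i.down) (fun _ => Nat.one_pos) (iSup_chart a b hr)

end Curve

end

end DoubleCover

/-! Over each standard chart of `ℙ¹`, with coordinate `u`, the curve is the spectrum of the free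
algebra `k[u][y]/(y² + αy + β)`, where `α, β` dehomogenize `a, b`; on the overlap `y₁ = u₁^r y₀`.
Hence `ψ_* 𝒪 = 𝒪 ⊕ 𝒪(-r)`. This gives finiteness, flatness and degree two, and the Čech complex of
the two charts gives `H⁰ = k` and `dim H¹ = r - 1` (`cechDifferential_chartEquiv`,
`hasArithmeticGenus`).

Two generators of the local algebra are related by `y = p + eY` with `e` a unit, and the
discriminant changes by `e²` (`generator_change`). So `λ_q` is at most the order at `q` of the
discriminant `a² - 4b`, a form of degree `2r`. If this form is nonzero, its zeros have total degree
at most `2r` (`sum_mul_placeDegree_le`), which bounds the sum of the `λ_q` and each of them. Generic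
étaleness makes it nonzero, because a zero discriminant would make the geometric generic fibre
nonreduced.

If the discriminant is zero, as it is for a universally injective `ψ`, reducedness forces
characteristic two, `a = 0` and `β` nonsquare. The curve is then `y² = β`, and `λ_q ≥ n` means that
`π^n` divides `β + x²` for some polynomial `x`. The tool here is `evenMap`: operators on `k[u]` that
are linear over squares and kill squares, a substitute for derivations that also sees the
imperfection of `k`. One of them sends `β` to a nonzero section of `𝒪(2r)`, which vanishes to order
`2m` wherever `β + x²` does for some `x`. This bounds the sum of the `2[λ_q/2] deg q` by `2r`.

If the bound is attained, the local square roots `x` glue, by the Chinese remainder theorem with a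
condition at infinity, to one polynomial `l` of degree at most `r`, and a degree count gives `β = c
w² + l²` with `c` constant (`exists_eq_mul_sq_add_sq`). Conversely, for such a `β` the zeros of `w`
already contribute `2r`, and at a rational point `λ_q = 2 ord_q w`, since a larger value would make
`c`, hence `β`, a square. The existence of this form is equivalent to `H⁰` of the normalization
being larger than `k`: `(y + l)/w` is a square root of `c`, and in the other direction the square of
a global section lies in `k[u] ∩ k[u⁻¹] = k` (`globalSectionsEqBase_normalization_iff`). Finally
`λ_q > 2r` would put `β` in this form with `q` rational, where `λ_q = 2 ord_q w ≤ 2r`. -/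

namespace DoubleCover

noncomputable section

open MvPolynomial HomogeneousLocalization

/-! ### Dehomogenization and the coordinate rings of the charts. -/

section AwayEval

variable {A σ C : Type*} [CommRing A] [SetLike σ A] [AddSubgroupClass σ A] {𝒜 : ℕ → σ}
  [GradedRing 𝒜] [CommRing C]

/-- Dehomogenization: a ring homomorphism `φ` with `φ f = 1` induces one on `𝒜_(f)`. -/
def awayEval (f : A) (φ : A →+* C) (h : φ f = 1) : Away 𝒜 f →+* C :=
  (IsLocalization.Away.lift (S := Localization.Away f) f (g := φ) (by rw [h]; exact isUnit_one)).comp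
    (algebraMap _ _)

lemma awayEval_mk {f : A} {φ : A →+* C} (h : φ f = 1) {d : ℕ} (hf : f ∈ 𝒜 d) (n : ℕ) (x : A)
    (hx : x ∈ 𝒜 (n • d)) : awayEval (𝒜 := 𝒜) f φ h (Away.mk 𝒜 hf n x hx) = φ x := by
  simp only [awayEval, RingHom.comp_apply, HomogeneousLocalization.algebraMap_apply, Away.val_mk]
  rw [Localization.mk_eq_mk', IsLocalization.Away.lift, IsLocalization.lift_mk'_spec]
  simp [h]

end AwayEval

variable {k : Type u} [Field k]

/-- The affine coordinates on the chart `i` of `ℙ¹`. -/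
def chartCoord (i j : Fin 2) : Polynomial k := if j = i then 1 else Polynomial.X

lemma chartCoord_self (i : Fin 2) : chartCoord (k := k) i i = 1 := if_pos rfl

lemma chartCoord_rev (i : Fin 2) : chartCoord (k := k) i i.rev = Polynomial.X :=
  if_neg (by fin_cases i <;> decide)

/-- Dehomogenization of a form in two variables. -/
def dehom (i : Fin 2) : MvPolynomial (Fin 2) k →ₐ[k] Polynomial k := aeval (chartCoord i)

lemma dehom_X (i j : Fin 2) : dehom (k := k) i (X j) = chartCoord i j := aeval_X _ _

lemma dehom_monomial (i : Fin 2) (d : Fin 2 →₀ ℕ) (c : k) :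
    dehom i (monomial d c) = Polynomial.monomial (d i.rev) c := by
  rw [dehom, aeval_monomial, Finsupp.prod_fintype _ _ (by simp), Fin.prod_univ_two,
    ← Polynomial.C_mul_X_pow_eq_monomial]
  fin_cases i <;> simp [chartCoord]

/-- In a form of degree `n` the two exponents add up to `n`, so the exponent of the other variable
determines the monomial and no two monomials collide. -/
lemma coeff_dehom {n : ℕ} {F : MvPolynomial (Fin 2) k} (hF : F ∈ homogeneousSubmodule (Fin 2) k n)
    (i : Fin 2) (j : ℕ) : (dehom i F).coeff j =
      if j ≤ n then F.coeff (Finsupp.single i (n - j) + Finsupp.single i.rev j) else 0 := by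
  have hd : ∀ d ∈ F.support, d i + d i.rev = n := by
    intro d hd
    have := hF (mem_support_iff.mp hd)
    rw [Finsupp.weight_apply, Finsupp.sum_fintype _ _ (by simp), Fin.sum_univ_two] at this
    fin_cases i <;> simp_all [add_comm]
  conv_lhs => rw [F.as_sum, map_sum, Polynomial.finsetSum_coeff]
  simp only [dehom_monomial, Polynomial.coeff_monomial]
  have hi : i ≠ i.rev := by fin_cases i <;> decide
  split_ifs with hj
  · rw [Finset.sum_eq_single (Finsupp.single i (n - j) + Finsupp.single i.rev j)]
    · simp [hi]
    · intro d hdF hne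
      refine if_neg fun h => hne ?_
      have := hd d hdF
      ext l
      obtain rfl | rfl : l = i ∨ l = i.rev := by fin_cases i <;> fin_cases l <;> simp
      · simp [hi.symm]; omega
      · simp [hi]; omega
    · intro h
      rw [notMem_support_iff.mp h, ite_self]
  · refine Finset.sum_eq_zero fun d hdF => if_neg ?_
    have := hd d hdF
    omega

lemma natDegree_dehom_le {n : ℕ} {F : MvPolynomial (Fin 2) k}
    (hF : F ∈ homogeneousSubmodule (Fin 2) k n) (i : Fin 2) : (dehom i F).natDegree ≤ n := by
  rw [Polynomial.natDegree_le_iff_coeff_eq_zero]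
  intro j hj
  rw [coeff_dehom hF, if_neg (by omega)]

/-- Allows the point at infinity to be treated by reflecting polynomials on the first chart. -/
lemma dehom_rev {n : ℕ} {F : MvPolynomial (Fin 2) k}
    (hF : F ∈ homogeneousSubmodule (Fin 2) k n) (i : Fin 2) :
    dehom i.rev F = (dehom i F).reflect n := by
  ext j
  rw [Polynomial.coeff_reflect, coeff_dehom hF, coeff_dehom hF, Fin.rev_rev]
  by_cases h : j ≤ n
  · rw [Polynomial.revAt_le h, if_pos h, if_pos (Nat.sub_le _ _), Nat.sub_sub_self h, add_comm]
  · rw [Polynomial.revAt_eq_self_of_lt (by omega), if_neg h, if_neg h]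

lemma eq_zero_of_dehom_eq_zero {n : ℕ} {F : MvPolynomial (Fin 2) k}
    (hF : F ∈ homogeneousSubmodule (Fin 2) k n) (i : Fin 2) (h : dehom i F = 0) : F = 0 := by
  ext d
  by_contra hd
  have h1 := hF hd
  rw [Finsupp.weight_apply, Finsupp.sum_fintype _ _ (by simp), Fin.sum_univ_two] at h1
  have h2 := coeff_dehom hF i (d i.rev)
  have h3 : d i + d i.rev = n := by fin_cases i <;> simp_all [add_comm]
  rw [h, if_pos (by omega), Polynomial.coeff_zero] at h2
  refine hd ?_
  rw [MvPolynomial.coeff_zero, h2]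
  congr 1
  have hi : i ≠ i.rev := by fin_cases i <;> decide
  ext l
  obtain rfl | rfl : l = i ∨ l = i.rev := by fin_cases i <;> fin_cases l <;> simp
  · simp [hi.symm]; omega
  · simp [hi]

/-! ### The affine charts of `ℙ¹` -/

lemma X_mem_homogeneous (i : Fin 2) : (X i : MvPolynomial (Fin 2) k) ∈
    homogeneousSubmodule (Fin 2) k 1 := isHomogeneous_X k i

/-- The map `k[s,t]_(x_i) → k[u]`. -/
def lineEval (i : Fin 2) :
    Away (homogeneousSubmodule (Fin 2) k) (X i : MvPolynomial (Fin 2) k) →+* Polynomial k :=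
  awayEval (X i) (dehom i).toRingHom ((dehom_X i i).trans (chartCoord_self i))

lemma lineEval_mk (i : Fin 2) (n : ℕ) (F : MvPolynomial (Fin 2) k)
    (hF : F ∈ homogeneousSubmodule (Fin 2) k (n • 1)) :
    lineEval i (Away.mk _ (X_mem_homogeneous i) n F hF) = dehom i F :=
  awayEval_mk _ _ _ _ _

lemma lineEval_fromZero (i : Fin 2) (c : k) :
    lineEval i (fromZeroRingHom (homogeneousSubmodule (Fin 2) k) _
      (algebraMap k (homogeneousSubmodule (Fin 2) k 0) c)) = Polynomial.C c := by
  have := lineEval_mk i 0 (C c) (isHomogeneous_C _ c)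
  rw [dehom, aeval_C] at this
  rw [← Polynomial.algebraMap_eq, ← this]
  rfl

lemma lineEval_bijective (i : Fin 2) : Function.Bijective (lineEval (k := k) i) := by
  constructor
  · rw [injective_iff_map_eq_zero]
    intro x hx
    obtain ⟨n, F, hF, rfl⟩ := Away.mk_surjective _ (X_mem_homogeneous i) x
    rw [lineEval_mk] at hx
    ext
    simp [eq_zero_of_dehom_eq_zero hF i hx, Localization.mk_zero]
  · rw [← RingHom.range_eq_top, eq_top_iff]
    rintro p -
    induction p using Polynomial.induction_on' with
    | add p q hp hq => exact add_mem hp hq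
    | monomial n c =>
      rw [← Polynomial.C_mul_X_pow_eq_monomial]
      refine mul_mem ⟨_, lineEval_fromZero i c⟩ (pow_mem (RingHom.mem_range.mpr
        ⟨Away.mk _ (X_mem_homogeneous i) 1 (X i.rev) (X_mem_homogeneous i.rev), ?_⟩) _)
      rw [lineEval_mk, dehom_X, chartCoord_rev]

/-- The isomorphism `k[s,t]_(x_i) ≃ k[u]`. -/
def lineEquiv (i : Fin 2) :
    Away (homogeneousSubmodule (Fin 2) k) (X i : MvPolynomial (Fin 2) k) ≃+* Polynomial k :=
  RingEquiv.ofBijective (lineEval i) (lineEval_bijective i)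

/-! ### The affine charts of the curve -/

variable {r : ℕ} (a : homogeneousSubmodule (Fin 2) k r) (b : homogeneousSubmodule (Fin 2) k (2 * r))

/-- The coordinate ring `k[u][y] / (y² + α y + β)` of the chart `i` of the curve. -/
abbrev ChartRing (i : Fin 2) : Type u :=
  QuadraticAlgebra (Polynomial k) (-dehom i b.1) (-dehom i a.1)

/-- `QuadraticAlgebra R a b` has the relation `ω² = a + b ω`, which accounts for the minus signs. -/
lemma omega_sq {R : Type*} [CommRing R] (α β : R) :
    (QuadraticAlgebra.omega : QuadraticAlgebra R (-β) (-α)) ^ 2 +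
      algebraMap R _ α * QuadraticAlgebra.omega + algebraMap R _ β = 0 := by
  rw [sq, QuadraticAlgebra.omega_mul_omega_eq_algebraMap, map_neg, map_neg]
  ring

/-- The affine coordinates on the chart `i` of the curve. -/
def curveCoord (i : Fin 2) : Fin 3 → ChartRing a b i :=
  ![algebraMap (Polynomial k) _ (chartCoord i 0), algebraMap (Polynomial k) _ (chartCoord i 1),
    QuadraticAlgebra.omega]

lemma aeval_curveCoord_rename (i : Fin 2) (F : MvPolynomial (Fin 2) k) :
    aeval (curveCoord a b i) (rename Fin.castSucc F) =
      algebraMap (Polynomial k) _ (dehom i F) := by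
  rw [aeval_rename]
  change _ = algebraMap (Polynomial k) _ (aeval (chartCoord i) F)
  rw [← aeval_algebraMap_apply]
  congr 2
  funext j
  fin_cases j <;> rfl

/-- Dehomogenization `k[s,t,z] / (z² + a z + b) → k[u][y] / (y² + α y + β)`. -/
def curveDehom (i : Fin 2) : CoordinateRing a b →ₐ[k] ChartRing a b i :=
  Ideal.Quotient.liftₐ _ (aeval (curveCoord a b i)) (by
    intro x hx
    obtain ⟨c, rfl⟩ := Ideal.mem_span_singleton'.mp hx
    rw [map_mul, curveEquation, map_add, map_add, map_mul, map_pow, aeval_curveCoord_rename,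
      aeval_curveCoord_rename, aeval_X]
    change _ * (QuadraticAlgebra.omega ^ 2 + _ * QuadraticAlgebra.omega + _) = _
    rw [omega_sq, mul_zero])

lemma curveDehom_coordinateMap (i : Fin 2) (F : MvPolynomial (Fin 2) k) :
    curveDehom a b i (coordinateMap a b F) = algebraMap _ _ (dehom i F) :=
  aeval_curveCoord_rename a b i F

/-- The class of `z`. -/
def zCoord : CoordinateRing a b := Ideal.Quotient.mk _ (X 2)

lemma curveDehom_zCoord (i : Fin 2) :
    curveDehom a b i (zCoord a b) = QuadraticAlgebra.omega := by
  change aeval (curveCoord a b i) (X 2) = _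
  rw [aeval_X]
  rfl

lemma zCoord_mem : zCoord a b ∈ curveGrading a b r :=
  ⟨X 2, isWeightedHomogeneous_X k ![1, 1, r] 2, rfl⟩

lemma zCoord_sq : zCoord a b ^ 2 + coordinateMap a b a.1 * zCoord a b + coordinateMap a b b.1 = 0 :=
  Ideal.Quotient.eq_zero_iff_mem.mpr (Ideal.subset_span rfl)

lemma coordinateMap_X_mem (i : Fin 2) : coordinateMap a b (X i) ∈ curveGrading a b 1 :=
  Graded.map_mem (coordinateMap a b) (X_mem_homogeneous i)

/-- The map `𝒪(Θ)_(x_i) → k[u][y] / (y² + α y + β)`. -/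
def curveEval (i : Fin 2) :
    Away (curveGrading a b) (coordinateMap a b (X i)) →+* ChartRing a b i :=
  awayEval _ (curveDehom a b i).toRingHom (by
    change curveDehom a b i _ = 1
    rw [curveDehom_coordinateMap, dehom_X, chartCoord_self, map_one])

lemma curveEval_mk (i : Fin 2) (n : ℕ) (F : CoordinateRing a b)
    (hF : F ∈ curveGrading a b (n • 1)) :
    curveEval a b i (Away.mk _ (coordinateMap_X_mem a b i) n F hF) = curveDehom a b i F :=
  awayEval_mk _ _ _ _ _

lemma curveEval_map (i : Fin 2)
    (x : Away (homogeneousSubmodule (Fin 2) k) (X i : MvPolynomial (Fin 2) k)) :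
    curveEval a b i (Away.map (coordinateMap a b) (X i) x) = algebraMap _ _ (lineEval i x) := by
  obtain ⟨n, F, hF, rfl⟩ := Away.mk_surjective _ (X_mem_homogeneous i) x
  rw [Away.map_mk, curveEval_mk, lineEval_mk, curveDehom_coordinateMap]

/-- The function `y = z / x_i^r` on the chart `i`. -/
def chartY (i : Fin 2) : Away (curveGrading a b) (coordinateMap a b (X i)) :=
  Away.mk _ (coordinateMap_X_mem a b i) r (zCoord a b) (by
    rw [smul_eq_mul, mul_one]; exact zCoord_mem a b)

lemma curveEval_chartY (i : Fin 2) : curveEval a b i (chartY a b i) = QuadraticAlgebra.omega := by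
  rw [chartY, curveEval_mk, curveDehom_zCoord]

lemma curveEval_surjective (i : Fin 2) : Function.Surjective (curveEval a b i) := by
  intro x
  obtain ⟨c, hc⟩ := (lineEval_bijective i).2 x.re
  obtain ⟨d, hd⟩ := (lineEval_bijective i).2 x.im
  refine ⟨Away.map (coordinateMap a b) (X i) c + Away.map (coordinateMap a b) (X i) d * chartY a b i,
    ?_⟩
  rw [map_add, map_mul, curveEval_map, curveEval_map, curveEval_chartY, hc, hd]
  ext <;> simp

/-- Clears denominators: identities between homogeneous fractions are checked in the full
localization after multiplication by a power of `f`. -/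
lemma val_mk_mul_pow {A σ : Type*} [CommRing A] [SetLike σ A] [AddSubgroupClass σ A] {𝒜 : ℕ → σ}
    [GradedRing 𝒜] {f : A} {d : ℕ} (hf : f ∈ 𝒜 d) (n : ℕ) (x : A) (hx : x ∈ 𝒜 (n • d)) :
    (Away.mk 𝒜 hf n x hx).val * algebraMap A (Localization.Away f) f ^ n = algebraMap A _ x := by
  rw [Away.val_mk, ← map_pow, Localization.mk_eq_mk', mul_comm]
  exact IsLocalization.mk'_spec' _ x (⟨f ^ n, n, rfl⟩ : Submonoid.powers f)

/-- The homogeneous relation `zCoord_sq` divided by `x_i ^ (2r)`. -/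
lemma chartY_sq (i : Fin 2) : chartY a b i ^ 2 = -(Away.map (coordinateMap a b) (X i)
    (Away.mk _ (X_mem_homogeneous i) r a.1 (by simp)) * chartY a b i) -
    Away.map (coordinateMap a b) (X i)
    (Away.mk _ (X_mem_homogeneous i) (2 * r) b.1 (by simp)) := by
  have hu : IsUnit (algebraMap (CoordinateRing a b)
    (Localization.Away (coordinateMap a b (X i))) (coordinateMap a b (X i)) ^ (2 * r)) :=
    (IsLocalization.Away.algebraMap_isUnit _).pow _
  apply HomogeneousLocalization.val_injective
  refine hu.mul_left_inj.mp ?_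
  rw [Away.map_mk, Away.map_mk]
  have h1 := val_mk_mul_pow (coordinateMap_X_mem a b i) r (zCoord a b) (by
    rw [smul_eq_mul, mul_one]; exact zCoord_mem a b)
  have h2 := val_mk_mul_pow (coordinateMap_X_mem a b i) r (coordinateMap a b a.1)
    (Graded.map_mem (coordinateMap a b) (by simp))
  have h3 := val_mk_mul_pow (coordinateMap_X_mem a b i) (2 * r) (coordinateMap a b b.1)
    (Graded.map_mem (coordinateMap a b) (by simp))
  have h4 := congrArg (algebraMap (CoordinateRing a b)
    (Localization.Away (coordinateMap a b (X i)))) (zCoord_sq a b)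
  simp only [map_add, map_mul, map_pow, map_zero, ← h1, ← h2, ← h3] at h4
  simp only [HomogeneousLocalization.val_sub, HomogeneousLocalization.val_neg,
    HomogeneousLocalization.val_mul, HomogeneousLocalization.val_pow]
  rw [← sub_eq_zero, ← h4, chartY]
  ring

/-- The subring `k[u] + k[u] y` of the coordinate ring of the chart `i`. -/
def chartSubring (i : Fin 2) : Subring (Away (curveGrading a b) (coordinateMap a b (X i))) where
  carrier := {x | ∃ c d, x = Away.map (coordinateMap a b) (X i) c +
    Away.map (coordinateMap a b) (X i) d * chartY a b i}
  zero_mem' := ⟨0, 0, by simp⟩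
  one_mem' := ⟨1, 0, by simp⟩
  add_mem' := by
    rintro _ _ ⟨c, d, rfl⟩ ⟨c', d', rfl⟩
    exact ⟨c + c', d + d', by simp only [map_add]; ring⟩
  neg_mem' := by
    rintro _ ⟨c, d, rfl⟩
    exact ⟨-c, -d, by simp only [map_neg]; ring⟩
  mul_mem' := by
    rintro _ _ ⟨c, d, rfl⟩ ⟨c', d', rfl⟩
    refine ⟨c * c' - d * d' * (Away.mk _ (X_mem_homogeneous i) (2 * r) b.1 (by simp)),
      c * d' + d * c' - d * d' * (Away.mk _ (X_mem_homogeneous i) r a.1 (by simp)), ?_⟩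
    simp only [map_add, map_sub, map_mul]
    linear_combination (Away.map (coordinateMap a b) (X i) d *
      Away.map (coordinateMap a b) (X i) d') * chartY_sq a b i

lemma map_mem_chartSubring (i : Fin 2) (c) :
    Away.map (coordinateMap a b) (X i) c ∈ chartSubring a b i := ⟨c, 0, by simp⟩

lemma chartY_mem_chartSubring (i : Fin 2) : chartY a b i ∈ chartSubring a b i := ⟨0, 1, by simp⟩

/-- A monomial of weight `n` divided by `x_i ^ n` is a product of a scalar, powers of the `x_j /
x_i` and a power of `y = z / x_i ^ r`, all of which lie in the subring. This shows that `1, y`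
generate the chart over `k[u]`. -/
lemma exists_chartSubring (i : Fin 2) (n : ℕ) (F : MvPolynomial (Fin 3) k)
    (hF : F ∈ weightedGrading k r n) : ∃ x ∈ chartSubring a b i,
      algebraMap (CoordinateRing a b) (Localization.Away (coordinateMap a b (X i)))
        (Ideal.Quotient.mk _ F) = x.val * algebraMap _ _ (coordinateMap a b (X i)) ^ n := by
  have hmon : ∀ d ∈ F.support, ∃ x ∈ chartSubring a b i,
      algebraMap (CoordinateRing a b) (Localization.Away (coordinateMap a b (X i)))
        (Ideal.Quotient.mk _ (monomial d (F.coeff d))) =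
          x.val * algebraMap _ _ (coordinateMap a b (X i)) ^ n := by
    intro d hd
    have hw := hF (mem_support_iff.mp hd)
    rw [Finsupp.weight_apply, Finsupp.sum_fintype _ _ (by simp), Fin.sum_univ_three] at hw
    simp at hw
    have hX : ∀ j : Fin 2, X j ∈ homogeneousSubmodule (Fin 2) k (1 • 1) := X_mem_homogeneous
    have hC : (C (F.coeff d) : MvPolynomial (Fin 2) k) ∈ homogeneousSubmodule (Fin 2) k (0 • 1) :=
      isHomogeneous_C _ _
    have hz : zCoord a b ∈ curveGrading a b (r • 1) := by
      rw [smul_eq_mul, mul_one]; exact zCoord_mem a b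
    refine ⟨Away.map (coordinateMap a b) (X i) (Away.mk _ (X_mem_homogeneous i) 0 _ hC) *
      Away.map (coordinateMap a b) (X i) (Away.mk _ (X_mem_homogeneous i) 1 _ (hX 0)) ^ d 0 *
      Away.map (coordinateMap a b) (X i) (Away.mk _ (X_mem_homogeneous i) 1 _ (hX 1)) ^ d 1 *
      chartY a b i ^ d 2, ?_, ?_⟩
    · exact mul_mem (mul_mem (mul_mem (map_mem_chartSubring a b i _)
        (pow_mem (map_mem_chartSubring a b i _) _)) (pow_mem (map_mem_chartSubring a b i _) _))
        (pow_mem (chartY_mem_chartSubring a b i) _)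
    · have h0 := val_mk_mul_pow (coordinateMap_X_mem a b i) 0 _
        (Graded.map_mem (coordinateMap a b) hC)
      have h1 := fun j => val_mk_mul_pow (coordinateMap_X_mem a b i) 1 _
        (Graded.map_mem (coordinateMap a b) (hX j))
      have h2 := val_mk_mul_pow (coordinateMap_X_mem a b i) r _ hz
      have h3 : (Ideal.Quotient.mk (Ideal.span {curveEquation a b}) (monomial d (F.coeff d))) =
          coordinateMap a b (C (F.coeff d)) * coordinateMap a b (X 0) ^ d 0 *
            coordinateMap a b (X 1) ^ d 1 * zCoord a b ^ d 2 := by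
        rw [monomial_eq, Finsupp.prod_fintype _ _ (by simp), Fin.prod_univ_three]
        simp only [map_mul, map_pow]
        simp [coordinateMap, zCoord, mul_assoc]
      rw [h3]
      simp only [map_mul, map_pow]
      rw [← h0, ← h1 0, ← h1 1, ← h2]
      simp only [HomogeneousLocalization.val_mul, HomogeneousLocalization.val_pow, Away.map_mk,
        chartY, ← hw]
      ring
  choose! x hx hx' using hmon
  refine ⟨∑ d ∈ F.support, x d, sum_mem hx, ?_⟩
  conv_lhs => rw [F.as_sum, map_sum, map_sum, Finset.sum_congr rfl hx']
  rw [← HomogeneousLocalization.algebraMap_apply, map_sum, Finset.sum_mul]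
  rfl

lemma chartSubring_eq_top (i : Fin 2) (x) : x ∈ chartSubring a b i := by
  obtain ⟨n, _, ⟨F, hF, rfl⟩, rfl⟩ := Away.mk_surjective _ (coordinateMap_X_mem a b i) x
  obtain ⟨y, hy, h⟩ := exists_chartSubring a b i (n • 1) F hF
  convert hy
  have hu : IsUnit (algebraMap (CoordinateRing a b)
    (Localization.Away (coordinateMap a b (X i))) (coordinateMap a b (X i)) ^ (n • 1)) :=
    (IsLocalization.Away.algebraMap_isUnit _).pow _
  apply HomogeneousLocalization.val_injective
  refine hu.mul_left_inj.mp (Eq.trans ?_ h)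
  simp only [smul_eq_mul, mul_one]
  exact val_mk_mul_pow (coordinateMap_X_mem a b i) n _ _

/-- Every element has the form `c + d y` by `chartSubring_eq_top`, and its image has coordinates `c`
and `d`; hence the kernel is zero. -/
lemma curveEval_bijective (i : Fin 2) : Function.Bijective (curveEval a b i) := by
  refine ⟨?_, curveEval_surjective a b i⟩
  rw [injective_iff_map_eq_zero]
  intro x hx
  obtain ⟨c, d, rfl⟩ := chartSubring_eq_top a b i x
  rw [map_add, map_mul, curveEval_map, curveEval_map, curveEval_chartY] at hx
  have h1 := congrArg QuadraticAlgebra.re hx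
  have h2 := congrArg QuadraticAlgebra.im hx
  simp at h1 h2
  rw [(map_eq_zero_iff _ (lineEval_bijective i).1).mp h1,
    (map_eq_zero_iff _ (lineEval_bijective i).1).mp h2]
  simp

/-- The isomorphism between the coordinate ring of the chart `i` of the curve and
`k[u][y] / (y² + α y + β)`. -/
def curveEquiv (i : Fin 2) :
    Away (curveGrading a b) (coordinateMap a b (X i)) ≃+* ChartRing a b i :=
  RingEquiv.ofBijective (curveEval a b i) (curveEval_bijective a b i)

end

end DoubleCover

/-! ### Gluing the charts: the projection is finite flat of degree two. -/

namespace DoubleCover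

noncomputable section

open MvPolynomial HomogeneousLocalization

variable {k : Type u} [Field k] {r : ℕ}

/-- The chart `Spec k[u] ⟶ ℙ¹` with image `D₊(x_i)`. -/
def lineChart (i : Fin 2) : Spec (.of (Polynomial k)) ⟶ P1 k :=
  Spec.map (lineEquiv i).toCommRingCatIso.hom ≫
    Proj.awayι (homogeneousSubmodule (Fin 2) k) (X i) (X_mem_homogeneous i) Nat.one_pos

instance (i : Fin 2) : IsOpenImmersion (lineChart (k := k) i) := by
  unfold lineChart; infer_instance

lemma opensRange_lineChart (i : Fin 2) : (lineChart (k := k) i).opensRange =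
    Proj.basicOpen (homogeneousSubmodule (Fin 2) k) (X i) :=
  (Scheme.Hom.opensRange_comp_of_isIso _ _).trans (Proj.opensRange_awayι _ _ _ _)

lemma iSup_basicOpen_X :
    ⨆ i : Fin 2, Proj.basicOpen (homogeneousSubmodule (Fin 2) k) (X i) = ⊤ := by
  refine Proj.iSup_basicOpen_eq_top' _ _ (fun i => ⟨1, X_mem_homogeneous i⟩) ?_
  rw [eq_top_iff]
  rintro F -
  have h : F ∈ Algebra.adjoin k (Set.range (X : Fin 2 → MvPolynomial (Fin 2) k)) := by
    rw [MvPolynomial.adjoin_range_X]; trivial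
  induction h using Algebra.adjoin_induction with
  | mem x hx => exact Algebra.subset_adjoin hx
  | algebraMap c =>
    exact Subalgebra.algebraMap_mem _ (⟨C c, isHomogeneous_C _ c⟩ : homogeneousSubmodule (Fin 2) k 0)
  | add x y _ _ hx hy => exact add_mem hx hy
  | mul x y _ _ hx hy => exact mul_mem hx hy

/-- The cover of `ℙ¹` by its two affine charts. -/
def lineCover : (P1 k).OpenCover :=
  Scheme.Cover.mkOfCovers (Fin 2) (fun _ => Spec (.of (Polynomial k))) lineChart (fun x => by
    have hx : x ∈ ⨆ i : Fin 2, Proj.basicOpen (homogeneousSubmodule (Fin 2) k) (X i) := by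
      rw [iSup_basicOpen_X]; trivial
    obtain ⟨i, hi⟩ := Opens.mem_iSup.mp hx
    rw [← opensRange_lineChart] at hi
    exact ⟨i, hi⟩) inferInstance

variable (a : homogeneousSubmodule (Fin 2) k r) (b : homogeneousSubmodule (Fin 2) k (2 * r))

/-- The chart `Spec k[u][y] / (y² + α y + β) ⟶ Θ`. -/
def curveChart (i : Fin 2) : Spec (.of (ChartRing a b i)) ⟶ Curve a b :=
  Spec.map (curveEquiv a b i).toCommRingCatIso.hom ≫
    Proj.awayι (curveGrading a b) (coordinateMap a b (X i)) (coordinateMap_X_mem a b i) Nat.one_pos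

instance (i : Fin 2) : IsOpenImmersion (curveChart a b i) := by
  unfold curveChart; infer_instance

lemma opensRange_curveChart (i : Fin 2) : (curveChart a b i).opensRange = chart a b i :=
  (Scheme.Hom.opensRange_comp_of_isIso _ _).trans (Proj.opensRange_awayι _ _ _ _)

lemma exists_mem_chart (hr : 0 < r) (x : Curve a b) : ∃ i, x ∈ chart a b i := by
  have hx : x ∈ ⨆ i : ULift.{u} (Fin 2), chart a b i.down := by
    rw [iSup_chart a b hr]; trivial
  obtain ⟨i, hi⟩ := Opens.mem_iSup.mp hx
  exact ⟨i.down, hi⟩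

/-- The cover of the curve by its two affine charts. -/
def curveCover (hr : 0 < r) : (Curve a b).OpenCover :=
  Scheme.Cover.mkOfCovers (Fin 2) (fun i => Spec (.of (ChartRing a b i))) (curveChart a b)
    (fun x => by
      obtain ⟨i, hi⟩ := exists_mem_chart a b hr x
      rw [← opensRange_curveChart] at hi
      exact ⟨i, hi⟩) inferInstance

lemma awayι_projMap {A B σ τ : Type u} [CommRing A] [SetLike σ A] [AddSubgroupClass σ A]
    [CommRing B] [SetLike τ B] [AddSubgroupClass τ B]
    {𝒜 : ℕ → σ} {ℬ : ℕ → τ} [GradedRing 𝒜] [GradedRing ℬ]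
    (f : 𝒜 →+*ᵍ ℬ) {ι : Type u} (s : ι → A) (d : ι → ℕ) (hs : ∀ i, s i ∈ 𝒜 (d i))
    (hd : ∀ i, 0 < d i) (hcov : ⨆ i, Proj.basicOpen ℬ (f (s i)) = ⊤) (i : ι) :
    Proj.awayι ℬ (f (s i)) (Graded.map_mem f (hs i)) (hd i) ≫ projMap f s d hs hd hcov =
      Spec.map (CommRingCat.ofHom (Away.map f (s i))) ≫ Proj.awayι 𝒜 (s i) (hs i) (hd i) :=
  (projCover f s d hs hd hcov).openCover.ι_glueMorphisms _ _ i

lemma awayι_curveToP1 (hr : 0 < r) (i : Fin 2) :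
    Proj.awayι (curveGrading a b) (coordinateMap a b (X i)) (coordinateMap_X_mem a b i) Nat.one_pos ≫
      curveToP1 a b hr = Spec.map (CommRingCat.ofHom (Away.map (coordinateMap a b) (X i))) ≫
        Proj.awayι (homogeneousSubmodule (Fin 2) k) (X i) (X_mem_homogeneous i) Nat.one_pos :=
  awayι_projMap (coordinateMap a b) (fun i : ULift.{u} (Fin 2) => X i.down) (fun _ => 1)
    (fun i => isHomogeneous_X k i.down) (fun _ => Nat.one_pos) (iSup_chart a b hr) ⟨i⟩

/-- The ring map `k[u] → k[u][y] / (y² + α y + β)`. -/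
abbrev chartMap (i : Fin 2) : CommRingCat.of (Polynomial k) ⟶ CommRingCat.of (ChartRing a b i) :=
  CommRingCat.ofHom (algebraMap (Polynomial k) (ChartRing a b i))

lemma curveChart_curveToP1 (hr : 0 < r) (i : Fin 2) : curveChart a b i ≫ curveToP1 a b hr =
    Spec.map (chartMap a b i) ≫ lineChart i := by
  rw [curveChart, Category.assoc, awayι_curveToP1, lineChart, ← Spec.map_comp_assoc,
    ← Spec.map_comp_assoc]
  congr 2
  exact CommRingCat.hom_ext (RingHom.ext fun x => curveEval_map a b i x)

/-- Makes the chart squares cartesian. On each chart `j` both sides are basic opens of matching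
functions. -/
lemma curveToP1_preimage (hr : 0 < r) (i : Fin 2) :
    curveToP1 a b hr ⁻¹ᵁ Proj.basicOpen (homogeneousSubmodule (Fin 2) k) (X i) = chart a b i := by
  have key : ∀ j, Proj.awayι (curveGrading a b) (coordinateMap a b (X j)) (coordinateMap_X_mem a b j)
      Nat.one_pos ⁻¹ᵁ (curveToP1 a b hr ⁻¹ᵁ Proj.basicOpen (homogeneousSubmodule (Fin 2) k) (X i)) =
      Proj.awayι (curveGrading a b) (coordinateMap a b (X j)) (coordinateMap_X_mem a b j)
      Nat.one_pos ⁻¹ᵁ chart a b i := by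
    intro j
    rw [← Scheme.Hom.comp_preimage, awayι_curveToP1, Scheme.Hom.comp_preimage,
      Proj.awayι_preimage_basicOpen _ _ _ (X_mem_homogeneous i) Nat.one_pos, chart,
      Proj.awayι_preimage_basicOpen _ _ _ (coordinateMap_X_mem a b i) Nat.one_pos]
    refine (SpecMap_preimage_basicOpen _ _).trans ?_
    congr 1
    exact (Away.map_mk _ _ _ _ _ _).trans (by simp only [map_pow])
  ext x
  obtain ⟨j, hj⟩ := exists_mem_chart a b hr x
  rw [chart, ← Proj.opensRange_awayι _ _ (coordinateMap_X_mem a b j) Nat.one_pos] at hj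
  obtain ⟨y, rfl⟩ := hj
  exact (SetLike.ext_iff.mp (key j) y)

lemma isPullback_chart (hr : 0 < r) (i : Fin 2) :
    IsPullback (Spec.map (chartMap a b i)) (curveChart a b i) (lineChart i) (curveToP1 a b hr) :=
  IsOpenImmersion.isPullback _ _ _ _ (curveChart_curveToP1 a b hr i) (by
    rw [opensRange_lineChart, curveToP1_preimage, opensRange_curveChart])

lemma lineChart_over (i : Fin 2) : lineChart i ≫ P1Over k =
    Spec.map (CommRingCat.ofHom (algebraMap k (Polynomial k))) := by
  rw [lineChart, P1Over, projOver, Category.assoc, Proj.awayι_toSpecZero_assoc, ← Spec.map_comp,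
    ← Spec.map_comp]
  congr 1
  exact CommRingCat.hom_ext (RingHom.ext fun c => lineEval_fromZero i c)

lemma curveEval_fromZero (i : Fin 2) (c : k) :
    curveEval a b i (fromZeroRingHom (curveGrading a b) _
      (algebraMap k (curveGrading a b 0) c)) = algebraMap k _ c := by
  have h0 : algebraMap k (CoordinateRing a b) c ∈ curveGrading a b (0 • 1) :=
    (algebraMap k (curveGrading a b 0) c).2
  have := curveEval_mk a b i 0 _ h0
  rw [AlgHom.commutes] at this
  rw [← this]
  rfl

lemma curveChart_over (i : Fin 2) : curveChart a b i ≫ curveOver a b =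
    Spec.map (CommRingCat.ofHom (algebraMap k (ChartRing a b i))) := by
  rw [curveChart, curveOver, projOver, Category.assoc, Proj.awayι_toSpecZero_assoc, ← Spec.map_comp,
    ← Spec.map_comp]
  congr 1
  refine CommRingCat.hom_ext (RingHom.ext fun c => ?_)
  exact curveEval_fromZero a b i c

lemma curveToP1_over (hr : 0 < r) : curveToP1 a b hr ≫ P1Over k = curveOver a b := by
  refine (curveCover a b hr).hom_ext _ _ fun (i : Fin 2) => ?_
  change curveChart a b i ≫ _ = curveChart a b i ≫ _
  rw [← Category.assoc, curveChart_curveToP1, Category.assoc, lineChart_over, curveChart_over,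
    ← Spec.map_comp]
  rfl

/-- The property is local on the target, and over each chart the morphism comes from a free algebra
of rank two. -/
lemma isFinite_curveToP1 (hr : 0 < r) : IsFinite (curveToP1 a b hr) := by
  have : IsZariskiLocalAtTarget (@IsFinite.{u}) :=
    @HasAffineProperty.instIsZariskiLocalAtTarget _ _
      IsFinite.instHasAffinePropertyAndIsAffineFiniteCarrierObjOppositeOpensCarrierCarrierCommRingCatPresheafOpOpensTopHomAppTop
  refine IsZariskiLocalAtTarget.of_openCover (P := @IsFinite) (lineCover (k := k)) fun i => ?_
  change IsFinite (Limits.pullback.snd (curveToP1 a b hr) (lineChart i))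
  rw [← (isPullback_chart a b hr i).flip.isoPullback_inv_snd]
  have : IsFinite (Spec.map (chartMap a b i)) :=
    (IsFinite.SpecMap_iff _).mpr (RingHom.finite_algebraMap.mpr inferInstance)
  infer_instance

lemma flat_curveToP1 (hr : 0 < r) : Flat (curveToP1 a b hr) := by
  have : IsZariskiLocalAtTarget (@Flat.{u}) :=
    HasRingHomProperty.instIsZariskiLocalAtTarget _ (Q := _)
  refine IsZariskiLocalAtTarget.of_openCover (P := @Flat) (lineCover (k := k)) fun i => ?_
  change Flat (Limits.pullback.snd (curveToP1 a b hr) (lineChart i))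
  rw [← (isPullback_chart a b hr i).flip.isoPullback_inv_snd]
  have : Flat (Spec.map (chartMap a b i)) :=
    Flat.SpecMap_iff.mpr (RingHom.flat_algebraMap_iff.mpr inferInstance)
  infer_instance

lemma finrank_curveToP1 (hr : 0 < r) (q : P1 k) : (curveToP1 a b hr).finrank q = 2 := by
  obtain ⟨i, x, rfl⟩ := (lineCover (k := k)).exists_eq q
  have := isFinite_curveToP1 a b hr
  have := flat_curveToP1 a b hr
  erw [← Scheme.Hom.finrank_of_isPullback _ _ _ _ (isPullback_chart a b hr i).flip x]
  erw [Scheme.Hom.finrank_SpecMap_algebraMap]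
  rw [Module.rankAtStalk_eq_finrank_of_free, QuadraticAlgebra.finrank_eq_two]
  rfl

end

end DoubleCover

/-! ### The multiplicity of a quadratic algebra. -/

namespace DoubleCover

noncomputable section

lemma le_ordAt_iff {A : Type*} [CommRing A] (m : Ideal A) (x : A) (n : ℕ) :
    (n : ℕ∞) ≤ ordAt m x ↔ x ∈ m ^ n := by
  refine ⟨fun h => ?_, fun h => le_iSup (fun n : {n : ℕ // x ∈ m ^ n} => ((n : ℕ) : ℕ∞)) ⟨n, h⟩⟩
  rcases n with _ | n
  · simp
  -- Passing from `n + 1 ≤ sup` to `n < sup` produces a member of the family that is at least `n +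
  -- 1`, even if the supremum is infinite.
  have h1 : (n : ℕ∞) < ordAt m x := lt_of_lt_of_le (by exact_mod_cast Nat.lt_succ_self n) h
  obtain ⟨⟨l, hl⟩, h2⟩ := lt_iSup_iff.mp h1
  exact Ideal.pow_le_pow_right (by exact_mod_cast h2) hl

/-- The exponent `(n + 1) / 2` is `n / 2` rounded up. -/
lemma le_two_mul_ordAt_iff {A : Type*} [CommRing A] (m : Ideal A) (x : A) (n : ℕ) :
    (n : ℕ∞) ≤ 2 * ordAt m x ↔ x ∈ m ^ ((n + 1) / 2) := by
  rw [← le_ordAt_iff]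
  generalize ordAt m x = o
  cases o with
  | top => simp
  | coe o => norm_cast; omega

section Quadratic

variable {A B : Type*} [CommRing A] [CommRing B] [Algebra A B] (m : Ideal A)

/-- The case `n = 0` is excluded because its left side always holds, while the right side asks for a
generator to exist. -/
lemma le_multiplicity_iff {n : ℕ} (hn : n ≠ 0) : (n : ℕ∞) ≤ multiplicity m B ↔
    ∃ (y : B) (a b : A), Algebra.adjoin A {y} = ⊤ ∧
      y ^ 2 + algebraMap A B a * y + algebraMap A B b = 0 ∧
        a ∈ m ^ ((n + 1) / 2) ∧ b ∈ m ^ n := by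
  constructor
  · intro h
    obtain ⟨l, rfl⟩ := Nat.exists_eq_succ_of_ne_zero hn
    have h1 : (l : ℕ∞) < multiplicity m B :=
      lt_of_lt_of_le (by exact_mod_cast Nat.lt_succ_self l) h
    simp only [multiplicity, lt_iSup_iff, lt_min_iff] at h1
    obtain ⟨y, a, b, hy, hab, h2, h3⟩ := h1
    refine ⟨y, a, b, hy, hab, ?_, ?_⟩
    · rw [← le_two_mul_ordAt_iff]
      exact_mod_cast Order.add_one_le_of_lt h2
    · rw [← le_ordAt_iff]
      exact_mod_cast Order.add_one_le_of_lt h3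
  · rintro ⟨y, a, b, hy, hab, h2, h3⟩
    rw [← le_two_mul_ordAt_iff] at h2
    rw [← le_ordAt_iff] at h3
    refine (le_min h2 h3).trans ?_
    exact le_iSup_of_le y (le_iSup_of_le a (le_iSup_of_le b (le_iSup_of_le hy
      (le_iSup_of_le hab le_rfl))))

lemma exists_of_mem_adjoin {y : B} {a b : A}
    (h : y ^ 2 + algebraMap A B a * y + algebraMap A B b = 0) {z : B}
    (hz : z ∈ Algebra.adjoin A {y}) : ∃ c d, z = algebraMap A B c + algebraMap A B d * y := by
  induction hz using Algebra.adjoin_induction with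
  | mem x hx => exact ⟨0, 1, by simp [Set.mem_singleton_iff.mp hx]⟩
  | algebraMap c => exact ⟨c, 0, by simp⟩
  | add x z _ _ hx hz =>
    obtain ⟨c, d, rfl⟩ := hx
    obtain ⟨c', d', rfl⟩ := hz
    exact ⟨c + c', d + d', by simp only [map_add]; ring⟩
  | mul x z _ _ hx hz =>
    obtain ⟨c, d, rfl⟩ := hx
    obtain ⟨c', d', rfl⟩ := hz
    refine ⟨c * c' - d * d' * b, c * d' + d * c' - d * d' * a, ?_⟩
    simp only [map_add, map_sub, map_mul]
    linear_combination (algebraMap A B d * algebraMap A B d') * h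

variable {Y : B} {α β : A}
  (hY : Function.Bijective (fun p : A × A => algebraMap A B p.1 + algebraMap A B p.2 * Y))
  (h : Y ^ 2 + algebraMap A B α * Y + algebraMap A B β = 0)

include hY h

/-- Write `y = p + eY` in the basis `1, Y`. Since `Y` is in turn of the form `c + dy`, the
coefficient `e` is a unit, and comparing the two quadratic equations determines `a` and `b`. -/
lemma generator_change {y : B} {a b : A} (hy : Algebra.adjoin A {y} = ⊤)
    (hab : y ^ 2 + algebraMap A B a * y + algebraMap A B b = 0) :
    ∃ e p : A, IsUnit e ∧ a = e * α - 2 * p ∧ b = e ^ 2 * β - e * α * p + p ^ 2 := by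
  have hinj : ∀ c d c' d' : A, algebraMap A B c + algebraMap A B d * Y =
      algebraMap A B c' + algebraMap A B d' * Y → c = c' ∧ d = d' := fun c d c' d' hh => by
    have := @hY.1 (c, d) (c', d') hh
    simpa using this
  obtain ⟨⟨p, e⟩, rfl⟩ := hY.2 y
  dsimp only at hy hab
  obtain ⟨c, d, hcd⟩ := exists_of_mem_adjoin hab (hy ▸ Algebra.mem_top : Y ∈ _)
  have h1 := hinj 0 1 (c + d * p) (d * e) (by
    simp only [map_add, map_mul, map_zero, map_one]; linear_combination hcd)
  have he : IsUnit e := IsUnit.of_mul_eq_one d (by rw [mul_comm]; exact h1.2.symm)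
  -- The equation of `y = p + eY` after replacing `Y²` by `-αY - β`, with the coefficients of `1`
  -- and `Y` collected.
  have h2 := hinj (p ^ 2 - e ^ 2 * β + a * p + b) (e * (2 * p - e * α + a)) 0 0 (by
    simp only [map_add, map_mul, map_sub, map_pow, map_zero, map_ofNat]
    linear_combination hab - (algebraMap A B e) ^ 2 * h)
  have h3 : a = e * α - 2 * p := by
    have := (he.mul_right_eq_zero).mp h2.2
    linear_combination this
  exact ⟨e, p, he, h3, by linear_combination h2.1 - p * h3⟩

/-- The discriminant depends on the generator only through the square of a unit, and `a² - 4b` lies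
in `m ^ n` once `a ∈ m ^ ⌈n/2⌉` and `b ∈ m ^ n`. -/
lemma discr_mem_of_le_multiplicity {n : ℕ} (hn : (n : ℕ∞) ≤ multiplicity m B) :
    α ^ 2 - 4 * β ∈ m ^ n := by
  rcases eq_or_ne n 0 with rfl | hn0
  · simp
  obtain ⟨y, a, b, hy, hab, ha, hb⟩ := (le_multiplicity_iff m hn0).mp hn
  obtain ⟨e, p, he, h1, h2⟩ := generator_change hY h hy hab
  have h3 : a ^ 2 ∈ m ^ n := by
    have := Ideal.pow_mem_pow ha 2
    rw [← pow_mul] at this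
    exact Ideal.pow_le_pow_right (by omega) this
  have h4 : e ^ 2 * (α ^ 2 - 4 * β) ∈ m ^ n := by
    have : e ^ 2 * (α ^ 2 - 4 * β) = a ^ 2 - 4 * b := by rw [h1, h2]; ring
    rw [this]
    exact sub_mem h3 (Ideal.mul_mem_left _ _ hb)
  exact (Ideal.unit_mul_mem_iff_mem _ (he.pow 2)).mp h4

/-- When `2 = 0` and `α = 0`, the change of generator reads `a = 0` and `b = e²β + p² = e²(β +
(p/e)²)`. -/
lemma le_multiplicity_iff_of_two_eq_zero (h2 : (2 : A) = 0) (hα : α = 0) {n : ℕ} :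
    (n : ℕ∞) ≤ multiplicity m B ↔ ∃ x, β + x ^ 2 ∈ m ^ n := by
  rcases eq_or_ne n 0 with rfl | hn0
  · simp
  rw [le_multiplicity_iff m hn0]
  constructor
  · rintro ⟨y, a, b, hy, hab, ha, hb⟩
    obtain ⟨e, p, he, h3, h4⟩ := generator_change hY h hy hab
    obtain ⟨e, rfl⟩ := he
    refine ⟨(e⁻¹ : Aˣ) * p, ?_⟩
    rw [← Ideal.unit_mul_mem_iff_mem _ (e.isUnit.pow 2)]
    convert hb using 1
    have := e.mul_inv
    rw [h4, hα]
    linear_combination p ^ 2 * (e * (e⁻¹ : Aˣ) + 1) * this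
  · rintro ⟨x, hx⟩
    refine ⟨Y + algebraMap A B x, 0, β + x ^ 2, ?_, ?_, zero_mem _, hx⟩
    · rw [eq_top_iff]
      rintro z -
      obtain ⟨⟨c, d⟩, rfl⟩ := hY.2 z
      have hy : Y + algebraMap A B x ∈ Algebra.adjoin A {Y + algebraMap A B x} :=
        Algebra.subset_adjoin rfl
      have : Y ∈ Algebra.adjoin A {Y + algebraMap A B x} := by
        have := sub_mem hy (Subalgebra.algebraMap_mem _ x)
        rwa [add_sub_cancel_right] at this
      exact add_mem (Subalgebra.algebraMap_mem _ c) (mul_mem (Subalgebra.algebraMap_mem _ d) this)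
    · have h2' : (2 : B) = 0 := by rw [← map_ofNat (algebraMap A B) 2, h2, map_zero]
      rw [hα] at h
      simp only [map_add, map_pow, map_zero] at h ⊢
      linear_combination h + (Y * algebraMap A B x + (algebraMap A B x) ^ 2) * h2'

end Quadratic

section Localization

variable {R A : Type*} [CommRing R] [IsDomain R] [CommRing A] [Algebra R A] {π : R}

lemma algebraMap_mem_pow_iff [hπ : (Ideal.span {π}).IsPrime] (hπ0 : π ≠ 0)
    [IsLocalization.AtPrime A (Ideal.span {π})] [IsLocalRing A] {p : R} {n : ℕ} :
    algebraMap R A p ∈ IsLocalRing.maximalIdeal A ^ n ↔ π ^ n ∣ p := by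
  have hp : Prime π := (Ideal.span_singleton_prime hπ0).mp hπ
  rw [← IsLocalization.AtPrime.map_eq_maximalIdeal (Ideal.span {π}) A, ← Ideal.map_pow,
    Ideal.span_singleton_pow, ← Ideal.mem_span_singleton,
    IsLocalization.algebraMap_mem_map_algebraMap_iff (Ideal.span {π}).primeCompl]
  constructor
  · rintro ⟨s, hs, h⟩
    rw [Ideal.mem_span_singleton] at h ⊢
    exact hp.pow_dvd_of_dvd_mul_left n (fun h' => hs (Ideal.mem_span_singleton.mpr h')) h
  · exact fun h => ⟨1, one_mem _, by rwa [one_mul]⟩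

/-- A denominator `s` prime to `π` has an inverse `v` modulo `π ^ n`, so `p / s` is congruent to `p
v`. -/
lemma exists_sub_algebraMap_mem_pow [IsPrincipalIdealRing R] [hπ : (Ideal.span {π}).IsPrime]
    (hπ0 : π ≠ 0) [IsLocalization.AtPrime A (Ideal.span {π})] [IsLocalRing A] (x : A) (n : ℕ) :
    ∃ p : R, x - algebraMap R A p ∈ IsLocalRing.maximalIdeal A ^ n := by
  have hp : Prime π := (Ideal.span_singleton_prime hπ0).mp hπ
  obtain ⟨p, s, rfl⟩ := IsLocalization.exists_mk'_eq (Ideal.span {π}).primeCompl x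
  have hs : ¬ π ∣ s := fun h => s.2 (Ideal.mem_span_singleton.mpr h)
  obtain ⟨u, v, huv⟩ := ((Irreducible.coprime_iff_not_dvd hp.irreducible).mpr hs).pow_left (m := n)
  have hu := IsLocalization.map_units A s
  refine ⟨p * v, ?_⟩
  rw [← Ideal.unit_mul_mem_iff_mem _ hu, mul_sub, IsLocalization.mk'_spec', ← map_mul, ← map_sub,
    algebraMap_mem_pow_iff hπ0]
  exact ⟨p * u, by linear_combination (-p) * huv⟩

end Localization

section LocalMultiplicity

variable {R A B : Type*} [CommRing R] [IsDomain R] [CommRing A] [Algebra R A]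
  [CommRing B] [Algebra A B] {π : R} [hπ : (Ideal.span {π}).IsPrime] (hπ0 : π ≠ 0)
  [IsLocalization.AtPrime A (Ideal.span {π})] [IsLocalRing A] {Y : B} {α β : R}
  (hY : Function.Bijective (fun p : A × A => algebraMap A B p.1 + algebraMap A B p.2 * Y))
  (h : Y ^ 2 + algebraMap A B (algebraMap R A α) * Y + algebraMap A B (algebraMap R A β) = 0)

include hπ0 hY h

lemma pow_dvd_discr_of_le_multiplicity {n : ℕ}
    (hn : (n : ℕ∞) ≤ multiplicity (IsLocalRing.maximalIdeal A) B) : π ^ n ∣ α ^ 2 - 4 * β := by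
  rw [← algebraMap_mem_pow_iff (A := A) hπ0]
  rw [map_sub, map_pow, map_mul, map_ofNat]
  exact discr_mem_of_le_multiplicity _ hY h hn

/-- The condition depends on `x` only modulo `m ^ n`, as `x² - p² = (x + p)(x - p)`; hence `x` can
be taken in `R`. -/
lemma le_multiplicity_iff_exists_pow_dvd [IsPrincipalIdealRing R] (h2 : (2 : R) = 0) (hα : α = 0)
    {n : ℕ} : (n : ℕ∞) ≤ multiplicity (IsLocalRing.maximalIdeal A) B ↔
      ∃ x : R, π ^ n ∣ β + x ^ 2 := by
  have h2' : (2 : A) = 0 := by rw [← map_ofNat (algebraMap R A) 2, h2, map_zero]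
  rw [le_multiplicity_iff_of_two_eq_zero _ hY h h2' (by rw [hα, map_zero])]
  constructor
  · rintro ⟨x, hx⟩
    obtain ⟨p, hp⟩ := exists_sub_algebraMap_mem_pow (π := π) hπ0 x n
    refine ⟨p, ?_⟩
    rw [← algebraMap_mem_pow_iff (A := A) hπ0, map_add, map_pow]
    have := sub_mem hx (Ideal.mul_mem_left _ (x + algebraMap R A p) hp)
    convert this using 1
    ring
  · rintro ⟨x, hx⟩
    refine ⟨algebraMap R A x, ?_⟩
    rwa [← map_pow, ← map_add, algebraMap_mem_pow_iff hπ0]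

end LocalMultiplicity

end

end DoubleCover

/-! ### Bases of the form `1, y` under localization and on stalks. -/

namespace DoubleCover

noncomputable section

section Pair

/-- The map `(c, d) ↦ c + d y`. -/
def pairHom {S T : Type*} [CommRing S] [CommRing T] (φ : S →+* T) (y : T) : S × S →+ T :=
  φ.toAddMonoidHom.coprod ((AddMonoidHom.mulRight y).comp φ.toAddMonoidHom)

lemma pairHom_apply {S T : Type*} [CommRing S] [CommRing T] (φ : S →+* T) (y : T) (p : S × S) :
    pairHom φ y p = φ p.1 + φ p.2 * y := rfl

lemma pairHom_bijective_of_isLocalization {S T S' T' : Type*} [CommRing S] [CommRing T]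
    [CommRing S'] [CommRing T'] [Algebra S S'] [Algebra T T'] (M : Submonoid S) (φ : S →+* T)
    (φ' : S' →+* T') [IsLocalization M S'] [IsLocalization (M.map φ) T']
    (comm : ∀ s, φ' (algebraMap S S' s) = algebraMap T T' (φ s)) {y : T}
    (hy : Function.Bijective (pairHom φ y)) :
    Function.Bijective (pairHom φ' (algebraMap T T' y)) := by
  constructor
  · rw [injective_iff_map_eq_zero]
    rintro ⟨c, d⟩ h
    -- Bring the two coefficients to a common denominator.
    obtain ⟨c, d, m, rfl, rfl⟩ : ∃ (c' d' : S) (m : M), c = IsLocalization.mk' S' c' m ∧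
        d = IsLocalization.mk' S' d' m := by
      obtain ⟨c', m, rfl⟩ := IsLocalization.exists_mk'_eq M c
      obtain ⟨d', n, rfl⟩ := IsLocalization.exists_mk'_eq M d
      exact ⟨c' * n, d' * m, m * n, (IsLocalization.mk'_cancel _ _ _).symm, by
        rw [mul_comm m n]; exact (IsLocalization.mk'_cancel _ _ _).symm⟩
    have h1 : algebraMap T T' (pairHom φ y (c, d)) = 0 := by
      have h2 : φ' (algebraMap S S' m) * (φ' (IsLocalization.mk' S' c m) +
          φ' (IsLocalization.mk' S' d m) * algebraMap T T' y) = 0 := by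
        rw [pairHom_apply] at h; rw [h, mul_zero]
      rw [mul_add, ← mul_assoc, ← map_mul, ← map_mul, IsLocalization.mk'_spec',
        IsLocalization.mk'_spec', comm, comm, ← map_mul, ← map_add] at h2
      exact h2
    obtain ⟨⟨_, n, hn, rfl⟩, h2⟩ := (IsLocalization.map_eq_zero_iff (M.map φ) T' _).mp h1
    have h3 : pairHom φ y (n * c, n * d) = 0 := by
      rw [pairHom_apply] at h2 ⊢
      simp only [map_mul] at h2 ⊢
      linear_combination h2
    have h4 := (injective_iff_map_eq_zero _).mp hy.1 _ h3
    simp only [Prod.mk_eq_zero] at h4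
    ext
    · exact (IsLocalization.mk'_eq_zero_iff c m).mpr ⟨⟨n, hn⟩, h4.1⟩
    · exact (IsLocalization.mk'_eq_zero_iff d m).mpr ⟨⟨n, hn⟩, h4.2⟩
  · intro t'
    obtain ⟨t, ⟨_, m, hm, rfl⟩, rfl⟩ := IsLocalization.exists_mk'_eq (M.map φ) t'
    obtain ⟨⟨c, d⟩, rfl⟩ := hy.2 t
    refine ⟨(IsLocalization.mk' S' c ⟨m, hm⟩, IsLocalization.mk' S' d ⟨m, hm⟩), ?_⟩
    rw [IsLocalization.eq_mk'_iff_mul_eq, ← comm, pairHom_apply, pairHom_apply, add_mul,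
      mul_right_comm, ← map_mul, ← map_mul]
    have := fun c => IsLocalization.mk'_spec S' c ⟨m, hm⟩
    dsimp only at this ⊢
    rw [this, this, comm, comm, map_add, map_mul]

open TopCat.Presheaf Opposite

/-- A stalk is a filtered colimit of sections, so it suffices that `1, y` is a basis over
arbitrarily small neighbourhoods of `q`. These will be basic opens of an affine neighbourhood. -/
lemma pairHom_bijective_stalk {X : TopCat.{u}} {F G : X.Presheaf CommRingCat.{u}} (φ : F ⟶ G) {q : X}
    {U : Opens X} (hq : q ∈ U) (y : G.obj (op U))
    (H : ∀ W : Opens X, q ∈ W → ∃ (V : Opens X) (hV : V ≤ U), q ∈ V ∧ V ≤ W ∧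
      Function.Bijective (pairHom (φ.app (op V)).hom ((G.map (homOfLE hV).op).hom y))) :
    Function.Bijective (pairHom ((stalkFunctor CommRingCat.{u} q).map φ).hom
      ((G.germ U q hq).hom y)) := by
  have hnat : ∀ (V : Opens X) (hV : V ≤ U) (hqV : q ∈ V) (p : F.obj (op V) × F.obj (op V)),
      pairHom ((stalkFunctor CommRingCat.{u} q).map φ).hom ((G.germ U q hq).hom y)
        ((F.germ V q hqV).hom p.1, (F.germ V q hqV).hom p.2) =
      (G.germ V q hqV).hom (pairHom (φ.app (op V)).hom ((G.map (homOfLE hV).op).hom y) p) := by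
    intro V hV hqV p
    have h1 := fun s => stalkFunctor_map_germ_apply V q hqV φ s
    have h2 := G.germ_res_apply (homOfLE hV) q hqV y
    simp only [pairHom_apply, map_add, map_mul]
    exact congrArg₂ _ (h1 p.1) (congrArg₂ _ (h1 p.2) h2.symm)
  constructor
  · rw [injective_iff_map_eq_zero]
    rintro ⟨c, d⟩ h
    obtain ⟨V₁, hV₁, c, rfl⟩ := F.exists_germ_eq c
    obtain ⟨V₂, hV₂, d, rfl⟩ := F.exists_germ_eq d
    obtain ⟨V, hVU, hqV, hV, -⟩ := H (V₁ ⊓ V₂) ⟨hV₁, hV₂⟩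
    rw [← F.germ_res_apply (homOfLE (hV.trans inf_le_left)) q hqV,
      ← F.germ_res_apply (homOfLE (hV.trans inf_le_right)) q hqV] at h ⊢
    generalize F.map (homOfLE (hV.trans inf_le_left)).op c = c' at h ⊢
    generalize F.map (homOfLE (hV.trans inf_le_right)).op d = d' at h ⊢
    have h1 := (hnat V hVU hqV (c', d')).symm.trans h
    obtain ⟨W, hqW, i₁, i₂, h2⟩ := G.germ_eq q hqV hqV _ 0 (h1.trans (map_zero (G.germ V q hqV).hom).symm)
    obtain ⟨V', hVU', hqV', hV', hb⟩ := H W hqW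
    have h3 := congrArg (G.map (homOfLE hV').op).hom h2
    have hc : ∀ s : F.obj (op V), (G.map (homOfLE hV').op).hom ((G.map i₁.op).hom
        ((φ.app (op V)).hom s)) = (φ.app (op V')).hom ((F.map (homOfLE (hV'.trans i₁.le)).op).hom s) := by
      intro s
      have := CategoryTheory.NatTrans.naturality_apply φ (homOfLE (hV'.trans i₁.le)).op s
      refine Eq.trans ?_ this.symm
      exact (CategoryTheory.ConcreteCategory.congr_hom (G.map_comp i₁.op (homOfLE hV').op) _).symm
    have hd : (G.map (homOfLE hV').op).hom ((G.map i₁.op).hom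
        ((G.map (homOfLE hVU).op).hom y)) = (G.map (homOfLE hVU').op).hom y := by
      rw [← RingHom.comp_apply, ← RingHom.comp_apply, ← CommRingCat.hom_comp, ← CommRingCat.hom_comp,
        ← G.map_comp, ← G.map_comp]
      rfl
    have h4 : pairHom (φ.app (op V')).hom ((G.map (homOfLE hVU').op).hom y)
        ((F.map (homOfLE (hV'.trans i₁.le)).op).hom c',
          (F.map (homOfLE (hV'.trans i₁.le)).op).hom d') = 0 := by
      rw [pairHom_apply, ← hc, ← hc, ← hd, ← map_mul, ← map_mul, ← map_add, ← map_add]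
      refine h3.trans ?_
      change (G.map (homOfLE hV').op).hom ((G.map i₂.op).hom 0) = 0
      rw [map_zero, map_zero]
    have h5 := (injective_iff_map_eq_zero _).mp hb.1 _ h4
    simp only [Prod.mk_eq_zero] at h5
    have h6 := fun s => F.germ_res_apply (homOfLE (hV'.trans i₁.le)) q hqV' s
    ext
    · exact (h6 c').symm.trans ((congrArg _ h5.1).trans (map_zero _))
    · exact (h6 d').symm.trans ((congrArg _ h5.2).trans (map_zero _))
  · intro b
    obtain ⟨V₁, hV₁, b, rfl⟩ := G.exists_germ_eq b
    obtain ⟨V, hVU, hqV, hV, hb⟩ := H V₁ hV₁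
    obtain ⟨p, hp⟩ := hb.2 ((G.map (homOfLE hV).op).hom b)
    refine ⟨_, (hnat V hVU hqV p).trans ?_⟩
    rw [hp]
    exact G.germ_res_apply (homOfLE hV) q hqV b

end Pair

section Charts

variable {X : Scheme.{u}} {R : CommRingCat.{u}} (j : Spec R ⟶ X) [IsOpenImmersion j] (U : X.Opens)
  (hU : j.opensRange = U)

lemma top_le_preimage (hU : j.opensRange = U) : ⊤ ≤ j ⁻¹ᵁ U := by
  subst hU; intro x _; exact ⟨x, rfl⟩

/-- The identification `Γ(X, U) → R` for an affine chart `Spec R ⟶ X` with image `U`. -/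
def chartSections : Γ(X, U) ⟶ R :=
  j.appLE U ⊤ (top_le_preimage j U hU) ≫ (Scheme.ΓSpecIso R).hom

instance : IsIso (chartSections j U hU) := by
  obtain rfl : j ''ᵁ ⊤ = U := by rw [Scheme.Hom.image_top_eq_opensRange, hU]
  rw [chartSections, ← Scheme.Hom.appIso_hom']
  infer_instance

lemma germ_stalkMap_eq_chartSections (x : Spec R) (hx : j x ∈ U) :
    X.presheaf.germ U (j x) hx ≫ j.stalkMap x = chartSections j U hU ≫ (Scheme.ΓSpecIso R).inv ≫
      (Spec R).presheaf.germ ⊤ x trivial := by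
  rw [j.germ_stalkMap, chartSections, Category.assoc, Iso.hom_inv_id_assoc, Scheme.Hom.appLE,
    Category.assoc]
  exact congrArg (j.app U ≫ ·) ((Spec R).presheaf.germ_res _ _ _).symm

/-- The map from the coordinate ring of an affine chart to a stalk. -/
def chartStalk (x : Spec R) (hx : j x ∈ U) : R ⟶ X.presheaf.stalk (j x) :=
  inv (chartSections j U hU) ≫ X.presheaf.germ U (j x) hx

lemma chartStalk_stalkMap (x : Spec R) (hx : j x ∈ U) :
    chartStalk j U hU x hx ≫ j.stalkMap x = (Scheme.ΓSpecIso R).inv ≫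
      (Spec R).presheaf.germ ⊤ x trivial := by
  rw [chartStalk, Category.assoc, germ_stalkMap_eq_chartSections j U hU, IsIso.inv_hom_id_assoc]

lemma isLocalization_chartStalk (x : PrimeSpectrum R) (hx : j x ∈ U) :
    @IsLocalization R _ x.asIdeal.primeCompl (X.presheaf.stalk (j x)) _
      (chartStalk j U hU x hx).hom.toAlgebra := by
  let := (chartStalk j U hU x hx).hom.toAlgebra
  let : Algebra R ((Spec R).presheaf.stalk x) := StructureSheaf.stalkAlgebra R x
  have : IsLocalization.AtPrime ((Spec R).presheaf.stalk x) x.asIdeal :=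
    StructureSheaf.IsLocalization.to_stalk R x
  obtain ⟨z, rfl⟩ : ∃ z : Spec R, z = x := ⟨x, rfl⟩
  have e : (Spec R).presheaf.stalk z ≃ₐ[R] X.presheaf.stalk (j z) :=
    (AlgEquiv.ofRingEquiv (f := (asIso (j.stalkMap z)).commRingCatIsoToRingEquiv)
      fun s => ConcreteCategory.congr_hom (chartStalk_stalkMap j U hU z hx) s).symm
  exact IsLocalization.isLocalization_of_algEquiv _ e

end Charts

section Morphism

variable {Y Z : Scheme.{u}} (ψ : Y ⟶ Z) {U : Z.Opens} (hU : IsAffineOpen U)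
  (hV : IsAffineOpen (ψ ⁻¹ᵁ U)) (y : Γ(Y, ψ ⁻¹ᵁ U))

include hU hV

lemma pairHom_bijective_basicOpen (hy : Function.Bijective (pairHom (ψ.app U).hom y)) (f : Γ(Z, U)) :
    Function.Bijective (pairHom (ψ.app (Z.basicOpen f)).hom
      ((Y.presheaf.map (homOfLE (ψ.preimage_mono (Z.basicOpen_le f))).op).hom y)) := by
  let := (Z.presheaf.map (homOfLE (Z.basicOpen_le f)).op).hom.toAlgebra
  let := (Y.presheaf.map (homOfLE (ψ.preimage_mono (Z.basicOpen_le f))).op).hom.toAlgebra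
  have h1 : IsLocalization (Submonoid.powers f) Γ(Z, Z.basicOpen f) :=
    hU.isLocalization_of_eq_basicOpen f (homOfLE (Z.basicOpen_le f)) rfl
  have h2 : IsLocalization ((Submonoid.powers f).map (ψ.app U).hom) Γ(Y, ψ ⁻¹ᵁ Z.basicOpen f) := by
    rw [Submonoid.map_powers]
    exact hV.isLocalization_of_eq_basicOpen ((ψ.app U).hom f) (homOfLE (ψ.preimage_mono (Z.basicOpen_le f)))
      (Scheme.preimage_basicOpen ψ f)
  exact pairHom_bijective_of_isLocalization (Submonoid.powers f) (ψ.app U).hom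
    (ψ.app (Z.basicOpen f)).hom (fun s => ConcreteCategory.congr_hom (ψ.naturality (homOfLE (Z.basicOpen_le f)).op) s) hy

lemma pairHom_bijective_toPushforwardStalk (hy : Function.Bijective (pairHom (ψ.app U).hom y)) (q : Z)
    (hq : q ∈ U) : Function.Bijective (pairHom (toPushforwardStalk ψ q).hom
      ((((TopCat.Presheaf.pushforward CommRingCat.{u} ψ.base).obj Y.presheaf).germ U q hq).hom y)) := by
  refine pairHom_bijective_stalk (G := (TopCat.Presheaf.pushforward CommRingCat.{u} ψ.base).obj
    Y.presheaf) ψ.c hq y fun W hW => ?_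
  obtain ⟨f, hf, hqf⟩ := hU.exists_basicOpen_le ⟨q, hW⟩ hq
  exact ⟨Z.basicOpen f, Z.basicOpen_le f, hqf, hf, pairHom_bijective_basicOpen ψ hU hV y hy f⟩

end Morphism

end

end DoubleCover

/-! ### Multiplicity and residue degree computed on a chart. -/

namespace DoubleCover

noncomputable section

section Charts

variable {Y Z : Scheme.{u}} (ψ : Y ⟶ Z) {R S : CommRingCat.{u}} (φ : R ⟶ S) (j : Spec R ⟶ Z)
  (j' : Spec S ⟶ Y) [IsOpenImmersion j] [IsOpenImmersion j'] (comm : j' ≫ ψ = Spec.map φ ≫ j)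
  (U : Z.Opens) (hU : j.opensRange = U) (hV : j'.opensRange = ψ ⁻¹ᵁ U)

include comm hU

lemma app_chartSections :
    ψ.app U ≫ chartSections j' (ψ ⁻¹ᵁ U) hV = chartSections j U hU ≫ φ := by
  have h1 : ψ.app U ≫ j'.appLE (ψ ⁻¹ᵁ U) ⊤ (top_le_preimage j' _ hV) =
      j.appLE U ⊤ (top_le_preimage j U hU) ≫ (Spec.map φ).appLE ⊤ ⊤ le_top := by
    rw [← Scheme.Hom.appLE_eq_app, Scheme.Hom.appLE_comp_appLE]
    refine Eq.trans ?_ (Scheme.Hom.appLE_comp_appLE (Spec.map φ) j U ⊤ ⊤ _ _).symm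
    simp only [comm]
  rw [chartSections, chartSections, reassoc_of% h1, Category.assoc]
  congr 1
  rw [← Scheme.ΓSpecIso_naturality]
  exact congrArg (· ≫ _) (Scheme.Hom.appLE_eq_app ..)

lemma map_inv_chartSections :
    φ ≫ inv (chartSections j' (ψ ⁻¹ᵁ U) hV) = inv (chartSections j U hU) ≫ ψ.app U := by
  rw [IsIso.comp_inv_eq, Category.assoc, app_chartSections ψ φ j j' comm U hU hV,
    IsIso.inv_hom_id_assoc]

lemma pairHom_bijective_chart {w : S} (hw : Function.Bijective (pairHom φ.hom w)) :
    Function.Bijective (pairHom (ψ.app U).hom ((inv (chartSections j' (ψ ⁻¹ᵁ U) hV)).hom w)) := by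
  have h1 : Function.Bijective (chartSections j U hU).hom :=
    ConcreteCategory.bijective_of_isIso (chartSections j U hU)
  have h2 : Function.Bijective (inv (chartSections j' (ψ ⁻¹ᵁ U) hV)).hom :=
    ConcreteCategory.bijective_of_isIso (inv (chartSections j' (ψ ⁻¹ᵁ U) hV))
  have h3 := (h2.comp hw).comp (h1.prodMap h1)
  convert h3 using 1
  funext p
  have h4 := fun s => ConcreteCategory.congr_hom (map_inv_chartSections ψ φ j j' comm U hU hV)
    ((chartSections j U hU).hom s)
  have h5 : ∀ s, (inv (chartSections j U hU)).hom ((chartSections j U hU).hom s) = s :=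
    fun s => ConcreteCategory.congr_hom (IsIso.hom_inv_id (chartSections j U hU)) s
  simp only [Function.comp, pairHom_apply, Prod.map, map_add, map_mul]
  refine congrArg₂ _ ?_ (congrArg (· * _) ?_)
  · exact ((h4 p.1).trans (congrArg (ψ.app U).hom (h5 p.1))).symm
  · exact ((h4 p.2).trans (congrArg (ψ.app U).hom (h5 p.2))).symm

omit comm hU in
/-- The map from the coordinate ring of an affine chart of the source to the stalk of the
pushforward. -/
def chartPushforwardStalk (q : Z) (hq : q ∈ U) : S ⟶ pushforwardStalk ψ q :=
  inv (chartSections j' (ψ ⁻¹ᵁ U) hV) ≫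
    ((TopCat.Presheaf.pushforward CommRingCat.{u} ψ.base).obj Y.presheaf).germ U q hq

lemma map_chartPushforwardStalk (x : Spec R) (hq : j x ∈ U) :
    φ ≫ chartPushforwardStalk ψ j' U hV (j x) hq =
      chartStalk j U hU x hq ≫ toPushforwardStalk ψ (j x) := by
  have h1 : Z.presheaf.germ U (j x) hq ≫ toPushforwardStalk ψ (j x) = ψ.app U ≫
      ((TopCat.Presheaf.pushforward CommRingCat.{u} ψ.base).obj Y.presheaf).germ U (j x) hq :=
    TopCat.Presheaf.stalkFunctor_map_germ U (j x) hq ψ.c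
  rw [chartPushforwardStalk, chartStalk, Category.assoc, h1, ← Category.assoc,
    map_inv_chartSections ψ φ j j' comm U hU hV, Category.assoc]

lemma pairHom_bijective_chartStalk {w : S} (hw : Function.Bijective (pairHom φ.hom w)) (q : Z)
    (hq : q ∈ U) : Function.Bijective (pairHom (toPushforwardStalk ψ q).hom
      ((chartPushforwardStalk ψ j' U hV q hq).hom w)) :=
  pairHom_bijective_toPushforwardStalk ψ (hU ▸ isAffineOpen_opensRange j)
    (hV ▸ isAffineOpen_opensRange j') _ (pairHom_bijective_chart ψ φ j j' comm U hU hV hw) q hq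

end Charts

section ChartQuadratic

variable {Y Z : Scheme.{u}} (ψ : Y ⟶ Z) {R S : Type u} [CommRing R] [IsDomain R]
  [CommRing S] [Algebra R S] (j : Spec (.of R) ⟶ Z)
  (j' : Spec (.of S) ⟶ Y) [IsOpenImmersion j] [IsOpenImmersion j']
  (comm : j' ≫ ψ = Spec.map (CommRingCat.ofHom (algebraMap R S)) ≫ j)
  (hV : j'.opensRange = ψ ⁻¹ᵁ j.opensRange) {w : S} {α β : R}
  (hw : Function.Bijective (pairHom (algebraMap R S) w))
  (h : w ^ 2 + algebraMap R S α * w + algebraMap R S β = 0)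
  {x : PrimeSpectrum R} {π : R} (hπ0 : π ≠ 0) (hx : x.asIdeal = Ideal.span {π})

include comm hV hw h hπ0 hx

/-- The stalk of the base is the localization of `R` at `(π)`, and `1, w` is a basis of the stalk of
the pushforward over it, so the local statement applies. -/
lemma pow_dvd_discr_of_le_lam {n : ℕ} (hn : (n : ℕ∞) ≤ lam ψ (j x)) : π ^ n ∣ α ^ 2 - 4 * β := by
  have hπ : (Ideal.span {π}).IsPrime := hx ▸ x.2
  let := (chartStalk j _ rfl x ⟨x, rfl⟩).hom.toAlgebra
  let := (toPushforwardStalk ψ (j x)).hom.toAlgebra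
  have : IsLocalization.AtPrime (Z.presheaf.stalk (j x)) (Ideal.span {π}) := by
    have := isLocalization_chartStalk j _ rfl x ⟨x, rfl⟩
    simp only [hx] at this
    exact this
  have hc := fun s => ConcreteCategory.congr_hom
    (map_chartPushforwardStalk ψ _ j j' comm _ rfl hV x ⟨x, rfl⟩) s
  refine pow_dvd_discr_of_le_multiplicity (A := Z.presheaf.stalk (j x))
    (B := pushforwardStalk ψ (j x)) hπ0
    (pairHom_bijective_chartStalk ψ _ j j' comm _ rfl hV hw (j x) ⟨x, rfl⟩) ?_ hn
  have := congrArg (chartPushforwardStalk ψ j' _ hV (j x) ⟨x, rfl⟩).hom h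
  rw [map_add, map_add, map_mul, map_pow, map_zero] at this
  rw [← this]
  exact congrArg₂ _ (congrArg₂ _ rfl (congrArg (· * _) (hc α).symm)) (hc β).symm

lemma le_lam_iff [IsPrincipalIdealRing R] (h2 : (2 : R) = 0) (hα : α = 0) {n : ℕ} :
    (n : ℕ∞) ≤ lam ψ (j x) ↔ ∃ x, π ^ n ∣ β + x ^ 2 := by
  have hπ : (Ideal.span {π}).IsPrime := hx ▸ x.2
  let := (chartStalk j _ rfl x ⟨x, rfl⟩).hom.toAlgebra
  let := (toPushforwardStalk ψ (j x)).hom.toAlgebra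
  have : IsLocalization.AtPrime (Z.presheaf.stalk (j x)) (Ideal.span {π}) := by
    have := isLocalization_chartStalk j _ rfl x ⟨x, rfl⟩
    simp only [hx] at this
    exact this
  have hc := fun s => ConcreteCategory.congr_hom
    (map_chartPushforwardStalk ψ _ j j' comm _ rfl hV x ⟨x, rfl⟩) s
  refine le_multiplicity_iff_exists_pow_dvd (A := Z.presheaf.stalk (j x))
    (B := pushforwardStalk ψ (j x)) hπ0
    (pairHom_bijective_chartStalk ψ _ j j' comm _ rfl hV hw (j x) ⟨x, rfl⟩) ?_ h2 hα
  have := congrArg (chartPushforwardStalk ψ j' _ hV (j x) ⟨x, rfl⟩).hom h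
  rw [map_add, map_add, map_mul, map_pow, map_zero] at this
  rw [← this]
  exact congrArg₂ _ (congrArg₂ _ rfl (congrArg (· * _) (hc α).symm)) (hc β).symm

end ChartQuadratic

section ResidueField

variable {k : Type u} [Field k] {Z : Scheme.{u}} (p : Z ⟶ Spec (.of k)) {R : Type u} [CommRing R]
  [Algebra k R] (j : Spec (.of R) ⟶ Z) [IsOpenImmersion j]
  (comm : j ≫ p = Spec.map (CommRingCat.ofHom (algebraMap k R)))

include comm

omit [IsOpenImmersion j] in
lemma toSections_app : CommRingCat.ofHom (toSections p ⊤) ≫ j.appTop =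
    CommRingCat.ofHom (algebraMap k R) ≫ (Scheme.ΓSpecIso (.of R)).inv := by
  have h1 : CommRingCat.ofHom (toSections p ⊤) = (Scheme.ΓSpecIso (.of k)).inv ≫ p.appTop := by
    rw [toSections, CommRingCat.ofHom_hom]
    exact congrArg (_ ≫ ·) (Scheme.Hom.appLE_eq_app ..)
  rw [h1, Category.assoc, ← Scheme.Hom.comp_appTop, comm]
  exact (Scheme.ΓSpecIso_inv_naturality _).symm

lemma chartStalk_algebraMap (x : Spec (.of R)) (c : k) :
    (chartStalk j _ rfl x ⟨x, rfl⟩).hom (algebraMap k R c) =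
      (Z.presheaf.germ ⊤ (j x) trivial).hom (toSections p ⊤ c) := by
  have h0 : Function.Injective (j.stalkMap x).hom :=
    (ConcreteCategory.bijective_of_isIso (j.stalkMap x)).1
  refine h0 ((ConcreteCategory.congr_hom (chartStalk_stalkMap j _ rfl x ⟨x, rfl⟩) _).trans ?_)
  refine Eq.trans ?_ (j.germ_stalkMap_apply ⊤ x trivial _).symm
  exact congrArg ((Spec (.of R)).presheaf.germ ⊤ x trivial).hom
    (ConcreteCategory.congr_hom (toSections_app p j comm) c).symm

/-- The residue field at a closed point of an affine chart. -/
lemma exists_residueField_equiv (x : PrimeSpectrum R) [hx : x.asIdeal.IsMaximal] :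
    ∃ e : R ⧸ x.asIdeal ≃+* Z.residueField (j x),
      ∀ c, e (algebraMap k _ c) = residueMap p (j x) c := by
  let := (chartStalk j _ rfl x ⟨x, rfl⟩).hom.toAlgebra
  have : IsLocalization.AtPrime (Z.presheaf.stalk (j x)) x.asIdeal :=
    isLocalization_chartStalk j _ rfl x ⟨x, rfl⟩
  refine ⟨IsLocalization.AtPrime.equivQuotMaximalIdeal x.asIdeal (Z.presheaf.stalk (j x)),
    fun c => ?_⟩
  exact congrArg (IsLocalRing.residue _) (chartStalk_algebraMap p j comm x c)

lemma residueDegree_eq (x : PrimeSpectrum R) [hx : x.asIdeal.IsMaximal] :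
    residueDegree p (j x) = Module.finrank k (R ⧸ x.asIdeal) := by
  obtain ⟨e, he⟩ := exists_residueField_equiv p j comm x
  let := (residueMap p (j x)).toAlgebra
  exact (LinearEquiv.finrank_eq (AlgEquiv.ofRingEquiv (f := e) he).toLinearEquiv).symm

omit comm in
lemma residueDegree_eq_one (q : Z) (h : Function.Bijective (residueMap p q)) :
    residueDegree p q = 1 := by
  let := (residueMap p q).toAlgebra
  have e : k ≃ₐ[k] Z.residueField q := AlgEquiv.ofBijective (Algebra.ofId _ _) h
  exact (e.toLinearEquiv.finrank_eq).symm.trans (Module.finrank_self k)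

end ResidueField

end

end DoubleCover

/-! ### Closed points of the projective line. -/

namespace DoubleCover

noncomputable section

open MvPolynomial HomogeneousLocalization

variable {k : Type u} [Field k]

lemma lineChart_preimage (i j : Fin 2) :
    lineChart i ⁻¹ᵁ Proj.basicOpen (homogeneousSubmodule (Fin 2) k) (X j) =
      PrimeSpectrum.basicOpen (chartCoord i j : Polynomial k) := by
  rw [lineChart, Scheme.Hom.comp_preimage,
    Proj.awayι_preimage_basicOpen _ _ _ (X_mem_homogeneous j) Nat.one_pos]
  refine (SpecMap_preimage_basicOpen _ _).trans ?_
  congr 1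
  refine (lineEval_mk i 1 _ _).trans ?_
  rw [pow_one, dehom_X]

/-- Ensures that a point of a chart is closed in the chart exactly when it is closed in `ℙ¹`. -/
instance : JacobsonSpace (P1 k) := by
  rw [IsOpenCover.jacobsonSpace_iff (U := fun i : Fin 2 => (lineChart (k := k) i).opensRange)]
  · intro i
    let e := (lineChart (k := k) i).isOpenEmbedding.isEmbedding.toHomeomorph
    have : JacobsonSpace (PrimeSpectrum (Polynomial k)) := inferInstance
    have : JacobsonSpace (Spec (.of (Polynomial k))) := this
    exact JacobsonSpace.of_isClosedEmbedding e.symm.isClosedEmbedding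
  · simp only [opensRange_lineChart]
    exact iSup_basicOpen_X

variable (k) in
/-- The closed points of the projective line: monic irreducible polynomials and `∞`. -/
abbrev Place : Type u := Option {π : Polynomial k // π.Monic ∧ Irreducible π}

/-- The chart used at a closed point. -/
def placeChart (P : Place k) : Fin 2 := P.elim 1 fun _ => 0

/-- The local equation of a closed point. -/
def placePoly (P : Place k) : Polynomial k := P.elim Polynomial.X fun π => π.1

lemma placePoly_monic (P : Place k) : (placePoly P).Monic := by
  rcases P with _ | π
  exacts [Polynomial.monic_X, π.2.1]

lemma placePoly_irreducible (P : Place k) : Irreducible (placePoly P) := by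
  rcases P with _ | π
  exacts [Polynomial.irreducible_X, π.2.2]

/-- A closed point as a prime ideal in the coordinate ring of its chart. -/
def placePrime (P : Place k) : PrimeSpectrum (Polynomial k) :=
  ⟨Ideal.span {placePoly P}, (Ideal.span_singleton_prime (placePoly_monic P).ne_zero).mpr
    (placePoly_irreducible P).prime⟩

instance (P : Place k) : (placePrime P).asIdeal.IsMaximal :=
  PrincipalIdealRing.isMaximal_of_irreducible (placePoly_irreducible P)

/-- The closed point of the projective line given by a monic irreducible polynomial or `∞`. -/
def placePoint (P : Place k) : P1 k := lineChart (placeChart P) (placePrime P)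

lemma lineChart_mem_basicOpen_iff (i j : Fin 2) (x : PrimeSpectrum (Polynomial k)) :
    lineChart i x ∈ Proj.basicOpen (homogeneousSubmodule (Fin 2) k) (X j) ↔
      (chartCoord i j : Polynomial k) ∉ x.asIdeal := by
  have := SetLike.ext_iff.mp (lineChart_preimage (k := k) i j) x
  exact this

lemma lineChart_mem_closedPoints_iff (i : Fin 2) (x : PrimeSpectrum (Polynomial k)) :
    lineChart i x ∈ closedPoints (P1 k) ↔ x.asIdeal.IsMaximal := by
  rw [← PrimeSpectrum.isClosed_singleton_iff_isMaximal]
  exact Set.ext_iff.mp (lineChart (k := k) i).isOpenEmbedding.preimage_closedPoints x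

lemma lineChart_injective (i : Fin 2) {x y : PrimeSpectrum (Polynomial k)}
    (h : lineChart i x = lineChart i y) : x = y :=
  (lineChart (k := k) i).isOpenEmbedding.injective h

/-- Closed points of the chart `0` are the maximal ideals of `k[u]`, each with a unique monic
irreducible generator. The only point outside this chart is the origin of the chart `1`. -/
lemma bijOn_placePoint : Set.BijOn (placePoint (k := k)) Set.univ (closedPoints (P1 k)) := by
  have hne : ∀ x : PrimeSpectrum (Polynomial k),
      lineChart 0 x ≠ placePoint (none : Place k) := by
    intro x h
    have h1 := (lineChart_mem_basicOpen_iff 0 0 x).mpr (by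
      rw [chartCoord_self]; exact fun h => x.2.ne_top ((Ideal.eq_top_iff_one _).mpr h))
    rw [h] at h1
    have h2 := (lineChart_mem_basicOpen_iff 1 0 _).mp h1
    exact h2 (Ideal.mem_span_singleton_self _)
  refine ⟨fun P _ => (lineChart_mem_closedPoints_iff _ _).mpr inferInstance, ?_, ?_⟩
  · rintro (_ | ⟨π, hπ⟩) - (_ | ⟨π', hπ'⟩) - h
    · rfl
    · exact absurd h.symm (hne _)
    · exact absurd h (hne _)
    · have h1 := congrArg PrimeSpectrum.asIdeal (lineChart_injective 0 h)
      have h2 := Polynomial.eq_of_monic_of_associated hπ.1 hπ'.1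
        (Ideal.span_singleton_eq_span_singleton.mp h1)
      subst h2; rfl
  · intro q hq
    by_cases h0 : q ∈ Proj.basicOpen (homogeneousSubmodule (Fin 2) k) (X 0)
    · rw [← opensRange_lineChart] at h0
      obtain ⟨x, rfl⟩ := h0
      have hx := (lineChart_mem_closedPoints_iff 0 x).mp hq
      have hx0 : x.asIdeal ≠ ⊥ := Ring.ne_bot_of_isMaximal_of_not_isField hx
        (Polynomial.not_isField k)
      obtain ⟨p, hp⟩ := (IsPrincipalIdealRing.principal x.asIdeal).principal
      rw [Ideal.submodule_span_eq] at hp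
      have hp0 : p ≠ 0 := by rintro rfl; exact hx0 (by rw [hp]; simp)
      have hpp : Prime p := (Ideal.span_singleton_prime hp0).mp (hp ▸ x.2)
      classical
      refine ⟨some ⟨normalize p, Polynomial.monic_normalize hp0,
        (associated_normalize p).irreducible hpp.irreducible⟩, trivial, ?_⟩
      refine congrArg (lineChart 0) (PrimeSpectrum.ext ?_)
      rw [hp]
      exact Ideal.span_singleton_eq_span_singleton.mpr (normalize_associated p)
    · have h1 : q ∈ ⨆ i : Fin 2, Proj.basicOpen (homogeneousSubmodule (Fin 2) k) (X i) := by
        rw [iSup_basicOpen_X]; trivial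
      obtain ⟨i, hi⟩ := Opens.mem_iSup.mp h1
      obtain rfl : i = 1 := by
        rcases Fin.exists_fin_two.mp ⟨i, rfl⟩ with h | h
        · subst h; exact absurd hi h0
        · exact h
      rw [← opensRange_lineChart] at hi
      obtain ⟨x, rfl⟩ := hi
      have h2 := not_not.mp (mt (lineChart_mem_basicOpen_iff 1 0 x).mpr h0)
      refine ⟨none, trivial, ?_⟩
      refine congrArg (lineChart 1) (PrimeSpectrum.ext ?_)
      refine Ideal.IsMaximal.eq_of_le (inferInstanceAs (placePrime none).asIdeal.IsMaximal) x.2.ne_top ?_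
      exact (Ideal.span_singleton_le_iff_mem _).mpr h2

/-- The degree of a closed point. -/
def placeDegree (P : Place k) : ℕ := (placePoly P).natDegree

lemma residueDegree_placePoint (P : Place k) :
    residueDegree (P1Over k) (placePoint P) = placeDegree P :=
  (residueDegree_eq _ _ (lineChart_over _) (placePrime P)).trans
    finrank_quotient_span_eq_natDegree

section Lam

variable {r : ℕ} (a : homogeneousSubmodule (Fin 2) k r)
    (b : homogeneousSubmodule (Fin 2) k (2 * r)) (hr : 0 < r)

lemma pairHom_omega_bijective (i : Fin 2) : Function.Bijective
    (pairHom (algebraMap (Polynomial k) (ChartRing a b i)) QuadraticAlgebra.omega) := by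
  have h : ∀ p : Polynomial k × Polynomial k,
      pairHom (algebraMap (Polynomial k) (ChartRing a b i)) QuadraticAlgebra.omega p = ⟨p.1, p.2⟩ := by
    intro p
    rw [pairHom_apply]
    ext <;> simp
  constructor
  · intro p q hpq
    rw [h, h] at hpq
    simpa [QuadraticAlgebra.ext_iff, Prod.ext_iff] using hpq
  · rintro ⟨c, d⟩
    exact ⟨(c, d), h _⟩

lemma omega_equation (i : Fin 2) : (QuadraticAlgebra.omega : ChartRing a b i) ^ 2 +
    algebraMap (Polynomial k) _ (dehom i a.1) * QuadraticAlgebra.omega +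
      algebraMap (Polynomial k) _ (dehom i b.1) = 0 := by
  rw [pow_two]
  ext <;> simp

lemma pow_dvd_of_le_lam (P : Place k) {n : ℕ}
    (hn : (n : ℕ∞) ≤ lam (curveToP1 a b hr) (placePoint P)) :
    placePoly P ^ n ∣ dehom (placeChart P) a.1 ^ 2 - 4 * dehom (placeChart P) b.1 :=
  pow_dvd_discr_of_le_lam _ _ _ (curveChart_curveToP1 a b hr (placeChart P))
    (by rw [opensRange_curveChart, opensRange_lineChart, curveToP1_preimage])
    (pairHom_omega_bijective a b _) (omega_equation a b _) (placePoly_monic P).ne_zero rfl hn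

lemma le_lam_placePoint_iff (h2 : (2 : k) = 0) (ha : a = 0) (P : Place k) {n : ℕ} :
    (n : ℕ∞) ≤ lam (curveToP1 a b hr) (placePoint P) ↔
      ∃ x, placePoly P ^ n ∣ dehom (placeChart P) b.1 + x ^ 2 :=
  le_lam_iff _ _ _ (curveChart_curveToP1 a b hr (placeChart P))
    (by rw [opensRange_curveChart, opensRange_lineChart, curveToP1_preimage])
    (pairHom_omega_bijective a b _) (omega_equation a b _) (placePoly_monic P).ne_zero rfl
    (by rw [← map_ofNat Polynomial.C, h2, map_zero]) (by rw [ha]; exact map_zero _)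

end Lam

end

end DoubleCover

/-! ### Counting zeros of sections of `𝒪(n)`. -/

namespace DoubleCover

noncomputable section

section Places

open Polynomial

variable {k : Type u} [Field k]

/-- The local expression at a closed point of a section of `𝒪(n)` given by `f`. -/
def placeLocal (n : ℕ) (P : Place k) (f : k[X]) : k[X] := P.elim (f.reflect n) fun _ => f

lemma placeLocal_add (n : ℕ) (P : Place k) (f g : k[X]) :
    placeLocal n P (f + g) = placeLocal n P f + placeLocal n P g := by
  rcases P with _ | π
  exacts [reflect_add _ _ _, rfl]

lemma placeLocal_C_mul (n : ℕ) (P : Place k) (c : k) (f : k[X]) :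
    placeLocal n P (C c * f) = C c * placeLocal n P f := by
  rcases P with _ | π
  exacts [reflect_C_mul _ _ _, rfl]

lemma placeLocal_mul {m n : ℕ} (P : Place k) {f g : k[X]} (hf : f.natDegree ≤ m)
    (hg : g.natDegree ≤ n) :
    placeLocal (m + n) P (f * g) = placeLocal m P f * placeLocal n P g := by
  rcases P with _ | π
  exacts [reflect_mul _ _ hf hg, rfl]

lemma placeLocal_sq {n : ℕ} (P : Place k) {f : k[X]} (hf : f.natDegree ≤ n) :
    placeLocal (2 * n) P (f ^ 2) = placeLocal n P f ^ 2 := by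
  rw [two_mul, pow_two, pow_two, placeLocal_mul P hf hf]

lemma placeLocal_ne_zero (n : ℕ) (P : Place k) {f : k[X]} (hf : f ≠ 0) : placeLocal n P f ≠ 0 := by
  rcases P with _ | π
  · exact mt reflect_eq_zero_iff.mp hf
  · exact hf

lemma natDegree_placeLocal_le {n : ℕ} (P : Place k) {f : k[X]} (hf : f.natDegree ≤ n) :
    (placeLocal n P f).natDegree ≤ n := by
  rcases P with _ | π
  · rw [natDegree_le_iff_coeff_eq_zero]
    intro j hj
    change (f.reflect n).coeff j = 0
    rw [coeff_reflect, revAt_eq_self_of_lt hj]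
    exact coeff_eq_zero_of_natDegree_lt (by omega)
  · exact hf

lemma dehom_placeChart {n : ℕ} {F : MvPolynomial (Fin 2) k}
    (hF : F ∈ MvPolynomial.homogeneousSubmodule (Fin 2) k n) (P : Place k) :
    dehom (placeChart P) F = placeLocal n P (dehom 0 F) := by
  rcases P with _ | π
  · exact dehom_rev hF 0
  · rfl

lemma placeDegree_pos (P : Place k) : 0 < placeDegree P :=
  (placePoly_irreducible P).natDegree_pos

/-- For `f ≠ 0`, the order of vanishing at infinity of `f` as a section of `𝒪(n)` is `n - deg f`. -/
lemma X_pow_dvd_reflect_iff {n m : ℕ} {f : k[X]} (hm : m ≤ n) (hf : f.natDegree ≤ n) :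
    X ^ m ∣ f.reflect n ↔ f.natDegree ≤ n - m := by
  rw [X_pow_dvd_iff, natDegree_le_iff_coeff_eq_zero]
  constructor
  · intro h j hj
    by_cases hjn : j ≤ n
    · have := h (n - j) (by omega)
      rwa [coeff_reflect, revAt_le (by omega), Nat.sub_sub_self hjn] at this
    · exact coeff_eq_zero_of_natDegree_lt (by omega)
  · intro h j hj
    rw [coeff_reflect, revAt_le (by omega)]
    exact h _ (by omega)

lemma prod_pow_dvd {s : Finset {π : k[X] // π.Monic ∧ Irreducible π}}
    {e : {π : k[X] // π.Monic ∧ Irreducible π} → ℕ} {f : k[X]} (h : ∀ π ∈ s, π.1 ^ e π ∣ f) :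
    ∏ π ∈ s, π.1 ^ e π ∣ f := by
  refine Finset.prod_dvd_of_coprime (fun π _ π' _ hne => ?_) h
  refine IsCoprime.pow ((π.2.2.coprime_iff_not_dvd).mpr fun hd => hne (Subtype.ext ?_))
  exact eq_of_monic_of_associated π.2.1 π'.2.1 ((π.2.2.dvd_irreducible_iff_associated π'.2.2).mp hd)

lemma natDegree_prod_pow (s : Finset {π : k[X] // π.Monic ∧ Irreducible π})
    (e : {π : k[X] // π.Monic ∧ Irreducible π} → ℕ) :
    (∏ π ∈ s, π.1 ^ e π).natDegree = ∑ π ∈ s, e π * placeDegree (some π) := by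
  rw [natDegree_prod_of_monic _ _ fun π _ => π.2.1.pow _]
  exact Finset.sum_congr rfl fun π _ => π.2.1.natDegree_pow _

lemma sum_place_le (s : Finset (Place k)) (g : Place k → ℕ) :
    ∑ P ∈ s, g P ≤ g none + ∑ π ∈ s.eraseNone, g (some π) := by
  classical
  rw [show ∑ π ∈ s.eraseNone, g (some π) = ∑ P ∈ s.eraseNone.map Function.Embedding.some, g P from
    (Finset.sum_map s.eraseNone Function.Embedding.some g).symm]
  have : s ⊆ insert none (s.eraseNone.map Function.Embedding.some) := by
    intro P hP
    rcases P with _ | π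
    · simp
    · simp [hP]
  refine (Finset.sum_le_sum_of_subset this).trans ?_
  rw [Finset.sum_insert (by simp)]

/-- A nonzero section of `𝒪(n)` on the projective line has at most `n` zeros. -/
lemma sum_mul_placeDegree_le {n : ℕ} {f : k[X]} (hf0 : f ≠ 0) (hf : f.natDegree ≤ n)
    {e : Place k → ℕ} (h : ∀ P, placePoly P ^ e P ∣ placeLocal n P f) (s : Finset (Place k)) :
    ∑ P ∈ s, e P * placeDegree P ≤ n := by
  refine (sum_place_le s _).trans ?_
  -- Needed before `e none` can be subtracted from `n` in `ℕ`.
  have h1 : e none ≤ n := by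
    have h2 := natDegree_le_of_dvd (h none) (placeLocal_ne_zero n none hf0)
    have h3 : (placePoly (none : Place k) ^ e none).natDegree = e none := natDegree_X_pow _
    exact h3 ▸ h2.trans (natDegree_placeLocal_le none hf)
  -- A zero of order `e none` at infinity lowers the degree of `f` by that much, which leaves `n - e
  -- none` for the finite zeros.
  have h2 := (X_pow_dvd_reflect_iff h1 hf).mp (h none)
  have h3 := natDegree_le_of_dvd (prod_pow_dvd (s := s.eraseNone) (e := fun π => e (some π))
    fun π _ => h (some π)) hf0
  rw [natDegree_prod_pow] at h3
  have h4 : placeDegree (none : Place k) = 1 := natDegree_X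
  rw [h4]
  omega

lemma mul_placeDegree_le {n : ℕ} {f : k[X]} (hf0 : f ≠ 0) (hf : f.natDegree ≤ n)
    {P : Place k} {e : ℕ} (h : placePoly P ^ e ∣ placeLocal n P f) : e * placeDegree P ≤ n := by
  classical
  have := sum_mul_placeDegree_le hf0 hf (e := fun Q => if Q = P then e else 0) (fun Q => by
    by_cases hQ : Q = P
    · subst hQ; simpa using h
    · simp [hQ]) {P}
  simpa using this

/-- A nonzero section of `𝒪(n)` on the projective line has exactly `n` zeros. -/
lemma exists_sum_mul_placeDegree {n : ℕ} {f : k[X]} (hf0 : f ≠ 0) (hf : f.natDegree ≤ n) :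
    ∃ (s : Finset (Place k)) (e : Place k → ℕ),
      (∀ P ∈ s, placePoly P ^ e P ∣ placeLocal n P f) ∧ ∑ P ∈ s, e P * placeDegree P = n := by
  classical
  let t := (UniqueFactorizationMonoid.normalizedFactors f).toFinset
  have ht : ∀ p ∈ t, p.Monic ∧ Irreducible p := by
    intro p hp
    rw [Multiset.mem_toFinset] at hp
    have h1 := UniqueFactorizationMonoid.irreducible_of_normalized_factor p hp
    refine ⟨?_, h1⟩
    rw [← UniqueFactorizationMonoid.normalize_normalized_factor p hp]
    exact monic_normalize h1.ne_zero
  -- At infinity the order is the defect `n - deg f`; at `π` it is the multiplicity in the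
  -- factorization of `f`.
  let e : Place k → ℕ := fun P => P.elim (n - f.natDegree)
    fun π => (UniqueFactorizationMonoid.normalizedFactors f).count π.1
  have hprod : Associated (∏ p ∈ t, p ^ (UniqueFactorizationMonoid.normalizedFactors f).count p) f := by
    rw [← Finset.prod_multiset_count]
    exact UniqueFactorizationMonoid.prod_normalizedFactors hf0
  refine ⟨insert none ((t.attach.image fun p => ⟨p.1, ht p.1 p.2⟩).map Function.Embedding.some), e,
    fun P hP => ?_, ?_⟩
  · rcases P with _ | π
    · exact (X_pow_dvd_reflect_iff (by simp [e]) hf).mpr (by simp only [e, Option.elim]; omega)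
    · have hπ : π.1 ∈ t := by
        simp only [Finset.mem_insert, Finset.mem_map, Finset.mem_image] at hP
        obtain h | ⟨_, ⟨p, -, rfl⟩, h⟩ := hP
        · cases h
        · cases h; exact p.2
      exact (Finset.dvd_prod_of_mem (fun p => p ^
        (UniqueFactorizationMonoid.normalizedFactors f).count p) hπ).trans hprod.dvd
  · rw [Finset.sum_insert (by simp), Finset.sum_map, Finset.sum_image (by
      intro p _ q _ h; exact Subtype.ext (Subtype.mk.inj h))]
    have h1 := natDegree_eq_of_degree_eq (degree_eq_degree_of_associated hprod)
    rw [natDegree_prod_of_monic _ _ fun p hp => (ht p hp).1.pow _, ← Finset.sum_attach] at h1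
    have h2 : ∑ p ∈ t.attach, e (Function.Embedding.some ⟨p.1, ht p.1 p.2⟩) *
        placeDegree (Function.Embedding.some ⟨p.1, ht p.1 p.2⟩ : Place k) = f.natDegree := by
      rw [← h1]
      exact Finset.sum_congr rfl fun p _ => ((ht p.1 p.2).1.natDegree_pow _).symm
    rw [h2]
    have h4 : placeDegree (none : Place k) = 1 := natDegree_X
    rw [h4]
    simp only [e, Option.elim]
    omega

end Places

lemma finite_support_of_sum_le {ι : Type*} {f : ι → ℕ} {n : ℕ} (h : ∀ s : Finset ι, ∑ i ∈ s, f i ≤ n) :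
    f.support.Finite := by
  by_contra hinf
  obtain ⟨t, ht, hc⟩ := Set.Infinite.exists_subset_card_eq hinf (n + 1)
  have h1 := h t
  have h2 : ∑ i ∈ t, 1 ≤ ∑ i ∈ t, f i :=
    Finset.sum_le_sum fun i hi => Nat.one_le_iff_ne_zero.mpr (ht hi)
  rw [Finset.sum_const, hc] at h2
  simp at h2
  omega

lemma finsum_le_of_sum_le {ι : Type*} {f : ι → ℕ} {n : ℕ} (h : ∀ s : Finset ι, ∑ i ∈ s, f i ≤ n) :
    ∑ᶠ i, f i ≤ n := by
  rw [finsum_eq_sum f (finite_support_of_sum_le h)]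
  exact h _

end

end DoubleCover

/-! ### Characteristic two: operators linear over squares, and `β = c w² + l²`. -/

namespace DoubleCover

noncomputable section

section CharTwo

open Polynomial

variable {k : Type u} [Field k] [CharP k 2]

/-- A nonsquare in characteristic two is detected by a functional over the subfield of squares. -/
lemma exists_frobenius_functional {c : k} (hc : ¬ IsSquare c) :
    ∃ φ : k →+ k, φ 1 = 0 ∧ φ c ≠ 0 ∧ ∀ s x, φ (s ^ 2 * x) = s ^ 2 * φ x := by
  let F := (frobenius k 2).fieldRange
  -- A nonsquare lies outside the line spanned by `1` over the subfield `F` of squares, so an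
  -- `F`-linear functional can kill `1` but not `c`.
  have h1 : c ∉ Submodule.span F {(1 : k)} := by
    intro h
    obtain ⟨⟨_, s, rfl⟩, hs⟩ := Submodule.mem_span_singleton.mp h
    refine hc ⟨s, ?_⟩
    rw [← hs, Subfield.smul_def]
    simp [frobenius_def, pow_two]
  obtain ⟨f, hf, hle⟩ := Submodule.exists_le_ker_of_notMem h1
  refine ⟨(Subfield.subtype F).toAddMonoidHom.comp f.toAddMonoidHom, ?_, ?_, fun s x => ?_⟩
  · have : f 1 = 0 := hle (Submodule.mem_span_singleton_self _)
    simp [this]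
  · simpa using hf
  · have h2 : s ^ 2 * x = (⟨s ^ 2, s, rfl⟩ : F) • x := by rw [Subfield.smul_def]; rfl
    rw [h2]
    simp

/-- The map on polynomials which applies `φ` to the coefficients of even index. -/
def evenMap (φ : k →+ k) (f : k[X]) : k[X] :=
  f.sum fun i c => monomial i (if Even i then φ c else c)

omit [CharP k 2] in
lemma coeff_evenMap (φ : k →+ k) (f : k[X]) (i : ℕ) :
    (evenMap φ f).coeff i = if Even i then φ (f.coeff i) else f.coeff i := by
  rw [evenMap, sum_def, finsetSum_coeff]
  simp only [coeff_monomial]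
  rw [Finset.sum_ite_eq' f.support i]
  split_ifs with h1 h2 h2
  · rfl
  · rfl
  · rw [notMem_support_iff.mp h1, map_zero]
  · rw [notMem_support_iff.mp h1]

omit [CharP k 2] in
lemma evenMap_add (φ : k →+ k) (f g : k[X]) : evenMap φ (f + g) = evenMap φ f + evenMap φ g := by
  ext i
  simp only [coeff_evenMap, coeff_add, map_add]
  split_ifs <;> rfl

lemma coeff_sq_of_odd (f : k[X]) {i : ℕ} (hi : ¬ Even i) : (f ^ 2).coeff i = 0 := by
  rw [← map_frobenius_expand, coeff_map, coeff_expand two_pos,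
    if_neg (by rwa [← even_iff_two_dvd]), map_zero]

lemma isSquare_coeff_sq (f : k[X]) (i : ℕ) : ∃ s, (f ^ 2).coeff i = s ^ 2 := by
  rw [← map_frobenius_expand, coeff_map]
  exact ⟨_, rfl⟩

/-- A square has only even exponents, and its coefficients are squares; multiplication by it
therefore respects parity and commutes with `φ`. -/
lemma evenMap_sq_mul {φ : k →+ k} (hφ : ∀ s x, φ (s ^ 2 * x) = s ^ 2 * φ x) (f g : k[X]) :
    evenMap φ (f ^ 2 * g) = f ^ 2 * evenMap φ g := by
  ext i
  rw [coeff_evenMap, coeff_mul, coeff_mul, map_sum, ← Finset.sum_ite_irrel]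
  refine Finset.sum_congr rfl fun p hp => ?_
  rw [Finset.HasAntidiagonal.mem_antidiagonal] at hp
  by_cases h1 : Even p.1
  · obtain ⟨s, hs⟩ := isSquare_coeff_sq f p.1
    rw [coeff_evenMap, hs, hφ, ← hp]
    simp only [Nat.even_add, h1, true_iff]
    split_ifs <;> rfl
  · rw [coeff_sq_of_odd f h1, zero_mul, zero_mul, map_zero, ite_self]

lemma evenMap_sq {φ : k →+ k} (hφ : ∀ s x, φ (s ^ 2 * x) = s ^ 2 * φ x) (h1 : φ 1 = 0) (f : k[X]) :
    evenMap φ (f ^ 2) = 0 := by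
  have h2 : evenMap φ 1 = 0 := by
    ext i
    rw [coeff_evenMap, coeff_one]
    split_ifs with h3 h4 h4 <;> simp_all
  have := evenMap_sq_mul hφ f 1
  rwa [mul_one, h2, mul_zero] at this

/-- The factor `π ^ (2m)` is a square and comes out of the operator, while `x²` is killed. This
eliminates the unknown `x`, which varies from point to point. -/
lemma pow_dvd_evenMap {φ : k →+ k} (hφ : ∀ s x, φ (s ^ 2 * x) = s ^ 2 * φ x) (h1 : φ 1 = 0)
    {π f x : k[X]} {m : ℕ} (h : π ^ (2 * m) ∣ f + x ^ 2) : π ^ (2 * m) ∣ evenMap φ f := by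
  obtain ⟨g, hg⟩ := h
  have h2 : evenMap φ f = π ^ (2 * m) * evenMap φ g := by
    rw [mul_comm 2 m, pow_mul] at hg ⊢
    rw [← evenMap_sq_mul hφ, ← hg, evenMap_add, evenMap_sq hφ h1, add_zero]
  exact ⟨_, h2⟩

omit [CharP k 2] in
-- The reflection `i ↦ 2r - i` preserves parity, so the operator makes sense on sections of `𝒪(2r)`.
lemma evenMap_placeLocal (φ : k →+ k) (r : ℕ) (P : Place k) (f : k[X]) :
    evenMap φ (placeLocal (2 * r) P f) = placeLocal (2 * r) P (evenMap φ f) := by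
  rcases P with _ | π
  · ext i
    change (evenMap φ (f.reflect (2 * r))).coeff i = ((evenMap φ f).reflect (2 * r)).coeff i
    rw [coeff_evenMap, coeff_reflect, coeff_reflect, coeff_evenMap]
    have : Even (revAt (2 * r) i) ↔ Even i := by
      by_cases hi : i ≤ 2 * r
      · rw [revAt_le hi, Nat.even_sub hi]
        simp
      · rw [revAt_eq_self_of_lt (by omega)]
    simp only [this]
  · rfl

/-- In characteristic two a polynomial is a square exactly when its odd coefficients vanish and its
even ones are squares. Each way of failing this supplies a suitable `φ`. -/
lemma exists_evenMap_ne_zero {f : k[X]} (hf : ¬ IsSquare f) :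
    ∃ φ : k →+ k, φ 1 = 0 ∧ (∀ s x, φ (s ^ 2 * x) = s ^ 2 * φ x) ∧ evenMap φ f ≠ 0 := by
  by_cases hodd : ∃ i, ¬ Even i ∧ f.coeff i ≠ 0
  · obtain ⟨i, hi, h⟩ := hodd
    -- For `φ = 0` the operator keeps the odd part of `f`, which is `u` times its derivative.
    refine ⟨0, rfl, by simp, fun h0 => h ?_⟩
    have := congrArg (coeff · i) h0
    simpa [coeff_evenMap, hi] using this
  push Not at hodd
  by_cases hsq : ∀ i, IsSquare (f.coeff i)
  · refine absurd ?_ hf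
    choose s hs using hsq
    refine ⟨∑ i ∈ Finset.range (f.natDegree + 1), monomial i (s (2 * i)), ?_⟩
    rw [← pow_two]
    ext i
    rw [← map_frobenius_expand, coeff_map, coeff_expand two_pos]
    split_ifs with hi
    · obtain ⟨j, rfl⟩ := hi
      rw [Nat.mul_div_cancel_left _ two_pos, finsetSum_coeff]
      simp only [coeff_monomial, Finset.sum_ite_eq', Finset.mem_range]
      split_ifs with hj
      · rw [frobenius_def, pow_two, ← hs]
      · rw [map_zero]
        exact coeff_eq_zero_of_natDegree_lt (by omega)
    · rw [map_zero]
      exact hodd i (by rwa [even_iff_two_dvd])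
  · push Not at hsq
    obtain ⟨i, hi⟩ := hsq
    obtain ⟨φ, h1, h2, h3⟩ := exists_frobenius_functional hi
    refine ⟨φ, h1, h3, fun h0 => h2 ?_⟩
    have hi' : Even i := by
      by_contra hi'
      exact hi (hodd i hi' ▸ ⟨0, by simp⟩)
    have := congrArg (coeff · i) h0
    simpa [coeff_evenMap, hi'] using this

variable {r : ℕ} {β : k[X]} (hβ : ¬ IsSquare β) (hdeg : β.natDegree ≤ 2 * r)

include hβ hdeg

/-- A suitable `evenMap φ β` is a nonzero section of `𝒪(2r)` vanishing to order `2 m P` at every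
`P`. -/
lemma sum_sq_mul_placeDegree_le {m : Place k → ℕ}
    (H : ∀ P, ∃ x, placePoly P ^ (2 * m P) ∣ placeLocal (2 * r) P β + x ^ 2)
    (s : Finset (Place k)) : ∑ P ∈ s, 2 * m P * placeDegree P ≤ 2 * r := by
  obtain ⟨φ, h1, h2, h3⟩ := exists_evenMap_ne_zero hβ
  refine sum_mul_placeDegree_le h3 ?_ (fun P => ?_) s
  · rw [natDegree_le_iff_coeff_eq_zero]
    intro j hj
    rw [coeff_evenMap, coeff_eq_zero_of_natDegree_lt (by omega), map_zero, ite_self]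
  · obtain ⟨x, hx⟩ := H P
    rw [← evenMap_placeLocal]
    exact pow_dvd_evenMap h2 h1 hx

omit hβ hdeg [CharP k 2] in
-- Chinese remaindering with a condition at infinity. The polynomial `T` realizes the condition at
-- infinity in its top `m none` coefficients. The correction modulo `h` has degree less than `deg h
-- = r - m none`, so it fixes the finite congruences without disturbing them.
lemma exists_congruent {r : ℕ} (s : Finset {π : k[X] // π.Monic ∧ Irreducible π})
    (m : Place k → ℕ) (x : Place k → k[X]) (hm : m none + ∑ π ∈ s, m (some π) * placeDegree (some π) = r) :
    ∃ l : k[X], l.natDegree ≤ r ∧ X ^ m none ∣ l.reflect r - x none ∧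
      ∀ π ∈ s, π.1 ^ m (some π) ∣ l - x (some π) := by
  classical
  set h := ∏ π ∈ s, π.1 ^ m (some π) with hh
  have hmonic : h.Monic := monic_prod_of_monic _ _ fun π _ => π.2.1.pow _
  have hdeg : m none + h.natDegree = r := by rw [hh, natDegree_prod_pow, hm]
  obtain ⟨l₀, hl₀⟩ : ∃ l₀, ∀ π ∈ s, π.1 ^ m (some π) ∣ l₀ - x (some π) := by
    obtain ⟨l₀, hl₀⟩ := Ideal.exists_forall_sub_mem_ideal
      (I := fun π : s => Ideal.span {π.1.1 ^ m (some π.1)}) (fun π π' hne => by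
        rw [Function.onFun, Ideal.isCoprime_span_singleton_iff]
        refine IsCoprime.pow ((π.1.2.2.coprime_iff_not_dvd).mpr fun hd =>
          hne (Subtype.ext (Subtype.ext ?_)))
        exact eq_of_monic_of_associated π.1.2.1 π'.1.2.1
          ((π.1.2.2.dvd_irreducible_iff_associated π'.1.2.2).mp hd)) (fun π => x (some π.1))
    exact ⟨l₀, fun π hπ => Ideal.mem_span_singleton.mp (hl₀ ⟨π, hπ⟩)⟩
  set T := (x none %ₘ X ^ m none).reflect r with hT
  have hTdeg : T.natDegree ≤ r := by
    rw [natDegree_le_iff_coeff_eq_zero]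
    intro j hj
    rw [hT, coeff_reflect, revAt_eq_self_of_lt hj]
    refine coeff_eq_zero_of_degree_lt ((degree_modByMonic_lt _ (monic_X_pow _)).trans_le ?_)
    rw [degree_X_pow]
    exact_mod_cast (by omega : m none ≤ j)
  have hrem : ((l₀ - T) %ₘ h).degree < h.natDegree := by
    rw [← degree_eq_natDegree hmonic.ne_zero]
    exact degree_modByMonic_lt _ hmonic
  refine ⟨T + (l₀ - T) %ₘ h, ?_, ?_, fun π hπ => ?_⟩
  · refine natDegree_add_le_of_degree_le hTdeg (natDegree_le_iff_degree_le.mpr (hrem.le.trans ?_))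
    exact_mod_cast (by omega : h.natDegree ≤ r)
  · rw [reflect_add, hT, reflect_reflect]
    have h1 : X ^ m none ∣ ((l₀ - T) %ₘ h).reflect r := by
      rw [X_pow_dvd_iff]
      intro j hj
      rw [coeff_reflect, revAt_le (by omega)]
      refine coeff_eq_zero_of_degree_lt (hrem.trans_le ?_)
      exact_mod_cast (by omega : h.natDegree ≤ r - j)
    have h2 : X ^ m none ∣ x none %ₘ X ^ m none - x none :=
      ⟨-(x none /ₘ X ^ m none), by
        linear_combination modByMonic_add_div (x none) (X ^ m none)⟩
    have := dvd_add h1 h2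
    convert this using 1
    ring
  · have h1 : h ∣ T + (l₀ - T) %ₘ h - l₀ :=
      ⟨-((l₀ - T) /ₘ h), by linear_combination modByMonic_add_div (l₀ - T) h⟩
    have := dvd_add ((Finset.dvd_prod_of_mem (fun π => π.1 ^ m (some π)) hπ).trans h1) (hl₀ π hπ)
    convert this using 1
    ring

omit hβ in
/-- If the bound on the multiplicities is attained, then `β` is of the form `c w² + l²`. -/
lemma exists_eq_mul_sq_add_sq {s : Finset (Place k)} {m : Place k → ℕ}
    (H : ∀ P ∈ s, ∃ x, placePoly P ^ (2 * m P) ∣ placeLocal (2 * r) P β + x ^ 2)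
    (hs : ∑ P ∈ s, m P * placeDegree P = r) :
    ∃ (c : k) (w l : k[X]), l.natDegree ≤ r ∧ w.natDegree ≤ r ∧ β = C c * w ^ 2 + l ^ 2 := by
  classical
  -- The point at infinity may be added with multiplicity zero.
  wlog hmem : none ∈ s generalizing s m
  · refine this (s := insert none s) (m := fun P => if P ∈ s then m P else 0) ?_ ?_ (by simp)
    · intro P hP
      by_cases hPs : P ∈ s
      · simpa [hPs] using H P hPs
      · exact ⟨0, by simp [hPs]⟩
    · rw [Finset.sum_insert hmem, ← hs, if_neg hmem, zero_mul, zero_add]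
      exact Finset.sum_congr rfl fun P hP => by rw [if_pos hP]
  choose! x hx using H
  have hs' : m none + ∑ π ∈ s.eraseNone, m (some π) * placeDegree (some π) = r := by
    rw [← hs, show ∑ π ∈ s.eraseNone, m (some π) * placeDegree (some π) =
      ∑ P ∈ s.eraseNone.map Function.Embedding.some, m P * placeDegree P from
      (Finset.sum_map s.eraseNone Function.Embedding.some fun P => m P * placeDegree P).symm,
      Finset.map_some_eraseNone, ← Finset.add_sum_erase _ _ hmem]
    have h4 : placeDegree (none : Place k) = 1 := natDegree_X
    rw [h4, mul_one]
  obtain ⟨l, hl, h1, h2⟩ := exists_congruent s.eraseNone m x hs'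
  set h := ∏ π ∈ s.eraseNone, π.1 ^ m (some π) with hh
  have hmonic : h.Monic := monic_prod_of_monic _ _ fun π _ => π.2.1.pow _
  have hdeg' : m none + h.natDegree = r := by rw [hh, natDegree_prod_pow, hs']
  -- In characteristic two `l² + x² = (l - x)²`, so a congruence modulo `π ^ m` becomes one modulo
  -- `π ^ (2m)` after squaring.
  have key : ∀ {π f x l : k[X]} {m : ℕ}, π ^ (2 * m) ∣ f + x ^ 2 → π ^ m ∣ l - x →
      π ^ (2 * m) ∣ f + l ^ 2 := by
    intro π f x l m h h'
    have h3 := pow_dvd_pow_of_dvd h' 2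
    rw [← pow_mul, mul_comm] at h3
    have h4 := dvd_add h h3
    have h5 : (2 : k[X]) = 0 := CharTwo.two_eq_zero
    convert h4 using 1
    linear_combination (l * x - x ^ 2) * h5
  have h3 : h ^ 2 ∣ β + l ^ 2 := by
    rw [hh, ← Finset.prod_pow]
    simp_rw [← pow_mul, mul_comm _ 2]
    exact prod_pow_dvd (e := fun π => 2 * m (some π)) fun π hπ =>
      key (hx (some π) (by simpa using hπ)) (h2 π hπ)
  have hd2 : (β + l ^ 2).natDegree ≤ 2 * r := by
    refine natDegree_add_le_of_degree_le hdeg (natDegree_pow_le.trans ?_)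
    omega
  have h4 : (β + l ^ 2).natDegree ≤ 2 * r - 2 * m none := by
    refine (X_pow_dvd_reflect_iff (by omega) hd2).mp ?_
    have := key (hx none hmem) h1
    rw [← show placeLocal r none l = l.reflect r from rfl, ← placeLocal_sq none hl,
      ← placeLocal_add] at this
    exact this
  obtain ⟨g, hg⟩ := h3
  -- The vanishing at infinity leaves `deg (β + l²) ≤ 2r - 2 m none = 2 deg h`, so the quotient by
  -- `h²` is a constant; it is the `c` sought, with `w = h`.
  have hgdeg : g.natDegree = 0 := by
    by_cases hg0 : g = 0
    · simp [hg0]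
    have := natDegree_mul (hmonic.pow 2).ne_zero hg0
    rw [← hg, hmonic.natDegree_pow] at this
    omega
  refine ⟨g.coeff 0, h, l, hl, by omega, ?_⟩
  rw [eq_C_of_natDegree_eq_zero hgdeg] at hg
  have h5 : (2 : k[X]) = 0 := CharTwo.two_eq_zero
  linear_combination hg - l ^ 2 * h5

omit hβ hdeg in
-- Take `x = l`: in characteristic two `β + l² = c w²`.
lemma exists_pow_dvd_of_eq {c : k} {w l : k[X]} (hl : l.natDegree ≤ r) (hw : w.natDegree ≤ r)
    (h : β = C c * w ^ 2 + l ^ 2) {P : Place k} {e : ℕ} (he : placePoly P ^ e ∣ placeLocal r P w) :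
    ∃ x, placePoly P ^ (2 * e) ∣ placeLocal (2 * r) P β + x ^ 2 := by
  refine ⟨placeLocal r P l, ?_⟩
  have h5 : (2 : k[X]) = 0 := CharTwo.two_eq_zero
  rw [h, placeLocal_add, placeLocal_C_mul, placeLocal_sq P hl, placeLocal_sq P hw, add_assoc,
    ← two_mul, h5, zero_mul, add_zero, mul_comm 2, pow_mul]
  exact (pow_dvd_pow_of_dvd he 2).mul_left _

omit hβ hdeg [CharP k 2] in
-- The hypothesis gives `y = π ^ e v` and then `π ∣ c w² + v²`. Evaluating at the root of the linear
-- polynomial `π` shows `-c = (v/w)²`.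
lemma isSquare_of_pow_dvd {π w y : k[X]} (hπ : π.Monic) (hπ1 : π.natDegree = 1) {c : k} {e : ℕ}
    (hw : ¬ π ∣ w) (h : π ^ (2 * e + 1) ∣ C c * (π ^ e * w) ^ 2 + y ^ 2) : IsSquare (-c) := by
  have hirr : Irreducible π := irreducible_of_degree_eq_one (by
    rw [degree_eq_natDegree hπ.ne_zero, hπ1]; rfl)
  have h1 : π ^ (2 * e) ∣ y ^ 2 := by
    have h2 : π ^ (2 * e) ∣ C c * (π ^ e * w) ^ 2 := by
      rw [mul_pow, ← pow_mul, mul_comm e 2]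
      exact (dvd_mul_right _ _).mul_left _
    exact (dvd_add_right h2).mp ((pow_dvd_pow _ (Nat.le_succ _)).trans h)
  rw [mul_comm 2 e, pow_mul] at h1
  obtain ⟨v, rfl⟩ := (IsIntegrallyClosed.pow_dvd_pow_iff two_ne_zero).mp h1
  have h2 : π ∣ C c * w ^ 2 + v ^ 2 := by
    have h3 : π ^ (2 * e) * π ∣ π ^ (2 * e) * (C c * w ^ 2 + v ^ 2) := by
      rw [← pow_succ]
      convert h using 1
      ring
    exact (mul_dvd_mul_iff_left (pow_ne_zero _ hπ.ne_zero)).mp h3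
  have h3 : π = X - C (-π.coeff 0) := by
    rw [map_neg, sub_neg_eq_add]
    exact hπ.eq_X_add_C hπ1
  rw [h3, dvd_iff_isRoot, IsRoot.def] at h2 hw
  simp only [eval_add, eval_mul, eval_pow, eval_C] at h2
  generalize eval (-π.coeff 0) w = s at h2 hw
  generalize eval (-π.coeff 0) v = t at h2
  refine ⟨t / s, ?_⟩
  field_simp
  linear_combination -h2

omit hdeg in
/-- At a rational point, the multiplicity is twice the order of vanishing of `w`. -/
lemma exists_forall_pow_dvd_iff {c : k} {w l : k[X]} (hl : l.natDegree ≤ r) (hw : w.natDegree ≤ r)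
    (h : β = C c * w ^ 2 + l ^ 2) {P : Place k} (hP : placeDegree P = 1) :
    ∃ e ≤ r, ∀ n, (∃ x, placePoly P ^ n ∣ placeLocal (2 * r) P β + x ^ 2) ↔ n ≤ 2 * e := by
  have hw0 : w ≠ 0 := by
    rintro rfl
    exact hβ ⟨l, by rw [h]; ring⟩
  have hw' := placeLocal_ne_zero r P hw0
  obtain ⟨u, hu, hu'⟩ := (finiteMultiplicity_of_degree_pos_of_monic
    (natDegree_pos_iff_degree_pos.mp (placeDegree_pos P)) (placePoly_monic P)
    hw').exists_eq_pow_mul_and_not_dvd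
  set e := _root_.multiplicity (placePoly P) (placeLocal r P w)
  have he := mul_placeDegree_le hw0 hw (P := P) (e := e) ⟨u, hu⟩
  rw [hP, mul_one] at he
  refine ⟨e, he, fun n => ⟨?_, fun hn => ?_⟩⟩
  · rintro ⟨x, hx⟩
    -- One order of vanishing beyond `2e` would make `c` a square `s²`, and then `β = (s w + l)²`.
    by_contra hn
    replace hx := (pow_dvd_pow _ (by omega : 2 * e + 1 ≤ n)).trans hx
    rw [h, placeLocal_add, placeLocal_C_mul, placeLocal_sq P hl, placeLocal_sq P hw, hu, add_assoc,
      ← CharTwo.add_sq] at hx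
    obtain ⟨s, hs⟩ := isSquare_of_pow_dvd (placePoly_monic P) hP hu' hx
    rw [CharTwo.neg_eq] at hs
    refine hβ ⟨C s * w + l, ?_⟩
    rw [← pow_two, CharTwo.add_sq, h, hs, map_mul]
    ring
  · obtain ⟨x, hx⟩ := exists_pow_dvd_of_eq hl hw h (P := P) (e := e) ⟨u, hu⟩
    exact ⟨x, (pow_dvd_pow _ hn).trans hx⟩

end CharTwo

end

end DoubleCover

/-! ### The intersection of the two charts. -/

namespace DoubleCover

noncomputable section

open MvPolynomial HomogeneousLocalization

lemma specMap_comp_symm {R S T : Type u} [CommRing R] [CommRing S] [CommRing T] (e : R ≃+* S)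
    (f : R →+* T) {X : Scheme.{u}} (j : Spec (.of R) ⟶ X) :
    Spec.map (CommRingCat.ofHom (f.comp e.symm.toRingHom)) ≫ Spec.map e.toCommRingCatIso.hom ≫ j =
      Spec.map (CommRingCat.ofHom f) ≫ j := by
  rw [← Spec.map_comp_assoc]
  congr 2
  exact CommRingCat.hom_ext (RingHom.ext fun x => congrArg f (e.symm_apply_apply x))

lemma specMap_awayMap_comp_awayι {A σ : Type u} [CommRing A] [SetLike σ A]
    [AddSubgroupClass σ A] (𝒜 : ℕ → σ) [GradedRing 𝒜] {f g x : A} {d m m' : ℕ} (hf : f ∈ 𝒜 m)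
    (hm : 0 < m) (hg : g ∈ 𝒜 m') (hx : x = f * g) (hd : m + m' = d) (hxd : x ∈ 𝒜 d) (hd0 : 0 < d) :
    Spec.map (CommRingCat.ofHom (awayMap 𝒜 hg hx)) ≫ Proj.awayι 𝒜 f hf hm =
      Proj.awayι 𝒜 x hxd hd0 := by
  subst hd
  exact Proj.SpecMap_awayMap_awayι 𝒜 hf hm hg hx

lemma val_awayMap_mk_mul_pow {A σ : Type u} [CommRing A] [SetLike σ A]
    [AddSubgroupClass σ A] (𝒜 : ℕ → σ) [GradedRing 𝒜] {f g x : A} {m m' : ℕ} (hf : f ∈ 𝒜 m)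
    (hg : g ∈ 𝒜 m') (hx : x = f * g) (n : ℕ) (F : A) (hF : F ∈ 𝒜 (n • m)) :
    (awayMap 𝒜 hg hx (Away.mk 𝒜 hf n F hF)).val * algebraMap A (Localization.Away x) f ^ n =
      algebraMap A (Localization.Away x) F := by
  subst hx
  have hu : IsUnit (algebraMap A (Localization.Away (f * g)) g) :=
    isUnit_of_dvd_unit (map_dvd _ ⟨f, mul_comm _ _⟩)
      (IsLocalization.Away.algebraMap_isUnit (f * g))
  refine (hu.pow n).mul_left_injective ?_
  dsimp only
  rw [awayMap_mk, mul_assoc, ← mul_pow, ← map_mul]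
  refine (val_mk_mul_pow _ _ _ _).trans ?_
  rw [map_mul, map_pow]

section Overlap

variable {k : Type u} [Field k] {r : ℕ} (a : homogeneousSubmodule (Fin 2) k r)
    (b : homogeneousSubmodule (Fin 2) k (2 * r))

/-- The product of the two coordinates of the base. -/
abbrev coordProd : CoordinateRing a b := coordinateMap a b (X 0) * coordinateMap a b (X 1)

lemma coordProd_eq (i : Fin 2) :
    coordProd a b = coordinateMap a b (X i) * coordinateMap a b (X i.rev) := by
  rcases Fin.exists_fin_two.mp ⟨i, rfl⟩ with h | h <;> subst h
  · rfl
  · exact mul_comm _ _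

/-- The coordinate ring of the intersection of the two charts. -/
abbrev OverlapRing : Type u := Away (curveGrading a b) (coordProd a b)

/-- The restriction of functions from the chart `i` to the intersection of the two charts. -/
def overlapMap (i : Fin 2) : ChartRing a b i →+* OverlapRing a b :=
  (awayMap (curveGrading a b) (coordinateMap_X_mem a b i.rev) (coordProd_eq a b i)).comp
    (curveEquiv a b i).symm.toRingHom

/-- The open immersion given by the intersection of the two charts. -/
def overlapChart : Spec (.of (OverlapRing a b)) ⟶ Curve a b :=
  Proj.awayι (curveGrading a b) (coordProd a b) (SetLike.mul_mem_graded (coordinateMap_X_mem a b 0)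
    (coordinateMap_X_mem a b 1)) Nat.two_pos

instance : IsOpenImmersion (overlapChart a b) := by
  unfold overlapChart; infer_instance

lemma opensRange_overlapChart : (overlapChart a b).opensRange = chart a b 0 ⊓ chart a b 1 :=
  (Proj.opensRange_awayι _ _ _ _).trans (Proj.basicOpen_mul _ _ _)

lemma overlapMap_curveChart (i : Fin 2) :
    Spec.map (CommRingCat.ofHom (overlapMap a b i)) ≫ curveChart a b i = overlapChart a b :=
  (specMap_comp_symm (curveEquiv a b i) (awayMap (curveGrading a b)
    (coordinateMap_X_mem a b i.rev) (coordProd_eq a b i)) _).trans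
    (specMap_awayMap_comp_awayι (curveGrading a b) (coordinateMap_X_mem a b i) Nat.one_pos
      (coordinateMap_X_mem a b i.rev) (coordProd_eq a b i) rfl _ _)

lemma isUnit_algebraMap_coord (i : Fin 2) : IsUnit (algebraMap (CoordinateRing a b)
    (Localization.Away (coordProd a b)) (coordinateMap a b (X i))) := by
  refine isUnit_of_dvd_unit ?_ (IsLocalization.Away.algebraMap_isUnit (coordProd a b))
  exact map_dvd _ ⟨_, coordProd_eq a b i⟩

lemma val_overlapMap (i : Fin 2) (n : ℕ) (F : CoordinateRing a b)
    (hF : F ∈ curveGrading a b (n • 1)) :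
    (overlapMap a b i (curveDehom a b i F)).val *
      algebraMap _ _ (coordinateMap a b (X i)) ^ n = algebraMap _ _ F := by
  have h1 : (curveEquiv a b i).symm (curveDehom a b i F) =
      Away.mk _ (coordinateMap_X_mem a b i) n F hF := by
    rw [RingEquiv.symm_apply_eq]
    exact (curveEval_mk a b i n F hF).symm
  have h2 : overlapMap a b i (curveDehom a b i F) = awayMap _ (coordinateMap_X_mem a b i.rev)
      (coordProd_eq a b i) ((curveEquiv a b i).symm (curveDehom a b i F)) := rfl
  rw [h2, h1]
  exact val_awayMap_mk_mul_pow (curveGrading a b) _ (coordinateMap_X_mem a b i.rev)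
    (coordProd_eq a b i) n F hF

lemma val_overlapMap_X (i : Fin 2) :
    (overlapMap a b i (algebraMap (Polynomial k) _ Polynomial.X)).val *
      algebraMap _ _ (coordinateMap a b (X i)) = algebraMap _ _ (coordinateMap a b (X i.rev)) := by
  have := val_overlapMap a b i 1 (coordinateMap a b (X i.rev))
    (by simpa using coordinateMap_X_mem a b i.rev)
  rwa [curveDehom_coordinateMap, dehom_X, chartCoord_rev, pow_one] at this

lemma val_overlapMap_omega (i : Fin 2) :
    (overlapMap a b i QuadraticAlgebra.omega).val *
      algebraMap _ _ (coordinateMap a b (X i)) ^ r = algebraMap _ _ (zCoord a b) := by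
  have := val_overlapMap a b i r (zCoord a b) (by
    rw [smul_eq_mul, mul_one]; exact zCoord_mem a b)
  rwa [curveDehom_zCoord] at this

lemma overlapMap_X_mul : overlapMap a b 0 (algebraMap (Polynomial k) _ Polynomial.X) *
    overlapMap a b 1 (algebraMap (Polynomial k) _ Polynomial.X) = 1 := by
  apply HomogeneousLocalization.val_injective
  rw [HomogeneousLocalization.val_mul, HomogeneousLocalization.val_one]
  refine ((isUnit_algebraMap_coord a b 0).mul (isUnit_algebraMap_coord a b 1)).mul_left_injective ?_
  have h0 := val_overlapMap_X a b 0
  have h1 := val_overlapMap_X a b 1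
  have e0 : (0 : Fin 2).rev = 1 := rfl
  have e1 : (1 : Fin 2).rev = 0 := rfl
  rw [e0] at h0
  rw [e1] at h1
  dsimp only
  rw [mul_mul_mul_comm, h0, h1, one_mul, mul_comm]

/-- This is `z / x₁^r = (x₀ / x₁)^r · z / x₀^r`; the transition factor turns the summand spanned by
`y` into `𝒪(-r)`. -/
lemma overlapMap_omega : overlapMap a b 1 QuadraticAlgebra.omega =
    overlapMap a b 1 (algebraMap (Polynomial k) _ Polynomial.X) ^ r *
      overlapMap a b 0 QuadraticAlgebra.omega := by
  apply HomogeneousLocalization.val_injective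
  rw [HomogeneousLocalization.val_mul, HomogeneousLocalization.val_pow]
  refine ((isUnit_algebraMap_coord a b 1).pow r).mul_left_injective ?_
  have h0 := val_overlapMap_omega a b 0
  have h1 := val_overlapMap_omega a b 1
  have h2 := val_overlapMap_X a b 1
  have e1 : (1 : Fin 2).rev = 0 := rfl
  rw [e1] at h2
  dsimp only
  rw [mul_right_comm, ← mul_pow, h2, h1, ← h0, mul_comm]

lemma isLocalization_overlapMap :
    @IsLocalization.Away (ChartRing a b 0) _ (algebraMap (Polynomial k) _ Polynomial.X)
      (OverlapRing a b) _ (overlapMap a b 0).toAlgebra := by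
  let := (awayMap (curveGrading a b) (coordinateMap_X_mem a b 1) (coordProd_eq a b 0)).toAlgebra
  have h1 : IsLocalization.Away (Away.isLocalizationElem (coordinateMap_X_mem a b 0)
      (coordinateMap_X_mem a b 1)) (OverlapRing a b) :=
    Away.isLocalization_mul _ _ (coordProd_eq a b 0) one_ne_zero
  have h2 := IsLocalization.isLocalization_of_base_ringEquiv (Submonoid.powers
    (Away.isLocalizationElem (coordinateMap_X_mem a b 0) (coordinateMap_X_mem a b 1)))
    (OverlapRing a b) (curveEquiv a b 0)
  have h3 : Submonoid.map (curveEquiv a b 0) (Submonoid.powers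
      (Away.isLocalizationElem (coordinateMap_X_mem a b 0) (coordinateMap_X_mem a b 1))) =
      Submonoid.powers (algebraMap (Polynomial k) (ChartRing a b 0) Polynomial.X) := by
    rw [Submonoid.map_powers]
    congr 1
    refine (curveEval_mk a b 0 1 _ _).trans ?_
    rw [pow_one, curveDehom_coordinateMap, dehom_X]
    rfl
  rw [h3] at h2
  exact h2

open LaurentPolynomial in
/-- Laurent polynomials as functions on the intersection of the two charts. -/
def laurentMap : LaurentPolynomial k →+* OverlapRing a b :=
  IsLocalization.Away.lift (Polynomial.X : Polynomial k)
    (g := (overlapMap a b 0).comp (algebraMap (Polynomial k) _))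
    (.of_mul_eq_one _ (overlapMap_X_mul a b))

lemma laurentMap_toLaurent (p : Polynomial k) :
    laurentMap a b (Polynomial.toLaurent p) = overlapMap a b 0 (algebraMap (Polynomial k) _ p) :=
  IsLocalization.Away.lift_eq _ _ p

lemma laurentMap_pairHom_bijective : Function.Bijective
    (pairHom (laurentMap a b) (overlapMap a b 0 QuadraticAlgebra.omega)) := by
  let := (overlapMap a b 0).toAlgebra
  have h1 : IsLocalization ((Submonoid.powers (Polynomial.X : Polynomial k)).map
      (algebraMap (Polynomial k) (ChartRing a b 0))) (OverlapRing a b) := by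
    rw [Submonoid.map_powers]
    exact isLocalization_overlapMap a b
  exact pairHom_bijective_of_isLocalization (Submonoid.powers (Polynomial.X : Polynomial k))
    (algebraMap (Polynomial k) (ChartRing a b 0)) (laurentMap a b)
    (fun p => laurentMap_toLaurent a b p) (pairHom_omega_bijective a b 0)

lemma laurentMap_T_neg_one :
    laurentMap a b (.T (-1)) = overlapMap a b 1 (algebraMap (Polynomial k) _ Polynomial.X) := by
  have h1 : laurentMap a b (.T 1) = overlapMap a b 0 (algebraMap (Polynomial k) _ Polynomial.X) := by
    rw [← laurentMap_toLaurent, Polynomial.toLaurent_X]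
  have h2 : laurentMap a b (.T 1) * laurentMap a b (.T (-1)) = 1 := by
    rw [← map_mul, ← LaurentPolynomial.T_add]; simp
  have h3 := overlapMap_X_mul a b
  rw [← h1] at h3
  calc _ = laurentMap a b (.T (-1)) * (laurentMap a b (.T 1) * _) := by rw [h3, mul_one]
    _ = _ := by rw [← mul_assoc, mul_comm (laurentMap a b (.T (-1))), h2, one_mul]

end Overlap

end

end DoubleCover

/-! ### Laurent polynomials and restriction of sections. -/

namespace DoubleCover

noncomputable section

section Laurent

open LaurentPolynomial

variable {k : Type*} [Field k]

lemma coeff_toLaurent_natCast (f : Polynomial k) (n : ℕ) :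
    (Polynomial.toLaurent f).coeff (n : ℤ) = f.coeff n := by
  rw [coeff_toLaurent]
  exact Finsupp.mapDomain_apply Nat.castEmbedding.injective _ _

lemma coeff_toLaurent_of_neg (f : Polynomial k) {n : ℤ} (hn : n < 0) :
    (Polynomial.toLaurent f).coeff n = 0 := by
  rw [coeff_toLaurent]
  refine Finsupp.mapDomain_of_notMem_range _ _ ?_
  rintro ⟨m, rfl⟩
  exact absurd hn (by simp)

lemma coeff_mul_T (f : LaurentPolynomial k) (m n : ℤ) : (f * T m).coeff n = f.coeff (n - m) := by
  have := AddMonoidAlgebra.coeff_mul_single_eq_coeff_mul (x := f) (r := (1 : k)) (m := m)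
    (m₁ := n) (n - m) (fun m' _ => eq_sub_iff_add_eq.symm)
  exact this.trans (mul_one _)

/-- The part of a Laurent polynomial in the range of a two-chart Čech differential. -/
lemma exists_laurent_decomposition (r : ℕ) (d : LaurentPolynomial k) :
    ∃ (f g : Polynomial k) (e : Fin (r - 1) → k),
      d = Polynomial.toLaurent f - invert (Polynomial.toLaurent g) * T (-r) +
        ∑ j, C (e j) * T (-((j : ℕ) + 1)) := by
  induction d using LaurentPolynomial.induction_on' with
  | add p q hp hq =>
    obtain ⟨f, g, e, rfl⟩ := hp
    obtain ⟨f', g', e', rfl⟩ := hq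
    refine ⟨f + f', g + g', e + e', ?_⟩
    simp only [map_add, Pi.add_apply, add_mul, Finset.sum_add_distrib]
    ring
  -- Exponents `n ≥ 0` come from the first chart and exponents `n ≤ -r` from the second. The `r - 1`
  -- exponents strictly between `-r` and `0` remain.
  | C_mul_T n c =>
    by_cases h0 : 0 ≤ n
    · obtain ⟨m, rfl⟩ := Int.eq_ofNat_of_zero_le h0
      exact ⟨Polynomial.monomial m c, 0, 0, by simp⟩
    by_cases hr : n ≤ -r
    · obtain ⟨m, hm⟩ := Int.eq_ofNat_of_zero_le (by omega : 0 ≤ -r - n)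
      refine ⟨0, Polynomial.monomial m (-c), 0, ?_⟩
      simp only [map_zero, Polynomial.toLaurent_C_mul_T, map_mul, invert_C, invert_T, mul_T_assoc,
        Pi.zero_apply, zero_mul, Finset.sum_const_zero, map_neg, neg_mul]
      rw [show -(m : ℤ) + -r = n by omega]
      simp
    · obtain ⟨m, hm⟩ := Int.eq_ofNat_of_zero_le (by omega : 0 ≤ -n - 1)
      refine ⟨0, 0, Pi.single ⟨m, by omega⟩ c, ?_⟩
      rw [Finset.sum_eq_single ⟨m, by omega⟩]
      · simp only [map_zero, zero_mul, sub_zero, zero_add, Pi.single_eq_same]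
        rw [show -((m : ℤ) + 1) = n by omega]
      · intro j _ hj
        rw [Pi.single_eq_of_ne hj, map_zero, zero_mul]
      · simp

lemma laurent_coeff_sum {r : ℕ} (e : Fin (r - 1) → k) (i : Fin (r - 1)) :
    (∑ j, C (e j) * T (-((j : ℕ) + 1)) : LaurentPolynomial k).coeff (-((i : ℕ) + 1)) = e i := by
  rw [AddMonoidAlgebra.coeff_sum, Finset.sum_apply', Finset.sum_eq_single i]
  · rw [coeff_mul_T]; simp
  · intro j _ hj
    rw [coeff_mul_T, C_apply, if_neg]
    intro h
    exact hj (Fin.ext (by omega))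
  · simp

lemma laurent_coeff_cech {r : ℕ} (f g : Polynomial k) (i : Fin (r - 1)) :
    (Polynomial.toLaurent f - invert (Polynomial.toLaurent g) * T (-r) :
      LaurentPolynomial k).coeff (-((i : ℕ) + 1)) = 0 := by
  rw [AddMonoidAlgebra.coeff_sub, Finsupp.sub_apply, coeff_toLaurent_of_neg f (by omega), coeff_mul_T,
    invert_apply, coeff_toLaurent_of_neg g (by have := i.2; omega), sub_zero]

/-- One side has only exponents `≥ 0` and the other only exponents `≤ 0`. -/
lemma exists_eq_C_of_toLaurent_eq {f g : Polynomial k}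
    (h : Polynomial.toLaurent f = invert (Polynomial.toLaurent g)) :
    ∃ c, f = Polynomial.C c ∧ g = Polynomial.C c := by
  have hf : f = Polynomial.C (f.coeff 0) := by
    ext n
    rcases Nat.eq_zero_or_pos n with rfl | hn
    · simp
    · rw [Polynomial.coeff_C_of_ne_zero hn.ne', ← coeff_toLaurent_natCast, h, invert_apply,
        coeff_toLaurent_of_neg g (by omega)]
  refine ⟨f.coeff 0, hf, Polynomial.toLaurent_injective ?_⟩
  rw [hf, Polynomial.toLaurent_C] at h
  rw [Polynomial.toLaurent_C, ← invert_C, h]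
  exact (involutive_invert _).symm

/-- The exponents are `≥ 0` on one side and `≤ -r < 0` on the other. -/
lemma eq_zero_of_toLaurent_eq {r : ℕ} (hr : 0 < r) {f g : Polynomial k}
    (h : Polynomial.toLaurent f = invert (Polynomial.toLaurent g) * T (-r)) : f = 0 ∧ g = 0 := by
  have hf : f = 0 := by
    ext n
    rw [← coeff_toLaurent_natCast, h, coeff_mul_T, invert_apply,
      coeff_toLaurent_of_neg g (by omega), Polynomial.coeff_zero]
  refine ⟨hf, Polynomial.toLaurent_injective ?_⟩
  rw [hf, map_zero] at h
  have h2 := congrArg (· * (T (r : ℤ) : LaurentPolynomial k)) h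
  simp only [zero_mul, mul_T_assoc, neg_add_cancel, T_zero, mul_one] at h2
  rw [map_zero]
  exact (map_eq_zero_iff _ (invert (R := k)).injective).mp h2.symm

end Laurent

section Restriction

variable {X : Scheme.{u}} {R S : CommRingCat.{u}} (j : Spec R ⟶ X) [IsOpenImmersion j]
  (j' : Spec S ⟶ X) [IsOpenImmersion j'] (φ : R ⟶ S) (h : Spec.map φ ≫ j = j') {U V : X.Opens}
  (hU : j.opensRange = U) (hV : j'.opensRange = V) (hVU : V ≤ U)

include h

lemma map_chartSections : X.presheaf.map (homOfLE hVU).op ≫ chartSections j' V hV =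
    chartSections j U hU ≫ φ := by
  rw [chartSections, chartSections, Category.assoc, ← Scheme.ΓSpecIso_naturality]
  have h1 : X.presheaf.map (homOfLE hVU).op ≫ j'.appLE V ⊤ (top_le_preimage j' V hV) =
      j.appLE U ⊤ (top_le_preimage j U hU) ≫ (Spec.map φ).appLE ⊤ ⊤ le_top := by
    refine Eq.trans ?_ (Scheme.Hom.appLE_comp_appLE (Spec.map φ) j U ⊤ ⊤ _ _).symm
    rw [Scheme.Hom.map_appLE]
    simp only [h]
  rw [reassoc_of% h1]
  exact congrArg (_ ≫ · ≫ _) (Scheme.Hom.appLE_eq_app ..)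

lemma map_inv_chartSections_apply (s : R) :
    (X.presheaf.map (homOfLE hVU).op).hom ((inv (chartSections j U hU)).hom s) =
      (inv (chartSections j' V hV)).hom (φ.hom s) := by
  have h1 : inv (chartSections j U hU) ≫ X.presheaf.map (homOfLE hVU).op =
      φ ≫ inv (chartSections j' V hV) := by
    rw [IsIso.inv_comp_eq, ← Category.assoc, ← map_chartSections j j' φ h hU hV hVU,
      Category.assoc, IsIso.hom_inv_id, Category.comp_id]
  exact ConcreteCategory.congr_hom h1 s

omit h in
lemma toSections_chart {k : Type u} [Field k] (p : X ⟶ Spec (.of k)) (f : k →+* R)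
    (hp : j ≫ p = Spec.map (CommRingCat.ofHom f)) (c : k) :
    toSections p U c = (inv (chartSections j U hU)).hom (f c) := by
  have h1 : ((Scheme.ΓSpecIso (.of k)).inv ≫ p.appLE ⊤ U (le_preimage_top p U)) ≫
      chartSections j U hU = CommRingCat.ofHom f := by
    have h2 : p.appLE ⊤ U (le_preimage_top p U) ≫ j.appLE U ⊤ (top_le_preimage j U hU) =
        (Spec.map (CommRingCat.ofHom f)).appLE ⊤ ⊤ le_top := by
      rw [Scheme.Hom.appLE_comp_appLE]
      simp only [hp]
    rw [chartSections, Category.assoc, reassoc_of% h2, Iso.inv_comp_eq,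
      ← Scheme.ΓSpecIso_naturality]
    exact congrArg (· ≫ _) (Scheme.Hom.appLE_eq_app ..)
  rw [← IsIso.eq_comp_inv] at h1
  exact ConcreteCategory.congr_hom h1 c

end Restriction

end

end DoubleCover

/-! ### Čech cohomology of the curve. -/

namespace DoubleCover

noncomputable section

section CechLinear

open LaurentPolynomial

variable {k : Type*} [Field k] {M₀ M₁ W : Type*} [AddCommGroup M₀] [Module k M₀] [AddCommGroup M₁]
  [Module k M₁] [AddCommGroup W] [Module k W] (D : M₀ × M₁ →ₗ[k] W) {r : ℕ}
  (e₀ : (Polynomial k × Polynomial k) ≃ₗ[k] M₀) (e₁ : (Polynomial k × Polynomial k) ≃ₗ[k] M₁)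
  (e : (LaurentPolynomial k × LaurentPolynomial k) ≃ₗ[k] W)
  (hD : ∀ p q, D (e₀ p, e₁ q) = e (Polynomial.toLaurent p.1 - invert (Polynomial.toLaurent q.1),
    Polynomial.toLaurent p.2 - invert (Polynomial.toLaurent q.2) * T (-r)))

include hD

/-- In coordinates the differential is the direct sum of those of `𝒪` and `𝒪(-r)`. The first has the
constants as kernel, the second has none because `r > 0`. -/
lemma exists_of_mem_ker_cech (hr : 0 < r) {x : M₀ × M₁} (hx : D x = 0) :
    ∃ c, x = (e₀ (Polynomial.C c, 0), e₁ (Polynomial.C c, 0)) := by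
  obtain ⟨x₀, x₁⟩ := x
  obtain ⟨p, rfl⟩ := e₀.surjective x₀
  obtain ⟨q, rfl⟩ := e₁.surjective x₁
  rw [hD, LinearEquiv.map_eq_zero_iff, Prod.mk_eq_zero, sub_eq_zero, sub_eq_zero] at hx
  obtain ⟨c, h1, h2⟩ := exists_eq_C_of_toLaurent_eq hx.1
  obtain ⟨h3, h4⟩ := eq_zero_of_toLaurent_eq hr hx.2
  exact ⟨c, Prod.ext (congrArg e₀ (Prod.ext h1 h3)) (congrArg e₁ (Prod.ext h2 h4))⟩

lemma finrank_ker_cech (hr : 0 < r) : Module.finrank k (LinearMap.ker D) = 1 := by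
  have h1 : D (e₀ (Polynomial.C 1, 0), e₁ (Polynomial.C 1, 0)) = 0 := by
    rw [hD]; simp
  refine finrank_eq_one ⟨_, LinearMap.mem_ker.mpr h1⟩ ?_ ?_
  · intro h
    have h2 := congrArg (fun x => x.1.1) h
    exact one_ne_zero (α := Polynomial k)
      (congrArg Prod.fst ((LinearEquiv.map_eq_zero_iff e₀).mp h2))
  · rintro ⟨x, hx⟩
    obtain ⟨c, rfl⟩ := exists_of_mem_ker_cech D e₀ e₁ e hD hr (LinearMap.mem_ker.mp hx)
    refine ⟨c, Subtype.ext (Prod.ext ?_ ?_)⟩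
    · change c • e₀ _ = _
      rw [← map_smul, Prod.smul_mk, smul_zero, Polynomial.smul_C, smul_eq_mul, mul_one]
    · change c • e₁ _ = _
      rw [← map_smul, Prod.smul_mk, smul_zero, Polynomial.smul_C, smul_eq_mul, mul_one]

/-- The cokernel of the Čech differential in coordinates. -/
lemma nonempty_cokernel_cech_equiv :
    Nonempty ((W ⧸ LinearMap.range D) ≃ₗ[k] (Fin (r - 1) → k)) := by
  let l : W →ₗ[k] (Fin (r - 1) → k) :=
    { toFun := fun w i => (e.symm w).2.coeff (-((i : ℕ) + 1))
      map_add' := fun v w => by ext i; simp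
      map_smul' := fun c w => by ext i; simp }
  have hl : ∀ d i, l (e d) i = d.2.coeff (-((i : ℕ) + 1)) := fun d i => by
    change (e.symm (e d)).2.coeff _ = _
    rw [e.symm_apply_apply]
  have hsurj : Function.Surjective l := fun v =>
    ⟨e (0, ∑ j, C (v j) * T (-((j : ℕ) + 1))), funext fun i => by
      rw [hl]; exact laurent_coeff_sum v i⟩
  have hker : LinearMap.range D = LinearMap.ker l := by
    apply le_antisymm
    · rintro _ ⟨⟨x₀, x₁⟩, rfl⟩
      obtain ⟨p, rfl⟩ := e₀.surjective x₀
      obtain ⟨q, rfl⟩ := e₁.surjective x₁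
      rw [LinearMap.mem_ker, hD]
      exact funext fun i => (hl _ i).trans (laurent_coeff_cech _ _ i)
    · intro w hw
      obtain ⟨⟨d₁, d₂⟩, rfl⟩ := e.surjective w
      -- With `0` in place of `r` the index set `Fin (0 - 1)` is empty: the summand `𝒪` contributes
      -- nothing to `H¹`.
      obtain ⟨f, g, v, h1⟩ := exists_laurent_decomposition 0 d₁
      obtain ⟨f', g', v', h2⟩ := exists_laurent_decomposition r d₂
      have h3 : v' = 0 := by
        refine funext fun i => ?_
        have h4 := congrFun (LinearMap.mem_ker.mp hw) i
        rw [hl, h2] at h4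
        change (_ + _ : LaurentPolynomial k).coeff _ = _ at h4
        rw [AddMonoidAlgebra.coeff_add, Finsupp.add_apply, laurent_coeff_cech, laurent_coeff_sum,
          zero_add] at h4
        exact h4
      refine ⟨(e₀ (f, f'), e₁ (g, g')), ?_⟩
      rw [hD, h1, h2, h3]
      simp
  exact ⟨(Submodule.quotEquivOfEq _ _ hker).trans (l.quotKerEquivOfSurjective hsurj)⟩

end CechLinear

section Sections

variable {k : Type u} [Field k] {X : Scheme.{u}} (p : X ⟶ Spec (.of k)) {S : Type*} [CommRing S]
  [Algebra k S] {R : CommRingCat.{u}} (f : S →+* R) (y : R) (hy : Function.Bijective (pairHom f y))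
  (j : Spec R ⟶ X) [IsOpenImmersion j] (U : X.Opens) (hU : j.opensRange = U)
  (hj : j ≫ p = Spec.map (CommRingCat.ofHom (f.comp (algebraMap k S))))

/-- The ring of an affine chart as the ring of sections over its image. -/
def chartRingHom : R →+* Sections p U := (inv (chartSections j U hU)).hom

lemma chartRingHom_bijective : Function.Bijective (chartRingHom p j U hU) :=
  ConcreteCategory.bijective_of_isIso (inv (chartSections j U hU))

include hj in
lemma algebraMap_sections_chart (c : k) :
    algebraMap k (Sections p U) c = chartRingHom p j U hU (f (algebraMap k S c)) :=
  toSections_chart j hU p _ hj c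

/-- The coordinates of a section over an affine chart whose ring has a basis `{1, y}`. -/
def sectionsEquiv : (S × S) ≃ₗ[k] Sections p U :=
  LinearEquiv.ofBijective
    { toFun := fun s => chartRingHom p j U hU (pairHom f y s)
      map_add' := fun s t => by rw [map_add, map_add]
      map_smul' := fun c s => by
        rw [RingHom.id_apply, Algebra.smul_def (A := Sections p U),
          algebraMap_sections_chart p f j U hU hj, ← map_mul,
          pairHom_apply, pairHom_apply, Prod.smul_fst, Prod.smul_snd, Algebra.smul_def,
          Algebra.smul_def, map_mul, map_mul, mul_add, mul_assoc] }
    ((chartRingHom_bijective p j U hU).comp hy)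

lemma sections_eq_of_res_eq {U₀ U₁ : X.Opens} (hU : U₀ ⊔ U₁ = ⊤) {s t : Sections p ⊤}
    (h₀ : resₐ p (le_top : U₀ ≤ ⊤) s = resₐ p le_top t)
    (h₁ : resₐ p (le_top : U₁ ≤ ⊤) s = resₐ p le_top t) : s = t :=
  X.sheaf.eq_of_locally_eq₂ (homOfLE le_top) (homOfLE le_top) hU.ge s t h₀ h₁

end Sections

section Cech

open LaurentPolynomial MvPolynomial

variable {k : Type u} [Field k] {r : ℕ} (a : homogeneousSubmodule (Fin 2) k r)
    (b : homogeneousSubmodule (Fin 2) k (2 * r)) (hr : 0 < r)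

lemma overlapChart_over_of_chart (i : Fin 2) : overlapChart a b ≫ curveOver a b =
    Spec.map (CommRingCat.ofHom ((overlapMap a b i).comp (algebraMap k (ChartRing a b i)))) := by
  rw [← overlapMap_curveChart a b i, Category.assoc, curveChart_over, ← Spec.map_comp,
    ← CommRingCat.ofHom_comp]

lemma algebraMap_C (i : Fin 2) (c : k) : algebraMap (Polynomial k) (ChartRing a b i)
    (Polynomial.C c) = algebraMap k (ChartRing a b i) c := rfl

lemma laurentMap_invert (p : Polynomial k) : laurentMap a b (invert (Polynomial.toLaurent p)) =
    overlapMap a b 1 (algebraMap (Polynomial k) _ p) := by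
  have hC : ∀ c, laurentMap a b (C c) =
      overlapMap a b 1 (algebraMap (Polynomial k) _ (Polynomial.C c)) := fun c => by
    have h := (overlapChart_over_of_chart a b 0).symm.trans (overlapChart_over_of_chart a b 1)
    rw [← Polynomial.toLaurent_C, laurentMap_toLaurent]
    have h1 : (overlapMap a b 0).comp (algebraMap k (ChartRing a b 0)) =
      (overlapMap a b 1).comp (algebraMap k (ChartRing a b 1)) :=
      congrArg CommRingCat.Hom.hom (Spec.map_injective h)
    rw [algebraMap_C, algebraMap_C]
    exact RingHom.congr_fun h1 c
  induction p using Polynomial.induction_on with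
  | C c => rw [Polynomial.toLaurent_C, invert_C, hC]
  | add p q hp hq => simp only [map_add, hp, hq]
  | monomial n c _ =>
    simp only [map_mul, map_pow, Polynomial.toLaurent_C, invert_C, hC, Polynomial.toLaurent_X,
      invert_T, laurentMap_T_neg_one]

lemma overlapChart_over : overlapChart a b ≫ curveOver a b = Spec.map (CommRingCat.ofHom
    ((laurentMap a b).comp (algebraMap k (LaurentPolynomial k)))) := by
  rw [overlapChart_over_of_chart a b 0]
  congr 2
  refine RingHom.ext fun c => (laurentMap_toLaurent a b (Polynomial.C c)).symm.trans ?_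
  rw [Polynomial.toLaurent_C]
  rfl

/-- Coordinates on the sections over a chart. -/
def chartEquiv (i : Fin 2) :
    (Polynomial k × Polynomial k) ≃ₗ[k] Sections (curveOver a b) (chart a b i) :=
  sectionsEquiv (curveOver a b) (algebraMap (Polynomial k) (ChartRing a b i)) QuadraticAlgebra.omega
    (pairHom_omega_bijective a b i) (curveChart a b i) (chart a b i) (opensRange_curveChart a b i)
    (curveChart_over a b i)

/-- Coordinates on the sections over the intersection of the charts. -/
def overlapEquiv : (LaurentPolynomial k × LaurentPolynomial k) ≃ₗ[k]
    Sections (curveOver a b) (chart a b 0 ⊓ chart a b 1) :=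
  sectionsEquiv (R := .of (OverlapRing a b)) (curveOver a b) (laurentMap a b) (overlapMap a b 0 QuadraticAlgebra.omega)
    (laurentMap_pairHom_bijective a b) (overlapChart a b) (chart a b 0 ⊓ chart a b 1)
    (opensRange_overlapChart a b) (overlapChart_over a b)

lemma res_chartEquiv_left (p : Polynomial k × Polynomial k) :
    resₐ (curveOver a b) inf_le_left (chartEquiv a b 0 p) =
      overlapEquiv a b (Polynomial.toLaurent p.1, Polynomial.toLaurent p.2) := by
  refine (map_inv_chartSections_apply (curveChart a b 0) (overlapChart a b)
    (CommRingCat.ofHom (overlapMap a b 0)) (overlapMap_curveChart a b 0)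
    (opensRange_curveChart a b 0) (opensRange_overlapChart a b) inf_le_left _).trans ?_
  refine congrArg (chartRingHom (curveOver a b) (overlapChart a b) _ (opensRange_overlapChart a b)) ?_
  change overlapMap a b 0 _ = _
  rw [pairHom_apply, pairHom_apply, map_add, map_mul, laurentMap_toLaurent, laurentMap_toLaurent]

lemma res_chartEquiv_right (p : Polynomial k × Polynomial k) :
    resₐ (curveOver a b) inf_le_right (chartEquiv a b 1 p) =
      overlapEquiv a b (invert (Polynomial.toLaurent p.1),
        invert (Polynomial.toLaurent p.2) * T (-r)) := by
  refine (map_inv_chartSections_apply (curveChart a b 1) (overlapChart a b)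
    (CommRingCat.ofHom (overlapMap a b 1)) (overlapMap_curveChart a b 1)
    (opensRange_curveChart a b 1) (opensRange_overlapChart a b) inf_le_right _).trans ?_
  refine congrArg (chartRingHom (curveOver a b) (overlapChart a b) _ (opensRange_overlapChart a b)) ?_
  change overlapMap a b 1 _ = _
  have hT : (T (-r : ℤ) : LaurentPolynomial k) = T (-1) ^ r := by
    rw [T_pow]; simp
  rw [pairHom_apply, pairHom_apply, map_add, map_mul, map_mul, laurentMap_invert, laurentMap_invert,
    hT, map_pow, laurentMap_T_neg_one, overlapMap_omega, mul_assoc]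

lemma cechDifferential_chartEquiv (p q : Polynomial k × Polynomial k) :
    cechDifferential (curveOver a b) (chart a b 0) (chart a b 1)
      (chartEquiv a b 0 p, chartEquiv a b 1 q) =
    overlapEquiv a b (Polynomial.toLaurent p.1 - invert (Polynomial.toLaurent q.1),
      Polynomial.toLaurent p.2 - invert (Polynomial.toLaurent q.2) * T (-r)) := by
  change resₐ _ _ (chartEquiv a b 0 p) - resₐ _ _ (chartEquiv a b 1 q) = _
  rw [res_chartEquiv_left, res_chartEquiv_right, ← map_sub, Prod.mk_sub_mk]

include hr

lemma chart_sup_chart : chart a b 0 ⊔ chart a b 1 = ⊤ := by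
  refine top_le_iff.mp fun x _ => ?_
  obtain ⟨i, hi⟩ := exists_mem_chart a b hr x
  fin_cases i
  · exact Or.inl hi
  · exact Or.inr hi

/-- The Euler characteristic is `1 - (r - 1)`. -/
lemma hasArithmeticGenus : HasArithmeticGenus (curveOver a b) (chart a b 0) (chart a b 1)
    ((r : ℤ) - 1) := by
  have h0 : Module.finrank k (CechH0 (curveOver a b) (chart a b 0) (chart a b 1)) = 1 :=
    finrank_ker_cech _ _ _ _ (cechDifferential_chartEquiv a b) hr
  obtain ⟨e⟩ := nonempty_cokernel_cech_equiv _ _ _ _ (cechDifferential_chartEquiv a b)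
  have h1 : Module.finrank k (CechH1 (curveOver a b) (chart a b 0) (chart a b 1)) = r - 1 := by
    rw [e.finrank_eq, Module.finrank_fin_fun]
  refine ⟨inferInstance, Proj.isAffineOpen_basicOpen _ _ (coordinateMap_X_mem a b 0) Nat.one_pos,
    Proj.isAffineOpen_basicOpen _ _ (coordinateMap_X_mem a b 1) Nat.one_pos,
    chart_sup_chart a b hr, Module.finite_of_finrank_pos (by rw [h0]; exact one_pos),
    Module.Finite.equiv e.symm, ?_⟩
  rw [h0, h1, Nat.cast_sub hr]
  ring

lemma globalSectionsEqBase : GlobalSectionsEqBase (curveOver a b) := by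
  have hone : ∀ c (i : Fin 2), chartEquiv a b i (Polynomial.C c, 0) =
      algebraMap k (Sections (curveOver a b) (chart a b i)) c := by
    intro c i
    refine (congrArg (chartRingHom (curveOver a b) (curveChart a b i) _ (opensRange_curveChart a b i)) ?_).trans
      (algebraMap_sections_chart (curveOver a b) (algebraMap (Polynomial k) (ChartRing a b i))
        (curveChart a b i) (chart a b i) (opensRange_curveChart a b i)
        (curveChart_over a b i) c).symm
    rw [pairHom_apply, map_zero, zero_mul, add_zero]
    rfl
  have : Nontrivial (Sections (curveOver a b) ⊤) := by
    refine ⟨1, 0, fun h => ?_⟩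
    have h1 := congrArg (resₐ (curveOver a b) (le_top : chart a b 0 ≤ ⊤)) h
    rw [map_one, map_zero, ← map_one (algebraMap k (Sections (curveOver a b) (chart a b 0))),
      ← hone] at h1
    exact one_ne_zero (α := Polynomial k)
      (congrArg Prod.fst ((LinearEquiv.map_eq_zero_iff _).mp h1))
  refine ⟨(algebraMap k (Sections (curveOver a b) ⊤)).injective, fun s => ?_⟩
  -- The two restrictions of a global section form a Čech cocycle, and such a cocycle is constant.
  have h1 : cechDifferential (curveOver a b) (chart a b 0) (chart a b 1)
      (resₐ (curveOver a b) le_top s, resₐ (curveOver a b) le_top s) = 0 := by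
    refine sub_eq_zero.mpr ?_
    change ((Curve a b).presheaf.map _ ≫ (Curve a b).presheaf.map _).hom s =
      ((Curve a b).presheaf.map _ ≫ (Curve a b).presheaf.map _).hom s
    rw [← Functor.map_comp, ← Functor.map_comp]
    rfl
  obtain ⟨c, hc⟩ := exists_of_mem_ker_cech _ _ _ _ (cechDifferential_chartEquiv a b) hr h1
  refine ⟨c, sections_eq_of_res_eq (curveOver a b) (chart_sup_chart a b hr) ?_ ?_⟩
  · rw [AlgHom.commutes, ← hone]
    exact (congrArg Prod.fst hc).symm
  · rw [AlgHom.commutes, ← hone]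
    exact (congrArg Prod.snd hc).symm

end Cech

end

end DoubleCover

/-! ### The discriminant and its vanishing. -/

namespace DoubleCover

noncomputable section

section Fibers

variable {X Z : Scheme.{u}} {ψ : X ⟶ Z} {R T : Type u} [CommRing R] [CommRing T] [Algebra R T]
  {j : Spec (.of R) ⟶ Z} [IsOpenImmersion j] {j' : Spec (.of T) ⟶ X} [IsOpenImmersion j']
  (h : IsPullback (Spec.map (CommRingCat.ofHom (algebraMap R T))) j' j ψ)
  (K : Type u) [Field K] [Algebra R K]

include h

omit [IsOpenImmersion j] in
-- Universal injectivity is injectivity on `K`-points for every field `K`, and `R`-algebra maps `T →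
-- K` are `K`-points over a fixed `K`-point of the base.
lemma algHom_eq_of_universallyInjective (hψ : UniversallyInjective ψ) (f g : T →ₐ[R] K) :
    f = g := by
  have h1 : Function.Injective (fun g : Spec (.of K) ⟶ X => g ≫ ψ) :=
    ((tfae_universallyInjective ψ).out 0 1 : UniversallyInjective ψ ↔ ∀ (K : Type u) [Field K],
      Function.Injective (fun g : Spec (.of K) ⟶ X => g ≫ ψ)).mp hψ K
  have key : ∀ f : T →ₐ[R] K, (Spec.map (CommRingCat.ofHom f.toRingHom) ≫ j') ≫ ψ =
      Spec.map (CommRingCat.ofHom (algebraMap R K)) ≫ j := fun f => by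
    rw [Category.assoc, ← h.w, ← Spec.map_comp_assoc, ← CommRingCat.ofHom_comp]
    congr 3
    exact f.comp_algebraMap
  have h2 := h1 ((key f).trans (key g).symm)
  rw [cancel_mono] at h2
  have h3 : f.toRingHom = g.toRingHom := congrArg CommRingCat.Hom.hom (Spec.map_injective h2)
  exact AlgHom.ext fun x => RingHom.congr_fun h3 x

omit [IsOpenImmersion j'] in
open TensorProduct in
-- The generic point of the chart lies in the dense open subset over which `ψ` is étale. So the
-- fibre over `Spec K` is étale over a field, hence reduced.
lemma isReduced_tensorProduct_of_genericallyEtale [IsDomain R] [FaithfulSMul R K]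
    (hψ : GenericallyEtale ψ) : _root_.IsReduced (K ⊗[R] T) := by
  obtain ⟨U, hU, hE⟩ := hψ
  let g : Spec (.of K) ⟶ Spec (.of R) := Spec.map (CommRingCat.ofHom (algebraMap R K))
  have hrange : Set.range (g ≫ j) ⊆ Set.range U.ι := by
    rintro _ ⟨x, rfl⟩
    rw [Scheme.Opens.range_ι]
    obtain ⟨_, ⟨y, rfl⟩, hy⟩ := hU.inter_open_nonempty _ j.isOpenEmbedding.isOpen_range
      ⟨_, (⊥ : PrimeSpectrum R), rfl⟩
    have hgx : g x = (⊥ : PrimeSpectrum R) := by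
      refine PrimeSpectrum.ext ?_
      have hx : x = (⊥ : PrimeSpectrum K) := Subsingleton.elim (α := PrimeSpectrum K) _ _
      rw [hx]
      exact Ideal.comap_bot_of_injective _ (FaithfulSMul.algebraMap_injective R K)
    have hsp : (⊥ : PrimeSpectrum R) ⤳ y := (PrimeSpectrum.le_iff_specializes _ _).mp bot_le
    change j (g x) ∈ U
    rw [hgx]
    exact (hsp.map j.continuous).mem_open U.isOpen hy
  have hA : IsPullback (Spec.map (CommRingCat.ofHom
      (Algebra.TensorProduct.includeRight (R := R) (A := K) (B := T)).toRingHom))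
      (Spec.map (CommRingCat.ofHom (algebraMap K (K ⊗[R] T))))
      (Spec.map (CommRingCat.ofHom (algebraMap R T))) g :=
    (isPullback_SpecMap_of_isPushout _ _ _ _ (CommRingCat.isPushout_tensorProduct R K T)).flip
  have hB := hA.paste_horiz h.flip
  rw [← IsOpenImmersion.lift_fac U.ι (g ≫ j) hrange] at hB
  have hC := IsPullback.of_right' hB (isPullback_morphismRestrict ψ U).flip
  have hD : Etale (Spec.map (CommRingCat.ofHom (algebraMap K (K ⊗[R] T)))) :=
    MorphismProperty.of_isPullback hC hE
  rw [HasRingHomProperty.Spec_iff (P := @Etale)] at hD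
  have : Algebra.Etale K (K ⊗[R] T) := RingHom.etale_algebraMap.mp hD
  exact Algebra.FormallyUnramified.isReduced_of_field K _

end Fibers

section Discriminant

open TensorProduct

variable {R : Type u} [CommRing R] (α β : R) (K : Type u) [Field K] [IsAlgClosed K] [Algebra R K]
  [FaithfulSMul R K]

omit [FaithfulSMul R K] in
lemma exists_root : ∃ y : K, y ^ 2 + algebraMap R K α * y + algebraMap R K β = 0 := by
  obtain ⟨y, hy⟩ := IsAlgClosed.exists_root (Polynomial.X ^ 2 + Polynomial.C (algebraMap R K α) *
    Polynomial.X + Polynomial.C (algebraMap R K β)) (by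
      have : (Polynomial.X ^ 2 + Polynomial.C (algebraMap R K α) *
        Polynomial.X + Polynomial.C (algebraMap R K β)).degree = 2 := by compute_degree!
      rw [this]; decide)
  refine ⟨y, ?_⟩
  simpa using hy

/-- The two roots `y` and `-α - y` in `K` define algebra maps; if these agree the root is double. -/
lemma discr_eq_zero_of_algHom_eq
    (H : ∀ f g : QuadraticAlgebra R (-β) (-α) →ₐ[R] K, f = g) : α ^ 2 - 4 * β = 0 := by
  obtain ⟨y, hy⟩ := exists_root α β K
  have key : ∀ y : K, y ^ 2 + algebraMap R K α * y + algebraMap R K β = 0 →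
      ∃ f : QuadraticAlgebra R (-β) (-α) →ₐ[R] K, f QuadraticAlgebra.omega = y := fun y hy =>
    ⟨QuadraticAlgebra.lift ⟨y, by
      rw [Algebra.smul_def, Algebra.smul_def, map_neg, map_neg]; linear_combination hy⟩, by simp⟩
  obtain ⟨f, hf⟩ := key y hy
  obtain ⟨g, hg⟩ := key (-algebraMap R K α - y) (by linear_combination hy)
  rw [H f g, hg] at hf
  apply FaithfulSMul.algebraMap_injective R K
  rw [map_sub, map_pow, map_mul, map_zero, map_ofNat]
  linear_combination (-4) * hy + (-algebraMap R K α - 2 * y) * hf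

omit [FaithfulSMul R K] in
-- For zero discriminant the quadratic polynomial is `(Y - y)²` over `K`, and `ω - y` is a nonzero
-- nilpotent.
lemma discr_ne_zero_of_isReduced (H : _root_.IsReduced (K ⊗[R] QuadraticAlgebra R (-β) (-α))) :
    α ^ 2 - 4 * β ≠ 0 := by
  intro h0
  obtain ⟨y, hy⟩ := exists_root α β K
  have hy2 : (2 * y + algebraMap R K α) ^ 2 = 0 := by
    have h1 := congrArg (algebraMap R K) h0
    rw [map_sub, map_pow, map_mul, map_zero, map_ofNat] at h1
    linear_combination h1 + 4 * hy
  have hy3 : 2 * y + algebraMap R K α = 0 := pow_eq_zero_iff two_ne_zero |>.mp hy2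
  let A := K ⊗[R] QuadraticAlgebra R (-β) (-α)
  let w : A := 1 ⊗ₜ QuadraticAlgebra.omega
  have hw : w ^ 2 + algebraMap R A α * w + algebraMap R A β = 0 := by
    have := congrArg (Algebra.TensorProduct.includeRight (R := R) (A := K)) (omega_sq α β)
    rw [map_add, map_add, map_mul, map_pow, AlgHom.commutes, AlgHom.commutes, map_zero] at this
    exact this
  have h1 : (w - algebraMap K A y) ^ 2 = 0 := by
    have h2 := congrArg (algebraMap K A) hy
    have h3 := congrArg (algebraMap K A) hy3
    rw [map_add, map_mul, map_ofNat, map_zero, ← IsScalarTower.algebraMap_apply] at h3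
    rw [map_add, map_add, map_mul, map_pow, map_zero, ← IsScalarTower.algebraMap_apply,
      ← IsScalarTower.algebraMap_apply] at h2
    linear_combination hw + (algebraMap K A y - w) * h3 - h2
  have h2 : w - algebraMap K A y = 0 := pow_eq_zero_iff two_ne_zero |>.mp h1
  -- The coefficient of `ω`, extended to `K`, takes the value `1` on `ω - y`, so this element is not
  -- zero.
  let l : QuadraticAlgebra R (-β) (-α) →ₗ[R] K :=
    { toFun := fun z => algebraMap R K z.im
      map_add' := fun z w => by simp
      map_smul' := fun c z => by simp [Algebra.smul_def] }
  have h3 := congrArg (l.liftBaseChange K) h2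
  rw [map_sub, map_zero, Algebra.TensorProduct.algebraMap_apply, LinearMap.liftBaseChange_tmul,
    LinearMap.liftBaseChange_tmul] at h3
  simp [l, QuadraticAlgebra.im_one] at h3

end Discriminant

section Reduced

variable {R : Type*} [CommRing R] {α β : R}

/-- The square of `2ω + α` is the discriminant, so `2ω + α` is nilpotent and both of its coordinates
vanish. -/
lemma two_eq_zero_of_isReduced (H : _root_.IsReduced (QuadraticAlgebra R (-β) (-α)))
    (h0 : α ^ 2 - 4 * β = 0) : (2 : R) = 0 ∧ α = 0 := by
  have h1 : (⟨α, 2⟩ : QuadraticAlgebra R (-β) (-α)) ^ 2 = 0 := by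
    rw [pow_two]
    ext
    · simp; linear_combination h0
    · simp; ring
  have h2 := pow_eq_zero_iff two_ne_zero |>.mp h1
  exact ⟨congrArg QuadraticAlgebra.im h2, congrArg QuadraticAlgebra.re h2⟩

/-- If `β = x²`, then `ω + x` has square zero. -/
lemma not_isSquare_of_isReduced [Nontrivial R] (H : _root_.IsReduced (QuadraticAlgebra R (-β) (-α)))
    (h2 : (2 : R) = 0) (hα : α = 0) : ¬ IsSquare β := by
  rintro ⟨x, rfl⟩
  have h1 : (⟨x, 1⟩ : QuadraticAlgebra R (-(x * x)) (-α)) ^ 2 = 0 := by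
    rw [pow_two]
    ext
    · simp
    · simp [hα]; linear_combination x * h2
  have h3 := pow_eq_zero_iff two_ne_zero |>.mp h1
  exact one_ne_zero (congrArg QuadraticAlgebra.im h3)

end Reduced

section Curve

open MvPolynomial

variable {k : Type u} [Field k] {r : ℕ} (a : homogeneousSubmodule (Fin 2) k r)
    (b : homogeneousSubmodule (Fin 2) k (2 * r))

instance : FaithfulSMul (Polynomial k) (AlgebraicClosure (RatFunc k)) :=
  .trans (Polynomial k) (RatFunc k) _

lemma isReduced_chartRing (hred : AlgebraicGeometry.IsReduced (Curve a b)) (i : Fin 2) :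
    _root_.IsReduced (ChartRing a b i) :=
  (affine_isReduced_iff (.of (ChartRing a b i))).mp
    (isReduced_of_isOpenImmersion (curveChart a b i))

variable (hr : 0 < r)

lemma discr_eq_zero_of_universallyInjective (h : UniversallyInjective (curveToP1 a b hr)) :
    dehom 0 a.1 ^ 2 - 4 * dehom 0 b.1 = 0 :=
  discr_eq_zero_of_algHom_eq _ _ (AlgebraicClosure (RatFunc k)) fun f g =>
    algHom_eq_of_universallyInjective (isPullback_chart a b hr 0) _ h f g

lemma discr_ne_zero_of_genericallyEtale (h : GenericallyEtale (curveToP1 a b hr)) :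
    dehom 0 a.1 ^ 2 - 4 * dehom 0 b.1 ≠ 0 :=
  discr_ne_zero_of_isReduced _ _ (AlgebraicClosure (RatFunc k))
    (isReduced_tensorProduct_of_genericallyEtale (isPullback_chart a b hr 0) _ h)

lemma of_discr_eq_zero (hred : AlgebraicGeometry.IsReduced (Curve a b))
    (h : dehom 0 a.1 ^ 2 - 4 * dehom 0 b.1 = 0) :
    (2 : k) = 0 ∧ a = 0 ∧ ¬ IsSquare (dehom 0 b.1) := by
  have H := isReduced_chartRing a b hred 0
  obtain ⟨h2, h0⟩ := two_eq_zero_of_isReduced H h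
  refine ⟨?_, Subtype.ext (eq_zero_of_dehom_eq_zero a.2 0 h0), not_isSquare_of_isReduced H h2 h0⟩
  rwa [← map_ofNat Polynomial.C, Polynomial.C_eq_zero] at h2

end Curve

end

end DoubleCover

/-! ### The normalization of an integral scheme inside its function field. -/

namespace DoubleCover

noncomputable section

section Generic

variable (X : Scheme.{u}) [IsIntegral X]

instance : Unique (genericPoints X) where
  default := ⟨genericPoint X, by rw [genericPoints_eq_singleton]; rfl⟩
  uniq η := Subtype.ext (by
    have : ∀ x ∈ genericPoints X, x = genericPoint X := by
      rw [genericPoints_eq_singleton]; exact fun _ => id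
    exact this _ η.2)

/-- The residue field at the generic point. -/
abbrev genericField : CommRingCat.{u} := X.residueField (genericPoint X)

/-- The disjoint union of the generic points is the generic point. -/
def genericFibersIso : genericFibers X ≅ Spec (genericField X) :=
  Limits.coproductUniqueIso (β := genericPoints X) fun η => Spec (X.residueField η.1)

lemma genericFibersIso_inv_genericFibersTo :
    (genericFibersIso X).inv ≫ genericFibersTo X = X.fromSpecResidueField (genericPoint X) :=
  Limits.Sigma.ι_desc (fun η : genericPoints X => X.fromSpecResidueField η.1) default

omit [AlgebraicGeometry.IsIntegral X] in
lemma fromSpecResidueField_appLE {x : X} {U : X.Opens} (hx : x ∈ U) :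
    (X.fromSpecResidueField x).appLE U ⊤ (fun y _ => by
      change X.fromSpecResidueField x y ∈ U
      rwa [Scheme.fromSpecResidueField_apply]) ≫ (Scheme.ΓSpecIso _).hom =
    X.evaluation U x hx := by
  have hle : ⊤ ≤ X.fromSpecStalk x ⁻¹ᵁ U := by
    rintro y -
    exact ((Set.ext_iff.mp X.range_fromSpecStalk _).mp ⟨y, rfl⟩).mem_open U.isOpen hx
  have h1 : (X.fromSpecStalk x).appLE U ⊤ hle =
      X.presheaf.germ U x hx ≫ (Scheme.ΓSpecIso (X.presheaf.stalk x)).inv := by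
    rw [Scheme.Hom.appLE, Scheme.fromSpecStalk_app hx, Category.assoc, Category.assoc,
      ← Functor.map_comp]
    refine congrArg (X.presheaf.germ U x hx ≫ ·) ?_
    exact (congrArg (_ ≫ ·) ((Spec (X.presheaf.stalk x)).presheaf.map_id _)).trans
      (Category.comp_id _)
  have h2 : (X.fromSpecResidueField x).appLE U ⊤ (fun y _ => by
      change X.fromSpecResidueField x y ∈ U
      rwa [Scheme.fromSpecResidueField_apply]) =
      (X.fromSpecStalk x).appLE U ⊤ hle ≫ (Spec.map (X.residue x)).appLE ⊤ ⊤ le_top :=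
    (Scheme.Hom.appLE_comp_appLE (Spec.map (X.residue x)) (X.fromSpecStalk x) U ⊤ ⊤ _ _).symm
  rw [h2, h1, Category.assoc, Category.assoc]
  have h3 : (Spec.map (X.residue x)).appLE ⊤ ⊤ le_top ≫ (Scheme.ΓSpecIso _).hom =
      (Scheme.ΓSpecIso _).hom ≫ X.residue x :=
    (congrArg (· ≫ _) (Scheme.Hom.appLE_eq_app ..)).trans (Scheme.ΓSpecIso_naturality _)
  rw [h3, Iso.inv_hom_id_assoc]
  rfl

omit [AlgebraicGeometry.IsIntegral X] in
lemma fromSpecResidueField_appTop (x : X) :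
    (X.fromSpecResidueField x).appTop ≫ (Scheme.ΓSpecIso _).hom = X.evaluation ⊤ x trivial := by
  refine Eq.trans ?_ (fromSpecResidueField_appLE X (U := ⊤) trivial)
  exact congrArg (· ≫ _) (Scheme.Hom.appLE_eq_app ..).symm

omit [AlgebraicGeometry.IsIntegral X] in
lemma toSections_top {k : Type u} [Field k] (p : X ⟶ Spec (.of k)) (c : k) :
    toSections p ⊤ c = ((Scheme.ΓSpecIso (.of k)).inv ≫ p.appTop).hom c :=
  ConcreteCategory.congr_hom (congrArg ((Scheme.ΓSpecIso (.of k)).inv ≫ ·)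
    (Scheme.Hom.appLE_eq_app (f := p) (U := ⊤))) c

variable [X.IsSeparated] [NoetherianSpace X]

/-- The canonical morphism from the generic points to the normalization. -/
def genericFibersToNormalization (X : Scheme.{u}) [X.IsSeparated] [NoetherianSpace X] :
    genericFibers X ⟶ normalization X :=
  (genericFibersTo X).toNormalization

instance (X : Scheme.{u}) [X.IsSeparated] [NoetherianSpace X] :
    IsDominant (genericFibersToNormalization X) :=
  inferInstanceAs (IsDominant (genericFibersTo X).toNormalization)

instance (X : Scheme.{u}) [X.IsSeparated] [NoetherianSpace X] :
    IsIntegralHom (normalizationTo X) :=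
  inferInstanceAs (IsIntegralHom (genericFibersTo X).fromNormalization)

instance : IsReduced (normalization X) := by
  have : IsReduced (genericFibers X) := isReduced_of_isOpenImmersion (genericFibersIso X).hom
  exact inferInstanceAs (IsReduced (genericFibersTo X).normalization)

/-- The generic point as a point of the normalization. -/
def genericToNormalization : Spec (genericField X) ⟶ normalization X :=
  (genericFibersIso X).inv ≫ genericFibersToNormalization X

lemma genericToNormalization_normalizationTo : genericToNormalization X ≫ normalizationTo X =
    X.fromSpecResidueField (genericPoint X) := by
  have h : genericFibersToNormalization X ≫ normalizationTo X = genericFibersTo X :=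
    (genericFibersTo X).toNormalization_fromNormalization
  rw [genericToNormalization, Category.assoc, h, genericFibersIso_inv_genericFibersTo]

instance : IsDominant (genericToNormalization X) := by
  unfold genericToNormalization; infer_instance

/-- If the pullback of a section vanishes, its basic open misses a dense set and is empty; on a
reduced scheme the section is then zero. -/
lemma app_injective_of_isDominant {Y Z : Scheme.{u}} (f : Y ⟶ Z) [IsDominant f] [IsReduced Z] :
    Function.Injective f.appTop.hom := by
  rw [injective_iff_map_eq_zero]
  intro s hs
  rw [← basicOpen_eq_bot_iff, ← Opens.not_nonempty_iff_eq_bot]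
  intro h
  obtain ⟨y, hy⟩ := f.denseRange.exists_mem_open (Z.basicOpen s).isOpen h
  have h1 : y ∈ f ⁻¹ᵁ Z.basicOpen s := hy
  rw [Scheme.preimage_basicOpen] at h1
  have h2 : f.app ⊤ s = 0 := hs
  rw [h2, Scheme.basicOpen_zero] at h1
  exact h1

/-- The value of a section of the normalization at the generic point. -/
def normalizationEval : Γ(normalization X, ⊤) →+* genericField X :=
  ((genericToNormalization X).appTop ≫ (Scheme.ΓSpecIso _).hom).hom

lemma normalizationEval_injective : Function.Injective (normalizationEval X) :=
  (ConcreteCategory.bijective_of_isIso (Scheme.ΓSpecIso (genericField X)).hom).1.comp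
    (app_injective_of_isDominant (genericToNormalization X))

lemma isIntegralElem_normalizationEval {U : X.Opens} (hU : IsAffineOpen U)
    (hη : genericPoint X ∈ U) (z : Γ(normalization X, ⊤)) :
    (X.evaluation U (genericPoint X) hη).hom.IsIntegralElem (normalizationEval X z) := by
  have hint : IsIntegralHom (normalizationTo X) := inferInstance
  have hle : ⊤ ≤ genericToNormalization X ⁻¹ᵁ (normalizationTo X ⁻¹ᵁ U) := fun y _ => by
    change (genericToNormalization X ≫ normalizationTo X) y ∈ U
    rwa [genericToNormalization_normalizationTo, Scheme.fromSpecResidueField_apply]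
  have h1 := hint.isIntegral_app U hU ((normalization X).presheaf.map (homOfLE le_top).op z)
  have h2 := RingHom.IsIntegralElem.map h1 ((genericToNormalization X).appLE _ ⊤ hle ≫
    (Scheme.ΓSpecIso _).hom).hom
  have h3 : (normalizationTo X).app U ≫ (genericToNormalization X).appLE _ ⊤ hle ≫
      (Scheme.ΓSpecIso _).hom = X.evaluation U (genericPoint X) hη := by
    rw [← fromSpecResidueField_appLE X hη, ← Category.assoc, Scheme.Hom.app_eq_appLE,
      Scheme.Hom.appLE_comp_appLE]
    simp only [genericToNormalization_normalizationTo]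
  have h4 : (normalization X).presheaf.map (homOfLE le_top).op ≫
      (genericToNormalization X).appLE _ ⊤ hle ≫ (Scheme.ΓSpecIso _).hom =
      (genericToNormalization X).appTop ≫ (Scheme.ΓSpecIso _).hom := by
    rw [Scheme.Hom.map_appLE_assoc]
    exact congrArg (· ≫ _) (Scheme.Hom.appLE_eq_app ..)
  rw [← h3]
  have h5 := ConcreteCategory.congr_hom h4 z
  exact h5 ▸ h2

variable {k : Type u} [Field k] (p : X ⟶ Spec (.of k))

lemma normalizationEval_toSections (c : k) :
    normalizationEval X (toSections (normalizationTo X ≫ p) ⊤ c) = residueMap p (genericPoint X) c := by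
  rw [toSections_top, residueMap, RingHom.comp_apply, toSections_top]
  have h1 : (normalizationTo X ≫ p).appTop ≫ (genericToNormalization X).appTop ≫
      (Scheme.ΓSpecIso _).hom = p.appTop ≫ X.evaluation ⊤ (genericPoint X) trivial := by
    rw [← fromSpecResidueField_appTop, ← genericToNormalization_normalizationTo]
    simp only [Scheme.Hom.comp_appTop, Category.assoc]
  exact ConcreteCategory.congr_hom (congrArg ((Scheme.ΓSpecIso (.of k)).inv ≫ ·) h1) c

/-- The generic point factors through `X ×_k Spec K`, which is integral over `X`. By the universal
property of relative normalization, the normalization maps to this product, hence to `Spec K`. -/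
lemma exists_ringHom_sections_normalization (K : Type u) [CommRing K] [Algebra k K]
    [Algebra.IsIntegral k K] (f : K →+* genericField X)
    (hf : ∀ c, f (algebraMap k K c) = residueMap p (genericPoint X) c) :
    ∃ g : K →+* Γ(normalization X, ⊤), ∀ c, g (algebraMap k K c) =
      toSections (normalizationTo X ≫ p) ⊤ c := by
  have hint : IsIntegralHom (Spec.map (CommRingCat.ofHom (algebraMap k K))) :=
    IsIntegralHom.SpecMap_iff.mpr (algebraMap_isIntegral_iff.mpr inferInstance)
  have hcomp : X.fromSpecResidueField (genericPoint X) ≫ p =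
      Spec.map (CommRingCat.ofHom f) ≫ Spec.map (CommRingCat.ofHom (algebraMap k K)) := by
    refine ext_of_isAffine ?_
    rw [← Iso.cancel_iso_inv_left (Scheme.ΓSpecIso (.of k)),
      ← Iso.cancel_iso_hom_right _ _ (Scheme.ΓSpecIso _)]
    refine CommRingCat.hom_ext (RingHom.ext fun c => ?_)
    rw [← Spec.map_comp, Category.assoc, Category.assoc, Scheme.ΓSpecIso_naturality,
      Iso.inv_hom_id_assoc]
    refine Eq.trans ?_ (hf c).symm
    rw [residueMap, RingHom.comp_apply, toSections_top, ← fromSpecResidueField_appTop,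
      Scheme.Hom.comp_appTop]
    rfl
  let f₁ : genericFibers X ⟶ Limits.pullback p (Spec.map (CommRingCat.ofHom (algebraMap k K))) :=
    (genericFibersIso X).hom ≫ Limits.pullback.lift _ _ hcomp
  have hf₁ : genericFibersTo X = f₁ ≫ Limits.pullback.fst _ _ := by
    rw [Category.assoc, Limits.pullback.lift_fst, ← genericFibersIso_inv_genericFibersTo,
      Iso.hom_inv_id_assoc]
  let m : normalization X ⟶ Limits.pullback p (Spec.map (CommRingCat.ofHom (algebraMap k K))) :=
    (genericFibersTo X).normalizationDesc f₁ (Limits.pullback.fst _ _) hf₁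
  have hm₁ : m ≫ Limits.pullback.fst _ _ = normalizationTo X :=
    (genericFibersTo X).normalizationDesc_comp f₁ (Limits.pullback.fst _ _) hf₁
  let m' : normalization X ⟶ Spec (.of K) := m ≫ Limits.pullback.snd _ _
  have hm : m' ≫ Spec.map (CommRingCat.ofHom (algebraMap k K)) = normalizationTo X ≫ p := by
    rw [← hm₁, Category.assoc, Category.assoc, Limits.pullback.condition]
  refine ⟨((Scheme.ΓSpecIso (.of K)).inv ≫ m'.appTop).hom, fun c => ?_⟩
  rw [toSections_top]
  have h1 : CommRingCat.ofHom (algebraMap k K) ≫ (Scheme.ΓSpecIso (.of K)).inv ≫ m'.appTop =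
      (Scheme.ΓSpecIso (.of k)).inv ≫ (normalizationTo X ≫ p).appTop := by
    rw [← Category.assoc, Scheme.ΓSpecIso_inv_naturality, Category.assoc, ← Scheme.Hom.comp_appTop,
      hm]
  exact ConcreteCategory.congr_hom h1 c

end Generic

end

end DoubleCover

/-! ### Integral elements of the function field and the form `β = c w² + l²`. -/

namespace DoubleCover

noncomputable section

section Representation

open Polynomial

variable {k : Type u} [Field k] [CharP k 2] {β : k[X]}

/-- An operator with `φ 1 = 0` and `φ c ≠ 0` kills `f²` and leaves `φ(c) d² = g² · evenMap φ β`.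
Hence `g ∣ d`, then `g ∣ f`, and the equation can be divided by `g²`. -/
lemma exists_eq_mul_sq_add_sq_of_eq {c : k} (hc : ¬ IsSquare c) {d f g : k[X]} (hd : d ≠ 0)
    (hg : g ≠ 0) (h : C c * d ^ 2 = f ^ 2 + g ^ 2 * β) : ∃ w l, β = C c * w ^ 2 + l ^ 2 := by
  obtain ⟨φ, h1, h2, h3⟩ := exists_frobenius_functional hc
  have h4 : d ^ 2 * C (φ c) = g ^ 2 * evenMap φ β := by
    have h5 := congrArg (evenMap φ) h
    rw [mul_comm, evenMap_add, evenMap_sq_mul h3, evenMap_sq_mul h3, evenMap_sq h3 h1,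
      zero_add] at h5
    rw [← h5]
    congr 1
    ext i
    rw [coeff_evenMap, coeff_C, coeff_C]
    split_ifs with hi h0 <;> simp_all
  have h5 : g ^ 2 ∣ d ^ 2 := by
    have : g ^ 2 ∣ d ^ 2 * C (φ c) := ⟨_, h4⟩
    exact (IsUnit.dvd_mul_right (isUnit_C.mpr (isUnit_iff_ne_zero.mpr h2))).mp this
  obtain ⟨w, rfl⟩ := (IsIntegrallyClosed.pow_dvd_pow_iff two_ne_zero).mp h5
  have h6 : g ^ 2 ∣ f ^ 2 := by
    refine (dvd_add_left (dvd_mul_right _ β)).mp ⟨C c * w ^ 2, ?_⟩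
    rw [← h]; ring
  obtain ⟨l, rfl⟩ := (IsIntegrallyClosed.pow_dvd_pow_iff two_ne_zero).mp h6
  refine ⟨w, l, mul_left_cancel₀ (pow_ne_zero 2 hg) ?_⟩
  have h7 : (2 : k[X]) = 0 := CharTwo.two_eq_zero
  linear_combination -h - g ^ 2 * l ^ 2 * h7

/-- Top coefficients cannot cancel in `c w² + l²`, since a nontrivial zero would make `c` a square.
-/
lemma natDegree_le_of_eq {c : k} (hc : ¬ IsSquare c) {r : ℕ} (hβ : β.natDegree ≤ 2 * r)
    {w l : k[X]} (h : β = C c * w ^ 2 + l ^ 2) : l.natDegree ≤ r ∧ w.natDegree ≤ r := by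
  by_contra hcon
  have hm : r < max l.natDegree w.natDegree := by
    by_contra h0
    exact hcon ⟨(le_max_left _ _).trans (not_lt.mp h0), (le_max_right _ _).trans (not_lt.mp h0)⟩
  set m := max l.natDegree w.natDegree with hmdef
  have hcoeff : c * w.coeff m ^ 2 + l.coeff m ^ 2 = 0 := by
    have h1 := congrArg (fun p => p.coeff (2 * m)) h
    simp only [coeff_add, coeff_C_mul] at h1
    rw [coeff_eq_zero_of_natDegree_lt (by omega),
      coeff_pow_of_natDegree_le (le_max_right _ _),
      coeff_pow_of_natDegree_le (le_max_left _ _)] at h1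
    exact h1.symm
  have hw : w.coeff m = 0 := by
    by_contra hw
    refine hc ⟨l.coeff m / w.coeff m, ?_⟩
    have h2 : (2 : k) = 0 := CharTwo.two_eq_zero
    field_simp
    linear_combination hcoeff - l.coeff m ^ 2 * h2
  rw [hw] at hcoeff
  have hl : l.coeff m = 0 := by simpa using hcoeff
  rcases max_choice l.natDegree w.natDegree with h1 | h1
  · rw [← hmdef] at h1
    rw [h1, coeff_natDegree, leadingCoeff_eq_zero] at hl
    rw [hl, natDegree_zero] at h1
    omega
  · rw [← hmdef] at h1
    rw [h1, coeff_natDegree, leadingCoeff_eq_zero] at hw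
    rw [hw, natDegree_zero] at h1
    omega

end Representation

section IntegralElements

open Polynomial

variable {k : Type u} [Field k]

/-- This is `k[u] ∩ k[u⁻¹] = k`: multiplying by `u ^ deg q` turns `q(u⁻¹)` into the reverse of `q`,
and degrees are compared. -/
lemma exists_eq_C_of_mul_eq_one {L : Type*} [Field L] {j₀ j₁ : k[X] →+* L}
    (h₀ : Function.Injective j₀) (hC : ∀ c, j₀ (C c) = j₁ (C c)) (hX : j₀ X * j₁ X = 1)
    {p q : k[X]} (h : j₀ p = j₁ q) : ∃ c, p = C c := by
  have h1 : j₀ (X ^ q.natDegree * p) = j₀ q.reverse := by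
    rw [map_mul, map_pow, h]
    have hu : IsUnit (j₁ X) := .of_mul_eq_one _ ((mul_comm _ _).trans hX)
    let := invertibleOfNonzero (hu.ne_zero)
    have hinv : j₀ X = ⅟(j₁ X) := (invOf_eq_left_inv hX).symm
    have h2 := eval₂_reverse_mul_pow (j₁.comp C) (j₁ X) q
    have h3 : ∀ f, eval₂ (j₁.comp C) (j₁ X) f = j₁ f := fun f => by
      rw [← coe_eval₂RingHom]
      congr 1
      ext <;> simp
    have h4 : ∀ f, eval₂ (j₁.comp C) (j₀ X) f = j₀ f := fun f => by
      rw [← coe_eval₂RingHom]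
      congr 1
      ext <;> simp [hC]
    rw [← hinv, h3, h4] at h2
    rw [← h2, mul_left_comm, ← mul_pow, hX, one_pow, mul_one]
  have h2 := congrArg natDegree (h₀ h1)
  by_cases hp : p = 0
  · exact ⟨0, by rw [hp, C_0]⟩
  rw [natDegree_X_pow_mul _ hp] at h2
  have h3 := reverse_natDegree_le q
  exact ⟨_, eq_C_of_natDegree_eq_zero (by omega)⟩

variable {α β : k[X]} {L : Type*} [Field L] {ε : QuadraticAlgebra k[X] (-β) (-α) →+* L}
  (hε : Function.Injective ε)

include hε in
lemma algebraMap_comp_injective : Function.Injective (ε.comp (algebraMap k[X] _)) :=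
  hε.comp (FaithfulSMul.algebraMap_injective _ _)

/-- In the purely inseparable case, every element of the fraction field has a denominator in
the polynomial ring. -/
lemma exists_mul_eq (h2 : (2 : k[X]) = 0) (hα : α = 0) (hdiv : ∀ ζ, ∃ s t, ε t ≠ 0 ∧ ζ * ε t = ε s)
    (ζ : L) : ∃ d f g, ε (algebraMap _ _ d) ≠ 0 ∧ ζ * ε (algebraMap k[X] _ d) = ε ⟨f, g⟩ := by
  obtain ⟨s, t, ht, h⟩ := hdiv ζ
  -- The square of the denominator is a polynomial in `u`, so multiplying numerator and denominator
  -- by `t` makes the new denominator polynomial.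
  have h3 : t * t = algebraMap k[X] _ (t.re ^ 2 - t.im ^ 2 * β) := by
    refine QuadraticAlgebra.ext ?_ ?_
    · change t.re * t.re + -β * t.im * t.im = t.re ^ 2 - t.im ^ 2 * β
      ring
    · change t.re * t.im + t.im * t.re + -α * t.im * t.im = 0
      linear_combination t.re * t.im * h2 - t.im * t.im * hα
  refine ⟨t.re ^ 2 - t.im ^ 2 * β, (s * t).re, (s * t).im, ?_, ?_⟩
  · rw [← h3, map_mul]
    exact mul_ne_zero ht ht
  · rw [← h3, map_mul, ← mul_assoc, h, ← map_mul]

lemma sq_eq_algebraMap (h2 : (2 : k[X]) = 0) (hα : α = 0) (f g : k[X]) :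
    (⟨f, g⟩ : QuadraticAlgebra k[X] (-β) (-α)) ^ 2 = algebraMap _ _ (f ^ 2 + g ^ 2 * β) := by
  rw [pow_two]
  refine QuadraticAlgebra.ext ?_ ?_
  · change f * f + -β * g * g = f ^ 2 + g ^ 2 * β
    linear_combination -g ^ 2 * β * h2
  · change f * g + g * f + -α * g * g = 0
    linear_combination f * g * h2 - g * g * hα

include hε in
-- The square of any element of `L` lies in the fraction field of `k[u]`; if the element is
-- integral, its square lies in the integrally closed ring `k[u]`.
lemma exists_sq_eq_of_isIntegralElem (h2 : (2 : k[X]) = 0) (hα : α = 0)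
    (hdiv : ∀ ζ, ∃ s t, ε t ≠ 0 ∧ ζ * ε t = ε s) {ζ : L} (hζ : ε.IsIntegralElem ζ) :
    ∃ p, ζ ^ 2 = ε (algebraMap k[X] _ p) := by
  obtain ⟨d, f, g, hd, h⟩ := exists_mul_eq h2 hα hdiv ζ
  let j := ε.comp (algebraMap k[X] (QuadraticAlgebra k[X] (-β) (-α)))
  have hj : Function.Injective j := algebraMap_comp_injective hε
  let : Algebra (QuadraticAlgebra k[X] (-β) (-α)) L := ε.toAlgebra
  let : Algebra k[X] L := j.toAlgebra
  have : IsScalarTower k[X] (QuadraticAlgebra k[X] (-β) (-α)) L := .of_algebraMap_eq' rfl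
  have h3 : IsIntegral k[X] (ζ ^ 2) :=
    (isIntegral_trans (A := QuadraticAlgebra k[X] (-β) (-α)) ζ hζ).pow 2
  let F := FractionRing k[X]
  let : Algebra F L := (IsFractionRing.lift (K := F) hj).toAlgebra
  have : IsScalarTower k[X] F L := .of_algebraMap_eq fun x =>
    (IsFractionRing.lift_algebraMap hj x).symm
  have hd' : algebraMap k[X] F d ≠ 0 := by
    intro h0
    refine hd ?_
    rw [(map_eq_zero_iff _ (IsFractionRing.injective k[X] F)).mp h0, map_zero, map_zero]
  let y : F := algebraMap k[X] F (f ^ 2 + g ^ 2 * β) / algebraMap k[X] F d ^ 2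
  have hy : algebraMap F L y = ζ ^ 2 := by
    rw [map_div₀, map_pow, ← IsScalarTower.algebraMap_apply, ← IsScalarTower.algebraMap_apply]
    refine (div_eq_iff (pow_ne_zero 2 hd)).mpr ?_
    change ε _ = ζ ^ 2 * ε _ ^ 2
    rw [← sq_eq_algebraMap h2 hα, map_pow, ← h, mul_pow]
  rw [← hy, isIntegral_algebraMap_iff (algebraMap F L).injective] at h3
  obtain ⟨p, hp⟩ := IsIntegrallyClosed.isIntegral_iff.mp h3
  refine ⟨p, ?_⟩
  rw [← hy, ← hp, ← IsScalarTower.algebraMap_apply]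
  rfl

include hε in
-- Square roots are unique in characteristic two, so a square `c` forces `ζ` to be constant.
-- Otherwise, squaring `ζ = (f + gω)/d` gives `c d² = f² + g²β`.
lemma exists_eq_C_or_exists_eq_mul_sq_add_sq [CharP k 2] (hα : α = 0)
    (hdiv : ∀ ζ, ∃ s t, ε t ≠ 0 ∧ ζ * ε t = ε s) {ζ : L} {c : k}
    (hζ : ζ ^ 2 = ε (algebraMap k[X] _ (C c))) : (∃ e : k, ζ = ε (algebraMap k[X] _ (C e))) ∨
      ¬ IsSquare c ∧ ∃ w l, β = C c * w ^ 2 + l ^ 2 := by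
  have h2 : (2 : k[X]) = 0 := CharTwo.two_eq_zero
  have h2L : (2 : L) = 0 := by
    rw [← map_ofNat ε, ← map_ofNat (algebraMap k[X] (QuadraticAlgebra k[X] (-β) (-α))), h2,
      map_zero, map_zero]
  have hsq : ∀ x y : L, x ^ 2 = y ^ 2 → x = y := fun x y h => by
    refine sub_eq_zero.mp (pow_eq_zero_iff two_ne_zero |>.mp (?_ : (x - y) ^ 2 = 0))
    linear_combination h + (y ^ 2 - x * y) * h2L
  have hj := algebraMap_comp_injective hε
  by_cases hc : IsSquare c
  · obtain ⟨e, rfl⟩ := hc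
    refine Or.inl ⟨e, hsq _ _ ?_⟩
    rw [hζ, ← map_pow, ← map_pow, ← C_pow, pow_two]
  refine Or.inr ⟨hc, ?_⟩
  obtain ⟨d, f, g, hd, h⟩ := exists_mul_eq h2 hα hdiv ζ
  have hd0 : d ≠ 0 := fun h0 => hd (by rw [h0, map_zero, map_zero])
  have h3 : C c * d ^ 2 = f ^ 2 + g ^ 2 * β := by
    apply hj
    have h4 := congrArg (· ^ 2) h
    simp only [mul_pow] at h4
    rw [hζ, ← map_pow, ← map_pow, ← map_mul, ← map_mul, ← map_pow, sq_eq_algebraMap h2 hα] at h4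
    exact h4
  refine exists_eq_mul_sq_add_sq_of_eq hc hd0 ?_ h3
  -- For `g = 0` the equation becomes `c d² = f²`, which would make `c` a square.
  rintro rfl
  refine hc ?_
  rw [zero_pow two_ne_zero, zero_mul, add_zero] at h3
  obtain ⟨e, rfl⟩ : d ∣ f := (IsIntegrallyClosed.pow_dvd_pow_iff two_ne_zero).mp
    ⟨C c, by rw [← h3, mul_comm]⟩
  have h4 : C c = e ^ 2 := mul_right_cancel₀ (pow_ne_zero 2 hd0) (by rw [h3]; ring)
  refine ⟨e.coeff 0, ?_⟩
  have h5 := congrArg (coeff · 0) h4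
  simpa [pow_two] using h5

end IntegralElements

end

end DoubleCover

/-! ### Global sections of the normalization of the curve. -/

namespace DoubleCover

noncomputable section

section Evaluation

variable {X : Scheme.{u}} {R : CommRingCat.{u}} (j : Spec R ⟶ X) [IsOpenImmersion j] {U : X.Opens}
  (hU : j.opensRange = U)

/-- The evaluation at a point of an affine chart. -/
def chartEval (η : X) (hη : η ∈ U) : R →+* X.residueField η :=
  (inv (chartSections j U hU) ≫ X.evaluation U η hη).hom

lemma chartEval_comp_chartSections (η : X) (hη : η ∈ U) :
    (chartEval j hU η hη).comp (chartSections j U hU).hom = (X.evaluation U η hη).hom := by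
  rw [chartEval, ← CommRingCat.hom_comp, IsIso.hom_inv_id_assoc]

lemma exists_mul_chartEval_eq (η : X) (hη : η ∈ U) (ζ : X.residueField η) :
    ∃ s t : R, chartEval j hU η hη t ≠ 0 ∧ ζ * chartEval j hU η hη t = chartEval j hU η hη s := by
  obtain ⟨x, rfl⟩ : ∃ x : PrimeSpectrum R, j x = η := by
    have : η ∈ j.opensRange := by rw [hU]; exact hη
    exact this
  have h1 : chartEval j hU (j x) hη = (X.residue (j x)).hom.comp (chartStalk j U hU x hη).hom := rfl
  obtain ⟨σ, rfl⟩ := Ideal.Quotient.mk_surjective ζ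
  let := (chartStalk j U hU x hη).hom.toAlgebra
  have h2 : IsLocalization x.asIdeal.primeCompl (X.presheaf.stalk (j x)) :=
    isLocalization_chartStalk j U hU x hη
  obtain ⟨s, t, rfl⟩ := IsLocalization.exists_mk'_eq x.asIdeal.primeCompl σ
  refine ⟨s, t, ?_, ?_⟩
  · have h3 : IsUnit (chartEval j hU (j x) hη t) :=
      (IsLocalization.map_units (X.presheaf.stalk (j x)) t).map (X.residue (j x)).hom
    exact h3.ne_zero
  · have h3 := IsLocalization.mk'_spec (X.presheaf.stalk (j x)) s t
    exact (map_mul (X.residue (j x)).hom _ _).symm.trans (congrArg (X.residue (j x)).hom h3)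

lemma chartEval_injective [IsIntegral X] (hη : genericPoint X ∈ U) :
    Function.Injective (chartEval j hU (genericPoint X) hη) := by
  refine Function.Injective.comp (g := (X.evaluation U (genericPoint X) hη).hom) ?_
    (ConcreteCategory.bijective_of_isIso (inv (chartSections j U hU))).1
  rw [injective_iff_map_eq_zero]
  intro s hs
  have h1 := (X.evaluation_eq_zero_iff_notMem_basicOpen (genericPoint X) hη s).mp hs
  rw [← basicOpen_eq_bot_iff, ← Opens.not_nonempty_iff_eq_bot]
  intro h
  exact h1 (((genericPoint_spec X).mem_open_set_iff (X.basicOpen s).isOpen).mpr (by simpa using h))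

lemma evaluation_res {V : X.Opens} (hVU : V ≤ U) (η : X) (hη : η ∈ V) (s : Γ(X, U)) :
    X.evaluation V η hη (X.presheaf.map (homOfLE hVU).op s) = X.evaluation U η (hVU hη) s :=
  ConcreteCategory.congr_hom
    (congrArg (· ≫ X.residue η) (X.presheaf.germ_res (homOfLE hVU) η hη)) s

lemma chartEval_comp {S : CommRingCat.{u}} (j' : Spec S ⟶ X) [IsOpenImmersion j'] (φ : R ⟶ S)
    (h : Spec.map φ ≫ j = j') {V : X.Opens} (hV : j'.opensRange = V) (hVU : V ≤ U) (η : X)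
    (hη : η ∈ V) (s : R) :
    chartEval j hU η (hVU hη) s = chartEval j' hV η hη (φ.hom s) := by
  have h1 := congrArg (X.evaluation V η hη).hom (map_inv_chartSections_apply j j' φ h hU hV hVU s)
  exact (evaluation_res hVU η hη _).symm.trans h1

lemma chartEval_algebraMap {k : Type u} [Field k] (p : X ⟶ Spec (.of k)) (f : k →+* R)
    (hp : j ≫ p = Spec.map (CommRingCat.ofHom f)) (η : X) (hη : η ∈ U) (c : k) :
    chartEval j hU η hη (f c) = residueMap p η c := by
  have h1 := congrArg (X.evaluation U η hη).hom (toSections_chart j hU p f hp c)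
  refine h1.symm.trans ?_
  have h2 := evaluation_res (le_top : U ≤ ⊤) η hη (toSections p ⊤ c)
  refine Eq.trans ?_ h2
  exact congrArg (X.evaluation U η hη).hom
    (((resₐ p (le_top : U ≤ ⊤)).commutes c).symm)

end Evaluation

section Domain

variable {R : Type*} [CommRing R] [IsDomain R] [IsIntegrallyClosed R] {α β : R}

/-- The square of `x` is the scalar `re² + im² β`, which vanishes only for `x = 0` because `β` is
not a square, even in the fraction field. A product zero therefore forces one of the two scalars to
vanish. -/
lemma isDomain_quadraticAlgebra (h2 : (2 : R) = 0) (hα : α = 0) (hβ : ¬ IsSquare β) :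
    IsDomain (QuadraticAlgebra R (-β) (-α)) := by
  have hN : ∀ x : QuadraticAlgebra R (-β) (-α),
      x * x = algebraMap R _ (x.re ^ 2 + x.im ^ 2 * β) := fun x => by
    refine QuadraticAlgebra.ext ?_ ?_
    · change x.re * x.re + -β * x.im * x.im = x.re ^ 2 + x.im ^ 2 * β
      linear_combination -x.im ^ 2 * β * h2
    · change x.re * x.im + x.im * x.re + -α * x.im * x.im = 0
      linear_combination x.re * x.im * h2 - x.im * x.im * hα
  have h0 : ∀ x : QuadraticAlgebra R (-β) (-α), x.re ^ 2 + x.im ^ 2 * β = 0 → x = 0 := by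
    intro x hx
    by_cases him : x.im = 0
    · rw [him] at hx
      exact QuadraticAlgebra.ext (by simpa using hx) him
    · obtain ⟨e, he⟩ : x.im ∣ x.re := (IsIntegrallyClosed.pow_dvd_pow_iff two_ne_zero).mp
        ⟨-β, by linear_combination hx⟩
      refine absurd ⟨e, mul_left_cancel₀ (pow_ne_zero 2 him) ?_⟩ hβ
      rw [he] at hx
      linear_combination hx - x.im ^ 2 * e ^ 2 * h2
  have : NoZeroDivisors (QuadraticAlgebra R (-β) (-α)) := by
    refine ⟨fun {x y} hxy => ?_⟩
    have h1 : algebraMap R (QuadraticAlgebra R (-β) (-α)) ((x.re ^ 2 + x.im ^ 2 * β) *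
        (y.re ^ 2 + y.im ^ 2 * β)) = 0 := by
      rw [map_mul, ← hN, ← hN, mul_mul_mul_comm, hxy, zero_mul]
    have h3 := (map_eq_zero_iff _ (FaithfulSMul.algebraMap_injective R _)).mp h1
    exact (mul_eq_zero.mp h3).imp (h0 x) (h0 y)
  exact NoZeroDivisors.to_isDomain _

end Domain

section Integral

open MvPolynomial

variable {k : Type u} [Field k] {r : ℕ} (a : homogeneousSubmodule (Fin 2) k r)
    (b : homogeneousSubmodule (Fin 2) k (2 * r)) (hr : 0 < r)

lemma isDomain_chartRing (hred : AlgebraicGeometry.IsReduced (Curve a b)) (h2 : (2 : k) = 0)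
    (ha : a = 0) (i : Fin 2) : IsDomain (ChartRing a b i) := by
  have h2' : (2 : Polynomial k) = 0 := by rw [← map_ofNat Polynomial.C, h2, map_zero]
  have hα : dehom i a.1 = 0 := by rw [ha]; exact map_zero _
  exact isDomain_quadraticAlgebra h2' hα
    (not_isSquare_of_isReduced (isReduced_chartRing a b hred i) h2' hα)

include hr

/-- Two irreducible open charts with nonempty intersection cover the curve. -/
lemma isIntegral_curve (hred : AlgebraicGeometry.IsReduced (Curve a b))
    (hdom : ∀ i, IsDomain (ChartRing a b i)) : AlgebraicGeometry.IsIntegral (Curve a b) := by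
  have hirr : ∀ i, IsIrreducible (chart a b i : Set (Curve a b)) := by
    intro i
    rw [← opensRange_curveChart]
    have := hdom i
    have h1 : IrreducibleSpace (PrimeSpectrum (ChartRing a b i)) := inferInstance
    have h2 := h1.isIrreducible_univ.image (curveChart a b i)
      (curveChart a b i).continuous.continuousOn
    have h3 : ((curveChart a b i).opensRange : Set (Curve a b)) =
        curveChart a b i '' Set.univ := Set.image_univ.symm
    rw [h3]
    exact h2
  have hne : (chart a b 0 ⊓ chart a b 1 : (Curve a b).Opens).1.Nonempty := by
    rw [← opensRange_overlapChart]
    have h1 : Nontrivial (OverlapRing a b) :=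
      (laurentMap_pairHom_bijective a b).1.nontrivial
    exact ⟨_, (Nonempty.some (inferInstance : Nonempty (PrimeSpectrum (OverlapRing a b)))), rfl⟩
  have hpre : PreirreducibleSpace (Curve a b) := by
    refine ⟨?_⟩
    have h1 : (Set.univ : Set (Curve a b)) ⊆ closure (chart a b 0 : Set (Curve a b)) := by
      intro x _
      rw [mem_closure_iff]
      intro V hV hx
      obtain ⟨i, hi⟩ := exists_mem_chart a b hr x
      obtain ⟨y, hy⟩ := hne
      obtain ⟨z, _, hz1, hz2⟩ := (hirr i).2 V (chart a b 0 ⊓ chart a b 1 : (Curve a b).Opens).1 hV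
        (chart a b 0 ⊓ chart a b 1).2 ⟨x, hi, hx⟩
        ⟨y, by fin_cases i; exacts [hy.1, hy.2], hy⟩
      exact ⟨z, hz1, hz2.1⟩
    rw [← (Set.univ_subset_iff.mp h1)]
    exact (hirr 0).2.closure
  have : IrreducibleSpace (Curve a b) := { hpre with toNonempty := ⟨hne.some⟩ }
  exact isIntegral_of_irreducibleSpace_of_isReduced _

end Integral

section GlobalSections

open MvPolynomial

variable {k : Type u} [Field k] {r : ℕ} (a : homogeneousSubmodule (Fin 2) k r)
    (b : homogeneousSubmodule (Fin 2) k (2 * r)) [AlgebraicGeometry.IsIntegral (Curve a b)]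

lemma genericPoint_mem_overlap : genericPoint (Curve a b) ∈ chart a b 0 ⊓ chart a b 1 := by
  have h1 : Nontrivial (OverlapRing a b) := (laurentMap_pairHom_bijective a b).1.nontrivial
  rw [← opensRange_overlapChart]
  refine ((genericPoint_spec (Curve a b)).mem_open_set_iff (overlapChart a b).opensRange.isOpen).mpr
    ⟨_, trivial, (Nonempty.some (inferInstance : Nonempty (PrimeSpectrum (OverlapRing a b)))), rfl⟩

omit [AlgebraicGeometry.IsIntegral (Curve a b)] in
lemma chart_overlap_le (i : Fin 2) : chart a b 0 ⊓ chart a b 1 ≤ chart a b i := by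
  fin_cases i
  exacts [inf_le_left, inf_le_right]

/-- The embedding of the ring of a chart into the function field. -/
def curveEmbedding (i : Fin 2) : ChartRing a b i →+* genericField (Curve a b) :=
  chartEval (curveChart a b i) (opensRange_curveChart a b i) (genericPoint (Curve a b))
    (chart_overlap_le a b i (genericPoint_mem_overlap a b))

lemma curveEmbedding_injective (i : Fin 2) : Function.Injective (curveEmbedding a b i) :=
  chartEval_injective _ _ _

lemma exists_mul_curveEmbedding_eq (i : Fin 2) (ζ : genericField (Curve a b)) :
    ∃ s t, curveEmbedding a b i t ≠ 0 ∧ ζ * curveEmbedding a b i t = curveEmbedding a b i s :=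
  exists_mul_chartEval_eq (curveChart a b i) (opensRange_curveChart a b i) _
    (chart_overlap_le a b i (genericPoint_mem_overlap a b)) ζ

lemma curveEmbedding_C (i : Fin 2) (c : k) :
    curveEmbedding a b i (algebraMap (Polynomial k) _ (Polynomial.C c)) =
      residueMap (curveOver a b) (genericPoint (Curve a b)) c :=
  chartEval_algebraMap (curveChart a b i) (opensRange_curveChart a b i) (curveOver a b)
    (algebraMap k (ChartRing a b i)) (curveChart_over a b i) _ _ c

lemma curveEmbedding_X_mul :
    curveEmbedding a b 0 (algebraMap (Polynomial k) _ Polynomial.X) *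
      curveEmbedding a b 1 (algebraMap (Polynomial k) _ Polynomial.X) = 1 := by
  have h : ∀ i s, curveEmbedding a b i s = chartEval (overlapChart a b)
      (opensRange_overlapChart a b) _ (genericPoint_mem_overlap a b) (overlapMap a b i s) :=
    fun i s => chartEval_comp (curveChart a b i) (opensRange_curveChart a b i) (overlapChart a b)
      (CommRingCat.ofHom (overlapMap a b i)) (overlapMap_curveChart a b i)
      (opensRange_overlapChart a b) (chart_overlap_le a b i) _ (genericPoint_mem_overlap a b) s
  rw [h, h]
  exact (map_mul _ _ _).symm.trans ((congrArg _ (overlapMap_X_mul a b)).trans (map_one _))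

lemma isIntegralElem_curveEmbedding (i : Fin 2) (z : Γ(normalization (Curve a b), ⊤)) :
    (curveEmbedding a b i).IsIntegralElem (normalizationEval (Curve a b) z) := by
  have h1 := isIntegralElem_normalizationEval (Curve a b) (U := chart a b i)
    (Proj.isAffineOpen_basicOpen _ _ (coordinateMap_X_mem a b i) Nat.one_pos)
    (chart_overlap_le a b i (genericPoint_mem_overlap a b)) z
  rw [← chartEval_comp_chartSections (curveChart a b i) (opensRange_curveChart a b i)] at h1
  exact h1.of_comp

/-- The new sections, if any, are square roots of nonsquare constants. -/
lemma globalSectionsEqBase_normalization_iff [CharP k 2] (ha : a = 0)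
    (hβ : ¬ IsSquare (dehom 0 b.1)) :
    GlobalSectionsEqBase (normalizationTo (Curve a b) ≫ curveOver a b) ↔
      ¬ ∃ (c : k) (w l : Polynomial k), l.natDegree ≤ r ∧ w.natDegree ≤ r ∧
        dehom 0 b.1 = Polynomial.C c * w ^ 2 + l ^ 2 := by
  have h2 : (2 : Polynomial k) = 0 := CharTwo.two_eq_zero
  have hα : ∀ i, dehom i a.1 = 0 := fun i => by rw [ha]; exact map_zero _
  have hinj : Function.Injective
      (algebraMap k (Sections (normalizationTo (Curve a b) ≫ curveOver a b) ⊤)) := by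
    refine Function.Injective.of_comp (f := normalizationEval (Curve a b)) ?_
    have : normalizationEval (Curve a b) ∘
        (algebraMap k (Sections (normalizationTo (Curve a b) ≫ curveOver a b) ⊤)) =
        residueMap (curveOver a b) (genericPoint (Curve a b)) :=
      funext (normalizationEval_toSections (Curve a b) (curveOver a b))
    rw [this]
    exact RingHom.injective _
  constructor
  · rintro H ⟨c, w, l, -, -, h⟩
    have hw : curveEmbedding a b 0 (algebraMap (Polynomial k) _ w) ≠ 0 := by
      intro hw
      have hw0 := (map_eq_zero_iff _ (algebraMap_comp_injective
        (curveEmbedding_injective a b 0))).mp hw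
      exact hβ ⟨l, by rw [h, hw0]; ring⟩
    let : Algebra k (genericField (Curve a b)) :=
      (residueMap (curveOver a b) (genericPoint (Curve a b))).toAlgebra
    -- Since `(l + ω)² = l² + β = c w²`, this quotient is a square root of `c`.
    let y := curveEmbedding a b 0 ⟨l, 1⟩ / curveEmbedding a b 0 (algebraMap (Polynomial k) _ w)
    have hy : y * y = c • 1 + (0 : k) • y := by
      rw [zero_smul, add_zero, Algebra.smul_def, mul_one, ← pow_two, div_pow,
        div_eq_iff (pow_ne_zero 2 hw), ← map_pow, sq_eq_algebraMap h2 (hα 0)]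
      refine Eq.trans ?_ (congrArg (· * _) (curveEmbedding_C a b 0 c))
      rw [← map_pow, ← map_pow, ← map_mul, ← map_mul]
      congr 2
      rw [h]
      linear_combination l ^ 2 * h2
    let f : QuadraticAlgebra k c 0 →ₐ[k] genericField (Curve a b) := QuadraticAlgebra.lift ⟨y, hy⟩
    obtain ⟨g, hg⟩ := exists_ringHom_sections_normalization (Curve a b) (curveOver a b)
      (QuadraticAlgebra k c 0) f.toRingHom f.commutes
    obtain ⟨e, he⟩ := H.2 (g QuadraticAlgebra.omega)
    have hc : e ^ 2 = c := by
      apply hinj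
      have h3 : (QuadraticAlgebra.omega : QuadraticAlgebra k c 0) ^ 2 = algebraMap k _ c := by
        rw [pow_two, QuadraticAlgebra.omega_mul_omega_eq_algebraMap, map_zero, zero_mul, add_zero]
      rw [map_pow, he]
      exact (map_pow g _ 2).symm.trans ((congrArg g h3).trans (hg c))
    -- If the square root of `c` comes from `e ∈ k`, then `β = (e w + l)²`.
    refine hβ ⟨Polynomial.C e * w + l, ?_⟩
    rw [h, ← hc, Polynomial.C_pow]
    linear_combination -Polynomial.C e * w * l * h2
  · intro H
    refine ⟨hinj, fun z => ?_⟩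
    let ζ := normalizationEval (Curve a b) z
    obtain ⟨p, hp⟩ := exists_sq_eq_of_isIntegralElem (curveEmbedding_injective a b 0) h2 (hα 0)
      (exists_mul_curveEmbedding_eq a b 0) (isIntegralElem_curveEmbedding a b 0 z)
    obtain ⟨q, hq⟩ := exists_sq_eq_of_isIntegralElem (curveEmbedding_injective a b 1) h2 (hα 1)
      (exists_mul_curveEmbedding_eq a b 1) (isIntegralElem_curveEmbedding a b 1 z)
    -- On the two charts `ζ²` is a polynomial in `u` and in `u⁻¹` respectively, hence a constant.
    obtain ⟨c, rfl⟩ := exists_eq_C_of_mul_eq_one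
      (j₁ := (curveEmbedding a b 1).comp (algebraMap (Polynomial k) _))
      (algebraMap_comp_injective (curveEmbedding_injective a b 0))
      (fun c => (curveEmbedding_C a b 0 c).trans (curveEmbedding_C a b 1 c).symm)
      (curveEmbedding_X_mul a b) (hp.symm.trans hq)
    rcases exists_eq_C_or_exists_eq_mul_sq_add_sq (curveEmbedding_injective a b 0) (hα 0)
      (exists_mul_curveEmbedding_eq a b 0) hp with ⟨e, he⟩ | ⟨hc, w, l, h⟩
    · refine ⟨e, normalizationEval_injective (Curve a b) ?_⟩
      exact (normalizationEval_toSections (Curve a b) (curveOver a b) e).trans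
        ((curveEmbedding_C a b 0 e).symm.trans he.symm)
    · obtain ⟨hl, hw⟩ := natDegree_le_of_eq hc (natDegree_dehom_le b.2 0) h
      exact absurd ⟨c, w, l, hl, hw, h⟩ H

end GlobalSections

end

end DoubleCover

namespace DoubleCover

noncomputable section

/-! ### Sums over the closed points of the projective line -/

section Sums

open MvPolynomial

variable {k : Type u} [Field k]

lemma finsum_closedPoints (f : P1 k → ℕ) :
    ∑ᶠ q ∈ closedPoints (P1 k), f q = ∑ᶠ P : Place k, f (placePoint P) := by
  rw [← finsum_mem_eq_of_bijOn placePoint bijOn_placePoint (f := fun P => f (placePoint P))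
    fun _ _ => rfl, finsum_mem_univ]

lemma forall_closedPoints {p : P1 k → Prop} (h : ∀ P : Place k, p (placePoint P)) :
    ∀ q ∈ closedPoints (P1 k), p q := by
  intro q hq
  obtain ⟨P, -, rfl⟩ := bijOn_placePoint.surjOn hq
  exact h P

lemma finite_closedPoints {p : P1 k → Prop} (h : {P : Place k | p (placePoint P)}.Finite) :
    {q ∈ closedPoints (P1 k) | p q}.Finite := by
  refine (h.image placePoint).subset ?_
  rintro q ⟨hq, hp⟩
  obtain ⟨P, -, rfl⟩ := bijOn_placePoint.surjOn hq
  exact ⟨P, hp, rfl⟩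

lemma finite_of_sum_mul_placeDegree_le {g : Place k → ℕ} {n : ℕ}
    (h : ∀ s : Finset (Place k), ∑ P ∈ s, g P * placeDegree P ≤ n) : {P | g P ≠ 0}.Finite :=
  (finite_support_of_sum_le h).subset fun P hP => mul_ne_zero hP (placeDegree_pos P).ne'

variable {r : ℕ} (a : homogeneousSubmodule (Fin 2) k r) (b : homogeneousSubmodule (Fin 2) k (2 * r))
  (hr : 0 < r)

lemma discr_mem : a.1 ^ 2 - 4 * b.1 ∈ homogeneousSubmodule (Fin 2) k (2 * r) := by
  refine sub_mem ?_ ?_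
  · have := SetLike.pow_mem_graded (A := homogeneousSubmodule (Fin 2) k) 2 a.2
    simpa using this
  · have h : (4 : MvPolynomial (Fin 2) k) * b.1 = (4 : k) • b.1 := by
      rw [smul_eq_C_mul, map_ofNat]
    rw [h]
    exact Submodule.smul_mem _ _ b.2

lemma dehom_discr (i : Fin 2) :
    dehom i (a.1 ^ 2 - 4 * b.1) = dehom i a.1 ^ 2 - 4 * dehom i b.1 := by
  rw [map_sub, map_pow, map_mul, map_ofNat]

/-! ### Nonzero discriminant -/

section DiscrNeZero

variable {a b}

lemma pow_dvd_placeLocal_discr (P : Place k) {n : ℕ}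
    (hn : (n : ℕ∞) ≤ lam (curveToP1 a b hr) (placePoint P)) :
    placePoly P ^ n ∣ placeLocal (2 * r) P (dehom 0 a.1 ^ 2 - 4 * dehom 0 b.1) := by
  have h := pow_dvd_of_le_lam a b hr P hn
  rwa [← dehom_discr, dehom_placeChart (discr_mem a b), dehom_discr] at h

lemma natDegree_discr_le : (dehom 0 a.1 ^ 2 - 4 * dehom 0 b.1).natDegree ≤ 2 * r := by
  rw [← dehom_discr]
  exact natDegree_dehom_le (discr_mem a b) 0

lemma lam_le_of_discr_ne_zero (hd : dehom 0 a.1 ^ 2 - 4 * dehom 0 b.1 ≠ 0) (P : Place k) :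
    lam (curveToP1 a b hr) (placePoint P) ≤ 2 * (r : ℕ∞) := by
  refine ENat.forall_natCast_le_iff_le.mp fun n hn => ?_
  have h := mul_placeDegree_le hd natDegree_discr_le (pow_dvd_placeLocal_discr hr P hn)
  exact_mod_cast (Nat.le_mul_of_pos_right n (placeDegree_pos P)).trans h

lemma sum_lam_mul_placeDegree_le (hd : dehom 0 a.1 ^ 2 - 4 * dehom 0 b.1 ≠ 0)
    (s : Finset (Place k)) :
    ∑ P ∈ s, (lam (curveToP1 a b hr) (placePoint P)).toNat * placeDegree P ≤ 2 * r :=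
  sum_mul_placeDegree_le hd natDegree_discr_le
    (fun P => pow_dvd_placeLocal_discr hr P (ENat.natCast_toNat_le_self _)) s

end DiscrNeZero

/-! ### The inseparable case -/

section Inseparable

variable {a b} [CharP k 2] (ha : a = 0)
include ha

lemma natCast_le_lam_iff (P : Place k) {n : ℕ} : (n : ℕ∞) ≤ lam (curveToP1 a b hr) (placePoint P) ↔
    ∃ x, placePoly P ^ n ∣ placeLocal (2 * r) P (dehom 0 b.1) + x ^ 2 := by
  rw [le_lam_placePoint_iff a b hr CharTwo.two_eq_zero ha, dehom_placeChart b.2]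

lemma exists_pow_dvd_of_two_mul_le (P : Place k) {m : ℕ}
    (hm : (2 * m : ℕ∞) ≤ lam (curveToP1 a b hr) (placePoint P)) :
    ∃ x, placePoly P ^ (2 * m) ∣ placeLocal (2 * r) P (dehom 0 b.1) + x ^ 2 :=
  (natCast_le_lam_iff hr ha P).mp (by exact_mod_cast hm)

/-- The convention `toNat ⊤ = 0` is harmless, as only `toNat ≤` is used. -/
lemma exists_pow_dvd_half_lam (P : Place k) :
    ∃ x, placePoly P ^ (2 * ((lam (curveToP1 a b hr) (placePoint P)).toNat / 2)) ∣
      placeLocal (2 * r) P (dehom 0 b.1) + x ^ 2 :=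
  (natCast_le_lam_iff hr ha P).mp
    (le_trans (by exact_mod_cast Nat.mul_div_le _ 2) (ENat.natCast_toNat_le_self _))

variable (hβ : ¬ IsSquare (dehom 0 b.1))
include hβ

lemma exists_lam_eq {c : k} {w l : Polynomial k} (hl : l.natDegree ≤ r) (hw : w.natDegree ≤ r)
    (h : dehom 0 b.1 = Polynomial.C c * w ^ 2 + l ^ 2) {P : Place k} (hP : placeDegree P = 1) :
    ∃ e ≤ r, lam (curveToP1 a b hr) (placePoint P) = 2 * (e : ℕ∞) := by
  obtain ⟨e, he, H⟩ := exists_forall_pow_dvd_iff hβ hl hw h hP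
  refine ⟨e, he, ENat.eq_of_forall_natCast_le_iff fun n => ?_⟩
  rw [natCast_le_lam_iff hr ha P, H]
  norm_cast

/-- A value above `2r` would allow `m = r` at `P` alone. The bound `2r deg P ≤ 2r` then makes `P`
rational and is attained, so `β = c w² + l²` and the multiplicity is twice an order of vanishing
that is at most `r`. -/
lemma lam_le_of_char_two (P : Place k) :
    lam (curveToP1 a b hr) (placePoint P) ≤ 2 * (r : ℕ∞) := by
  classical
  by_contra! hlt
  obtain ⟨x, hx⟩ := exists_pow_dvd_of_two_mul_le hr ha P hlt.le
  have h1 := sum_sq_mul_placeDegree_le hβ (natDegree_dehom_le b.2 0)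
    (m := fun Q => if Q = P then r else 0)
    (fun Q => by
      by_cases hQ : Q = P
      · subst hQ
        exact ⟨x, by simpa using hx⟩
      · exact ⟨0, by simp [hQ]⟩) {P}
  simp only [Finset.sum_singleton, if_true] at h1
  have hP : placeDegree P = 1 :=
    le_antisymm (Nat.le_of_mul_le_mul_left (by simpa using h1) (by omega : 0 < 2 * r))
      (placeDegree_pos P)
  obtain ⟨c, w, l, hl, hw, h⟩ := exists_eq_mul_sq_add_sq (natDegree_dehom_le b.2 0)
    (s := {P}) (m := fun _ => r) (by simpa using ⟨x, hx⟩) (by simp [hP])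
  obtain ⟨e, he, h2⟩ := exists_lam_eq hr ha hβ hl hw h hP
  rw [h2] at hlt
  exact absurd hlt (not_lt.mpr (by exact_mod_cast Nat.mul_le_mul_left 2 he))

lemma sum_half_lam_le (s : Finset (Place k)) :
    ∑ P ∈ s, 2 * ((lam (curveToP1 a b hr) (placePoint P)).toNat / 2) * placeDegree P ≤ 2 * r :=
  sum_sq_mul_placeDegree_le hβ (natDegree_dehom_le b.2 0) (exists_pow_dvd_half_lam hr ha) s

/-- The sum is even and at most `2r`, and the value `2r` would produce the excluded form of `β`. -/
lemma finsum_half_lam_le_of_not_exists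
    (hno : ¬ ∃ (c : k) (w l : Polynomial k), l.natDegree ≤ r ∧ w.natDegree ≤ r ∧
      dehom 0 b.1 = Polynomial.C c * w ^ 2 + l ^ 2) :
    ∑ᶠ P : Place k, 2 * ((lam (curveToP1 a b hr) (placePoint P)).toNat / 2) * placeDegree P ≤
      2 * r - 2 := by
  refine finsum_le_of_sum_le fun s => ?_
  have h1 := sum_half_lam_le hr ha hβ s
  have h2 : ∑ P ∈ s, (lam (curveToP1 a b hr) (placePoint P)).toNat / 2 * placeDegree P ≠ r :=
    fun h => hno (exists_eq_mul_sq_add_sq (natDegree_dehom_le b.2 0)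
      (fun P _ => exists_pow_dvd_half_lam hr ha P) h)
  simp only [mul_assoc] at h1 ⊢
  rw [← Finset.mul_sum] at h1 ⊢
  omega

/-- As a section of `𝒪(r)`, `w` has zeros of total degree exactly `r`, and a zero of order `e`
forces `[λ/2] ≥ e`. -/
lemma finsum_half_lam_eq {c : k} {w l : Polynomial k} (hl : l.natDegree ≤ r)
    (hw : w.natDegree ≤ r) (h : dehom 0 b.1 = Polynomial.C c * w ^ 2 + l ^ 2) :
    ∑ᶠ P : Place k, 2 * ((lam (curveToP1 a b hr) (placePoint P)).toNat / 2) * placeDegree P =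
      2 * r := by
  classical
  refine le_antisymm (finsum_le_of_sum_le (sum_half_lam_le hr ha hβ)) ?_
  have hw0 : w ≠ 0 := by
    rintro rfl
    exact hβ ⟨l, by rw [h]; ring⟩
  obtain ⟨s, e, he, hs⟩ := exists_sum_mul_placeDegree hw0 hw
  have hle : ∀ P ∈ s, e P ≤ (lam (curveToP1 a b hr) (placePoint P)).toNat / 2 := by
    intro P hP
    have h1 := (natCast_le_lam_iff hr ha P).mpr (exists_pow_dvd_of_eq hl hw h (he P hP))
    have h2 := ENat.toNat_le_toNat h1
      ((lam_le_of_char_two hr ha hβ P).trans_lt (ENat.natCast_lt_top (2 * r))).ne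
    rw [ENat.toNat_natCast] at h2
    omega
  calc 2 * r = ∑ P ∈ s, 2 * e P * placeDegree P := by
        simp only [mul_assoc]
        rw [← Finset.mul_sum, hs]
    _ ≤ ∑ P ∈ s, 2 * ((lam (curveToP1 a b hr) (placePoint P)).toNat / 2) * placeDegree P :=
        Finset.sum_le_sum fun P hP =>
          Nat.mul_le_mul_right _ (Nat.mul_le_mul_left 2 (hle P hP))
    _ ≤ _ := by
        -- The finite sum is compared with the sum over all places through a finite set containing
        -- both `s` and the support.
        have hfin := finite_support_of_sum_le (sum_half_lam_le hr ha hβ)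
        rw [finsum_eq_sum_of_support_subset (s := hfin.toFinset ∪ s) _ (by
          intro P hP; simpa using Or.inl hP)]
        exact Finset.sum_le_sum_of_subset Finset.subset_union_right

end Inseparable

end Sums

end

end DoubleCover

/-! ### Assembly of the four assertions. -/

open DoubleCover in
theorem mainTheorem11 {k : Type u} [Field k] {r : ℕ} (hr : 0 < r)
    (a : MvPolynomial.homogeneousSubmodule (Fin 2) k r)
    (b : MvPolynomial.homogeneousSubmodule (Fin 2) k (2 * r))
    (hred : AlgebraicGeometry.IsReduced (DoubleCover.Curve a b)) :
    -- the projection is a finite flat morphism of `k`-schemes of degree 2,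
    -- `H⁰(Θ, 𝒪) = k` and `p_a(Θ) = r - 1`
    (DoubleCover.curveToP1 a b hr ≫ DoubleCover.P1Over k = DoubleCover.curveOver a b ∧
      IsFinite (DoubleCover.curveToP1 a b hr) ∧
      Flat (DoubleCover.curveToP1 a b hr) ∧
      (∀ q : DoubleCover.P1 k, (DoubleCover.curveToP1 a b hr).finrank q = 2) ∧
      DoubleCover.GlobalSectionsEqBase (DoubleCover.curveOver a b) ∧
      DoubleCover.HasArithmeticGenus (DoubleCover.curveOver a b)
        (DoubleCover.chart a b 0) (DoubleCover.chart a b 1) ((r : ℤ) - 1)) ∧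
    -- the generically étale case
    (DoubleCover.GenericallyEtale (DoubleCover.curveToP1 a b hr) →
      {q ∈ closedPoints (DoubleCover.P1 k) |
        DoubleCover.lam (DoubleCover.curveToP1 a b hr) q ≠ 0}.Finite ∧
      ∑ᶠ q ∈ closedPoints (DoubleCover.P1 k),
        (DoubleCover.lam (DoubleCover.curveToP1 a b hr) q).toNat *
          DoubleCover.residueDegree (DoubleCover.P1Over k) q ≤ 2 * r) ∧
    -- the purely inseparable case
    (UniversallyInjective (DoubleCover.curveToP1 a b hr) →
      {q ∈ closedPoints (DoubleCover.P1 k) |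
        2 ≤ DoubleCover.lam (DoubleCover.curveToP1 a b hr) q}.Finite ∧
      (DoubleCover.GlobalSectionsEqBase
          (DoubleCover.normalizationTo (DoubleCover.Curve a b) ≫ DoubleCover.curveOver a b) →
        ((∑ᶠ q ∈ closedPoints (DoubleCover.P1 k),
          2 * ((DoubleCover.lam (DoubleCover.curveToP1 a b hr) q).toNat / 2) *
            DoubleCover.residueDegree (DoubleCover.P1Over k) q : ℕ) : ℤ) ≤ 2 * (r : ℤ) - 2) ∧
      (¬ DoubleCover.GlobalSectionsEqBase
          (DoubleCover.normalizationTo (DoubleCover.Curve a b) ≫ DoubleCover.curveOver a b) →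
        ∑ᶠ q ∈ closedPoints (DoubleCover.P1 k),
          2 * ((DoubleCover.lam (DoubleCover.curveToP1 a b hr) q).toNat / 2) *
            DoubleCover.residueDegree (DoubleCover.P1Over k) q = 2 * r ∧
        ∀ q ∈ closedPoints (DoubleCover.P1 k),
          Function.Bijective (DoubleCover.residueMap (DoubleCover.P1Over k) q) →
            ∃ m : ℕ, DoubleCover.lam (DoubleCover.curveToP1 a b hr) q = 2 * (m : ℕ∞))) ∧
    -- in all cases
    (∀ q ∈ closedPoints (DoubleCover.P1 k),
      DoubleCover.lam (DoubleCover.curveToP1 a b hr) q ≤ 2 * (r : ℕ∞)) := by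
  have hchar : (2 : k) = 0 → CharP k 2 := fun h => CharTwo.of_one_ne_zero_of_two_eq_zero one_ne_zero h
  refine ⟨⟨curveToP1_over a b hr, isFinite_curveToP1 a b hr, flat_curveToP1 a b hr,
    finrank_curveToP1 a b hr, globalSectionsEqBase a b hr, hasArithmeticGenus a b hr⟩,
    fun het => ?_, fun hui => ?_, forall_closedPoints fun P => ?_⟩
  · have hd := discr_ne_zero_of_genericallyEtale a b hr het
    refine ⟨finite_closedPoints ?_, ?_⟩
    · refine (finite_of_sum_mul_placeDegree_le (sum_lam_mul_placeDegree_le hr hd)).subset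
        fun P hP => ?_
      -- `toNat` also vanishes at `⊤`; the bound by `2r` rules this out.
      exact fun h => (ENat.toNat_eq_zero.mp h).elim hP ((lam_le_of_discr_ne_zero hr hd P).trans_lt (ENat.natCast_lt_top (2 * r))).ne
    · rw [finsum_closedPoints]
      simp only [residueDegree_placePoint]
      exact finsum_le_of_sum_le (sum_lam_mul_placeDegree_le hr hd)
  · obtain ⟨h2, ha, hβ⟩ :=
      of_discr_eq_zero a b hred (discr_eq_zero_of_universallyInjective a b hr hui)
    have := hchar h2
    have := isIntegral_curve a b hr hred (isDomain_chartRing a b hred h2 ha)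
    have hiff := globalSectionsEqBase_normalization_iff a b ha hβ
    rw [finsum_closedPoints]
    simp only [residueDegree_placePoint]
    refine ⟨finite_closedPoints ?_, fun h => ?_, fun h => ?_⟩
    · refine (finite_of_sum_mul_placeDegree_le (g := fun P =>
        2 * ((lam (curveToP1 a b hr) (placePoint P)).toNat / 2)) (sum_half_lam_le hr ha hβ)).subset
        fun P hP => ?_
      have h := ENat.toNat_le_toNat (show ((2 : ℕ) : ℕ∞) ≤ _ from hP)
        ((lam_le_of_char_two hr ha hβ P).trans_lt (ENat.natCast_lt_top (2 * r))).ne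
      rw [ENat.toNat_natCast] at h
      exact (Nat.mul_pos two_pos (Nat.div_pos h two_pos)).ne'
    · have := finsum_half_lam_le_of_not_exists hr ha hβ (hiff.mp h)
      omega
    · obtain ⟨c, w, l, hl, hw, he⟩ := not_not.mp fun hn => h (hiff.mpr hn)
      refine ⟨finsum_half_lam_eq hr ha hβ hl hw he, forall_closedPoints fun P hP => ?_⟩
      obtain ⟨e, -, he⟩ := exists_lam_eq hr ha hβ hl hw he
        ((residueDegree_placePoint P).symm.trans (residueDegree_eq_one _ _ hP))
      exact ⟨e, he⟩
  -- The last bound depends only on whether the discriminant vanishes, and vanishing already gives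
  -- the inseparable situation.
  · by_cases hd : dehom 0 a.1 ^ 2 - 4 * dehom 0 b.1 = 0
    · obtain ⟨h2, ha, hβ⟩ := of_discr_eq_zero a b hred hd
      have := hchar h2
      exact lam_le_of_char_two hr ha hβ P
    · exact lam_le_of_discr_ne_zero hr hd P
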